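/- **Conventions.** A *double category* $\mathbb{D}$ is a normalized pseudo double category: categories $\mathbb{D}_0$ (objects and arrows) and $\mathbb{D}_1$ (proarrows and cells), functors $\mathsf{src},\mathsf{tgt}:\mathbb{D}_1\to\mathbb{D}_0$, $y:\mathbb{D}_0\to\mathbb{D}_1$ with $\mathsf{src}\,y=\mathsf{tgt}\,y=\mathrm{id}$, and $\otimes:\mathbb{D}_1\times_{\mathbb{D}_0}\mathbb{D}_1\to\mathbb{D}_1$ compatible with source and target, which is associative up to a coherent natural globular isomorphism and has $y$ as a strict unit (the unit comparisons are identities). A *lax double functor* $F:\mathbb{C}\to\mathbb{D}$ consists of functors $F_0:\mathbb{C}_0\to\mathbb{D}_0$ and $F_1:\mathbb{C}_1\to\mathbb{D}_1$ that strictly commute with $\mathsf{src}$ and $\mathsf{tgt}$, together with natural globular cells $\iota_A:y(F_0A)\to F_1(yA)$ and $\phi_{M,N}:F_1M\otimes F_1N\to F_1(M\otimes N)$ satisfying the usual associativity and unit equations. It is *pseudo* if all $\iota_A$ and $\phi_{M,N}$ are invertible, and *strict* if they are identities. A *vertical transformation* $\alpha:F\Rightarrow G$ consists of natural transformations $F_0\Rightarrow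 G_0$ and $F_1\Rightarrow G_1$ that are compatible with $\mathsf{src}$, $\mathsf{tgt}$, $\iota$ and $\phi$. Let $\mathbf{Dbl}_\ell$, $\mathbf{Dbl}$ and $\mathbf{Dbl}_s$ be the 2-categories of double categories (of a fixed size), whose 1-cells are respectively the lax, the pseudo and the strict double functors and whose 2-cells are the vertical transformations. In a 2-category, let $P:E\to B$ be a 1-cell. A 2-cell $\alpha:e'\Rightarrow e:X\to E$ is *$P$-Cartesian* if for all $x:Y\to X$, $e'':Y\to E$, $\xi:e''\Rightarrow e x$ and $\gamma:Pe''\Rightarrow Pe'x$ with $P\xi=(P\alpha x)\circ\gamma$, there is a unique $\zeta:e''\Rightarrow e'x$ with $\xi=(\alpha x)\circ\zeta$ and $P\zeta=\gamma$. The 1-cell $P$ is an *internal (Street) fibration* if for all $e:X\to E$, $b:X\to B$ and $\beta:b\Rightarrow Pe$ there are $e':X\to E$ with $Pe'=b$ and a $P$-Cartesian $\alpha:e'\Rightarrow e$ with $P\alpha=\beta$. Let $p:\mathcal{X}\to\mathcal{S}$ be a functor. An arrow $f:e'\to e$ of $\mathcal{X}$ is *Cartesian* if for every $g:e''\to e$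 and every $w:p(e'')\to p(e')$ with $p(g)=p(f)\circ w$ there is a unique $h:e''\to e'$ with $g=f\circ h$ and $p(h)=w$. The functor $p$ is a *fibration* if every arrow $u:b\to p(e)$ is the image under $p$ of a Cartesian arrow with codomain $e$. A *cleavage* is a choice of such a Cartesian lift for each pair $(u,e)$; it need not be split or normal. A functor between total categories of cloven fibrations, lying over a functor between the bases, is *cleavage-preserving* if it takes chosen lifts to chosen lifts. **Theorem.** Let $P:\mathbb{E}\to\mathbb{B}$ be a pseudo double functor between double categories. Consider the conditions: 1. $P_0:\mathbb{E}_0\to\mathbb{B}_0$ and $P_1:\mathbb{E}_1\to\mathbb{B}_1$ are fibrations; 2. cleavages of $P_0$ and $P_1$ can be chosen such that $\mathsf{src}_{\mathbb{E}}$ and $\mathsf{tgt}_{\mathbb{E}}$ are cleavage-preserving; 3. $y_{\mathbb{E}}$ and $\otimes_{\mathbb{E}}$ preserve Cartesian arrows, those of the domain of $\otimes_{\mathbb{E}}$ being Cartesian with respect to $P_1\times_{P_0}P_1:\mathbb{E}_1\times_{\mathbb{E}_0}\mathbb{E}_1\to\mathbb{B}_1\times_{\mathbb{B}_0}\mathbb{B}_1$.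 Then: - **(L)** $P$ is an internal fibration in $\mathbf{Dbl}_\ell$ if and only if 1 and 2 hold. - **(P)** $P$ is an internal fibration in $\mathbf{Dbl}$ if and only if 1, 2 and 3 hold. - **(S)** If $P$ is strict, then $P$ is an internal fibration in $\mathbf{Dbl}_s$ if and only if 1 holds and cleavages of $P_0$ and $P_1$ can be chosen such that $\mathsf{src}_{\mathbb{E}}$, $\mathsf{tgt}_{\mathbb{E}}$, $y_{\mathbb{E}}$ and $\otimes_{\mathbb{E}}$ are all cleavage-preserving, where $P_1\times_{P_0}P_1$ carries the pointwise cleavage (a pair of arrows is chosen when both of its components are chosen). -/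

import Mathlib

open CategoryTheory

attribute [-instance] CategoryTheory.catToReflQuiver

universe v u

/-! ### Pseudo double categories -/

/-- The proarrows of a double category, with their external source and target: the objects of the
category `D₁`. -/
structure Proarrow {Obj : Type*} (Hor : Obj → Obj → Type*) where
  {src : Obj}
  {tgt : Obj}
  hor : Hor src tgt

/-- A (normalized) pseudo double category, i.e. a pseudo category in `Cat` whose unit comparisons
are identities: a category `D₀` of objects and (vertical) arrows, a category `D₁` of proarrows and
cells, functors `src, tgt : D₁ ⥤ D₀` (the object parts of which are recorded by the typing of
proarrows), external units `y : D₀ ⥤ D₁`, an external composition `⊗ : D₁ ×_{D₀} D₁ ⥤ D₁`, written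
in diagrammatic order, and an invertible globular associator satisfying the pentagon and the
triangle axioms. -/
structure DoubleCat where
  Obj : Type u
  [cat₀ : Category.{v} Obj]
  Hor : Obj → Obj → Type u
  [cat₁ : Category.{v} (Proarrow Hor)]
  /-- External source of a cell. -/
  srcMap : ∀ {A B A' B' : Obj} {m : Hor A B} {m' : Hor A' B'},
    (Proarrow.mk m ⟶ Proarrow.mk m') → (A ⟶ A')
  /-- External target of a cell. -/
  tgtMap : ∀ {A B A' B' : Obj} {m : Hor A B} {m' : Hor A' B'},
    (Proarrow.mk m ⟶ Proarrow.mk m') → (B ⟶ B')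
  srcMap_id : ∀ {A B : Obj} (m : Hor A B), srcMap (𝟙 (Proarrow.mk m)) = 𝟙 A
  tgtMap_id : ∀ {A B : Obj} (m : Hor A B), tgtMap (𝟙 (Proarrow.mk m)) = 𝟙 B
  srcMap_comp : ∀ {A B A' B' A'' B'' : Obj} {m : Hor A B} {m' : Hor A' B'} {m'' : Hor A'' B''}
    (θ : Proarrow.mk m ⟶ Proarrow.mk m') (θ' : Proarrow.mk m' ⟶ Proarrow.mk m''),
    srcMap (θ ≫ θ') = srcMap θ ≫ srcMap θ'
  tgtMap_comp : ∀ {A B A' B' A'' B'' : Obj} {m : Hor A B} {m' : Hor A' B'} {m'' : Hor A'' B''}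
    (θ : Proarrow.mk m ⟶ Proarrow.mk m') (θ' : Proarrow.mk m' ⟶ Proarrow.mk m''),
    tgtMap (θ ≫ θ') = tgtMap θ ≫ tgtMap θ'
  /-- External unit of an object. -/
  y : ∀ A : Obj, Hor A A
  /-- External unit of an arrow. -/
  yMap : ∀ {A A' : Obj} (_ : A ⟶ A'), Proarrow.mk (y A) ⟶ Proarrow.mk (y A')
  src_yMap : ∀ {A A' : Obj} (f : A ⟶ A'), srcMap (yMap f) = f
  tgt_yMap : ∀ {A A' : Obj} (f : A ⟶ A'), tgtMap (yMap f) = f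
  yMap_id : ∀ A : Obj, yMap (𝟙 A) = 𝟙 _
  yMap_comp : ∀ {A A' A'' : Obj} (f : A ⟶ A') (g : A' ⟶ A''), yMap (f ≫ g) = yMap f ≫ yMap g
  /-- External composition of proarrows. -/
  tens : ∀ {A B C : Obj}, Hor A B → Hor B C → Hor A C
  /-- External composition of cells. -/
  tensMap : ∀ {A B C A' B' C' : Obj} {m : Hor A B} {n : Hor B C} {m' : Hor A' B'} {n' : Hor B' C'}
    (θ : Proarrow.mk m ⟶ Proarrow.mk m') (κ : Proarrow.mk n ⟶ Proarrow.mk n')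
    (_ : tgtMap θ = srcMap κ), Proarrow.mk (tens m n) ⟶ Proarrow.mk (tens m' n')
  src_tensMap : ∀ {A B C A' B' C' : Obj} {m : Hor A B} {n : Hor B C} {m' : Hor A' B'}
    {n' : Hor B' C'} (θ : Proarrow.mk m ⟶ Proarrow.mk m') (κ : Proarrow.mk n ⟶ Proarrow.mk n')
    (h : tgtMap θ = srcMap κ), srcMap (tensMap θ κ h) = srcMap θ
  tgt_tensMap : ∀ {A B C A' B' C' : Obj} {m : Hor A B} {n : Hor B C} {m' : Hor A' B'}
    {n' : Hor B' C'} (θ : Proarrow.mk m ⟶ Proarrow.mk m') (κ : Proarrow.mk n ⟶ Proarrow.mk n')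
    (h : tgtMap θ = srcMap κ), tgtMap (tensMap θ κ h) = tgtMap κ
  tensMap_id : ∀ {A B C : Obj} (m : Hor A B) (n : Hor B C),
    tensMap (𝟙 (Proarrow.mk m)) (𝟙 (Proarrow.mk n)) ((tgtMap_id m).trans (srcMap_id n).symm) = 𝟙 _
  tensMap_comp : ∀ {A B C A' B' C' A'' B'' C'' : Obj} {m : Hor A B} {n : Hor B C}
    {m' : Hor A' B'} {n' : Hor B' C'} {m'' : Hor A'' B''} {n'' : Hor B'' C''}
    (θ : Proarrow.mk m ⟶ Proarrow.mk m') (κ : Proarrow.mk n ⟶ Proarrow.mk n')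
    (h : tgtMap θ = srcMap κ)
    (θ' : Proarrow.mk m' ⟶ Proarrow.mk m'') (κ' : Proarrow.mk n' ⟶ Proarrow.mk n'')
    (h' : tgtMap θ' = srcMap κ'),
    tensMap (θ ≫ θ') (κ ≫ κ') (by rw [tgtMap_comp, srcMap_comp, h, h']) =
      tensMap θ κ h ≫ tensMap θ' κ' h'
  /-- Left normalization, on proarrows. -/
  unit_tens : ∀ {A B : Obj} (m : Hor A B), tens (y A) m = m
  /-- Right normalization, on proarrows. -/
  tens_unit : ∀ {A B : Obj} (m : Hor A B), tens m (y B) = m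
  /-- Left normalization, on cells. -/
  unit_tensMap : ∀ {A B A' B' : Obj} {m : Hor A B} {m' : Hor A' B'}
    (θ : Proarrow.mk m ⟶ Proarrow.mk m'),
    tensMap (yMap (srcMap θ)) θ (tgt_yMap _) =
      eqToHom (congrArg Proarrow.mk (unit_tens m)) ≫ θ ≫
        eqToHom (congrArg Proarrow.mk (unit_tens m').symm)
  /-- Right normalization, on cells. -/
  tensMap_unit : ∀ {A B A' B' : Obj} {m : Hor A B} {m' : Hor A' B'}
    (θ : Proarrow.mk m ⟶ Proarrow.mk m'),
    tensMap θ (yMap (tgtMap θ)) (src_yMap _).symm =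
      eqToHom (congrArg Proarrow.mk (tens_unit m)) ≫ θ ≫
        eqToHom (congrArg Proarrow.mk (tens_unit m').symm)
  /-- The associator. -/
  assoc : ∀ {A B C D : Obj} (m : Hor A B) (n : Hor B C) (p : Hor C D),
    Proarrow.mk (tens (tens m n) p) ≅ Proarrow.mk (tens m (tens n p))
  src_assoc : ∀ {A B C D : Obj} (m : Hor A B) (n : Hor B C) (p : Hor C D),
    srcMap (assoc m n p).hom = 𝟙 A
  tgt_assoc : ∀ {A B C D : Obj} (m : Hor A B) (n : Hor B C) (p : Hor C D),
    tgtMap (assoc m n p).hom = 𝟙 D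
  assoc_naturality : ∀ {A B C D A' B' C' D' : Obj} {m : Hor A B} {n : Hor B C} {p : Hor C D}
    {m' : Hor A' B'} {n' : Hor B' C'} {p' : Hor C' D'}
    (θ : Proarrow.mk m ⟶ Proarrow.mk m') (κ : Proarrow.mk n ⟶ Proarrow.mk n')
    (μ : Proarrow.mk p ⟶ Proarrow.mk p') (h : tgtMap θ = srcMap κ) (h' : tgtMap κ = srcMap μ),
    tensMap (tensMap θ κ h) μ ((tgt_tensMap θ κ h).trans h') ≫ (assoc m' n' p').hom =
      (assoc m n p).hom ≫ tensMap θ (tensMap κ μ h') (h.trans (src_tensMap κ μ h').symm)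
  pentagon : ∀ {A B C D E : Obj} (m : Hor A B) (n : Hor B C) (p : Hor C D) (q : Hor D E),
    tensMap (assoc m n p).hom (𝟙 (Proarrow.mk q)) ((tgt_assoc m n p).trans (srcMap_id q).symm) ≫
      (assoc m (tens n p) q).hom ≫
        tensMap (𝟙 (Proarrow.mk m)) (assoc n p q).hom
          ((tgtMap_id m).trans (src_assoc n p q).symm) =
      (assoc (tens m n) p q).hom ≫ (assoc m n (tens p q)).hom
  /-- The triangle axiom, for identity unit comparisons. -/
  triangle : ∀ {A B C : Obj} (m : Hor A B) (n : Hor B C),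
    (assoc m (y B) n).hom = eqToHom (by rw [tens_unit, unit_tens])

attribute [instance] DoubleCat.cat₀ DoubleCat.cat₁

namespace DoubleCat

variable (D : DoubleCat.{v, u})

/-- The objects of `D₁`. -/
abbrev Pro : Type u := Proarrow D.Hor

/-- The functor `src : D₁ ⥤ D₀`. -/
def src : D.Pro ⥤ D.Obj where
  obj M := M.src
  map θ := D.srcMap θ
  map_id M := D.srcMap_id M.hor
  map_comp θ θ' := D.srcMap_comp θ θ'

/-- The functor `tgt : D₁ ⥤ D₀`. -/
def tgt : D.Pro ⥤ D.Obj where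
  obj M := M.tgt
  map θ := D.tgtMap θ
  map_id M := D.tgtMap_id M.hor
  map_comp θ θ' := D.tgtMap_comp θ θ'

/-- The functor `y : D₀ ⥤ D₁`. -/
def unit : D.Obj ⥤ D.Pro where
  obj A := ⟨D.y A⟩
  map f := D.yMap f
  map_id A := D.yMap_id A
  map_comp f g := D.yMap_comp f g

/-- The objects of the pullback category `D₁ ×_{D₀} D₁` of `tgt` and `src`: composable pairs of
proarrows. -/
structure Pair where
  {A : D.Obj}
  {B : D.Obj}
  {C : D.Obj}
  fst : D.Hor A B
  snd : D.Hor B C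

/-- The morphisms of `D₁ ×_{D₀} D₁`: externally composable pairs of cells. -/
@[ext]
structure PairHom (M N : D.Pair) where
  fst : Proarrow.mk M.fst ⟶ Proarrow.mk N.fst
  snd : Proarrow.mk M.snd ⟶ Proarrow.mk N.snd
  w : D.tgtMap fst = D.srcMap snd

/-- The pullback category `D₁ ×_{D₀} D₁`. -/
instance : Category D.Pair where
  Hom M N := D.PairHom M N
  id M := ⟨𝟙 _, 𝟙 _, (D.tgtMap_id _).trans (D.srcMap_id _).symm⟩
  comp f g := ⟨f.fst ≫ g.fst, f.snd ≫ g.snd, by rw [D.tgtMap_comp, D.srcMap_comp, f.w, g.w]⟩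
  id_comp f := PairHom.ext (Category.id_comp _) (Category.id_comp _)
  comp_id f := PairHom.ext (Category.comp_id _) (Category.comp_id _)
  assoc f g h := PairHom.ext (Category.assoc _ _ _) (Category.assoc _ _ _)

/-- The functor `⊗ : D₁ ×_{D₀} D₁ ⥤ D₁`. -/
def tensor : D.Pair ⥤ D.Pro where
  obj M := ⟨D.tens M.fst M.snd⟩
  map f := D.tensMap f.fst f.snd f.w
  map_id M := D.tensMap_id M.fst M.snd
  map_comp f g := D.tensMap_comp f.fst f.snd f.w g.fst g.snd g.w

end DoubleCat

/-! ### Lax, pseudo and strict double functors -/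

/-- A lax double functor: functors `F₀ : C₀ ⥤ D₀` and `F₁ : C₁ ⥤ D₁` strictly compatible with
external sources and targets, with globular natural comparison cells
`ι_A : y (F A) ⟶ F (y A)` and `φ_{m,n} : F m ⊗ F n ⟶ F (m ⊗ n)` satisfying the associativity axiom
and the two unit axioms. -/
structure LaxDoubleFunctor (C D : DoubleCat.{v, u}) where
  F₀ : C.Obj ⥤ D.Obj
  hor : ∀ {A B : C.Obj}, C.Hor A B → D.Hor (F₀.obj A) (F₀.obj B)
  cell : ∀ {A B A' B' : C.Obj} {m : C.Hor A B} {m' : C.Hor A' B'},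
    (Proarrow.mk m ⟶ Proarrow.mk m') → (Proarrow.mk (hor m) ⟶ Proarrow.mk (hor m'))
  cell_id : ∀ {A B : C.Obj} (m : C.Hor A B), cell (𝟙 (Proarrow.mk m)) = 𝟙 _
  cell_comp : ∀ {A B A' B' A'' B'' : C.Obj} {m : C.Hor A B} {m' : C.Hor A' B'}
    {m'' : C.Hor A'' B''} (θ : Proarrow.mk m ⟶ Proarrow.mk m')
    (θ' : Proarrow.mk m' ⟶ Proarrow.mk m''), cell (θ ≫ θ') = cell θ ≫ cell θ'
  src_cell : ∀ {A B A' B' : C.Obj} {m : C.Hor A B} {m' : C.Hor A' B'}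
    (θ : Proarrow.mk m ⟶ Proarrow.mk m'), D.srcMap (cell θ) = F₀.map (C.srcMap θ)
  tgt_cell : ∀ {A B A' B' : C.Obj} {m : C.Hor A B} {m' : C.Hor A' B'}
    (θ : Proarrow.mk m ⟶ Proarrow.mk m'), D.tgtMap (cell θ) = F₀.map (C.tgtMap θ)
  /-- Unit comparison. -/
  ι : ∀ A : C.Obj, Proarrow.mk (D.y (F₀.obj A)) ⟶ Proarrow.mk (hor (C.y A))
  src_ι : ∀ A : C.Obj, D.srcMap (ι A) = 𝟙 (F₀.obj A)
  tgt_ι : ∀ A : C.Obj, D.tgtMap (ι A) = 𝟙 (F₀.obj A)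
  ι_naturality : ∀ {A A' : C.Obj} (f : A ⟶ A'),
    D.yMap (F₀.map f) ≫ ι A' = ι A ≫ cell (C.yMap f)
  /-- Composition comparison. -/
  φ : ∀ {A B B' : C.Obj} (m : C.Hor A B) (n : C.Hor B B'),
    Proarrow.mk (D.tens (hor m) (hor n)) ⟶ Proarrow.mk (hor (C.tens m n))
  src_φ : ∀ {A B B' : C.Obj} (m : C.Hor A B) (n : C.Hor B B'), D.srcMap (φ m n) = 𝟙 (F₀.obj A)
  tgt_φ : ∀ {A B B' : C.Obj} (m : C.Hor A B) (n : C.Hor B B'), D.tgtMap (φ m n) = 𝟙 (F₀.obj B')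
  φ_naturality : ∀ {A B E A' B' E' : C.Obj} {m : C.Hor A B} {n : C.Hor B E} {m' : C.Hor A' B'}
    {n' : C.Hor B' E'} (θ : Proarrow.mk m ⟶ Proarrow.mk m') (κ : Proarrow.mk n ⟶ Proarrow.mk n')
    (h : C.tgtMap θ = C.srcMap κ),
    D.tensMap (cell θ) (cell κ) (by rw [tgt_cell, src_cell, h]) ≫ φ m' n' =
      φ m n ≫ cell (C.tensMap θ κ h)
  associativity : ∀ {A B B' B'' : C.Obj} (m : C.Hor A B) (n : C.Hor B B') (p : C.Hor B' B''),
    D.tensMap (φ m n) (𝟙 (Proarrow.mk (hor p))) ((tgt_φ m n).trans (D.srcMap_id _).symm) ≫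
        φ (C.tens m n) p ≫ cell (C.assoc m n p).hom =
      (D.assoc (hor m) (hor n) (hor p)).hom ≫
        D.tensMap (𝟙 (Proarrow.mk (hor m))) (φ n p) ((D.tgtMap_id _).trans (src_φ n p).symm) ≫
          φ m (C.tens n p)
  left_unitality : ∀ {A B : C.Obj} (m : C.Hor A B),
    D.tensMap (ι A) (𝟙 (Proarrow.mk (hor m))) ((tgt_ι A).trans (D.srcMap_id _).symm) ≫
        φ (C.y A) m =
      eqToHom (by rw [D.unit_tens, C.unit_tens])
  right_unitality : ∀ {A B : C.Obj} (m : C.Hor A B),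
    D.tensMap (𝟙 (Proarrow.mk (hor m))) (ι B) ((D.tgtMap_id _).trans (src_ι B).symm) ≫
        φ m (C.y B) =
      eqToHom (by rw [D.tens_unit, C.tens_unit])

namespace LaxDoubleFunctor

variable {C D E : DoubleCat.{v, u}}

/-- The functor `F₁ : C₁ ⥤ D₁`. -/
def F₁ (F : LaxDoubleFunctor C D) : C.Pro ⥤ D.Pro where
  obj M := ⟨F.hor M.hor⟩
  map θ := F.cell θ
  map_id M := F.cell_id M.hor
  map_comp θ θ' := F.cell_comp θ θ'

/-- The functor `F₁ ×_{F₀} F₁ : C₁ ×_{C₀} C₁ ⥤ D₁ ×_{D₀} D₁`. -/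
def F₂ (F : LaxDoubleFunctor C D) : C.Pair ⥤ D.Pair where
  obj M := ⟨F.hor M.fst, F.hor M.snd⟩
  map f := ⟨F.cell f.fst, F.cell f.snd, by rw [F.tgt_cell, F.src_cell, f.w]⟩
  map_id M := DoubleCat.PairHom.ext (F.cell_id _) (F.cell_id _)
  map_comp f g := DoubleCat.PairHom.ext (F.cell_comp _ _) (F.cell_comp _ _)

/-- A lax double functor is pseudo when its comparison cells are invertible. -/
structure IsPseudo (F : LaxDoubleFunctor C D) : Prop where
  isIso_ι : ∀ A : C.Obj, IsIso (F.ι A)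
  isIso_φ : ∀ {A B B' : C.Obj} (m : C.Hor A B) (n : C.Hor B B'), IsIso (F.φ m n)

/-- A lax double functor is strict when its comparison cells are identities. -/
structure IsStrict (F : LaxDoubleFunctor C D) : Prop where
  ι_eq : ∀ A : C.Obj, ∃ h : D.y (F.F₀.obj A) = F.hor (C.y A),
    F.ι A = eqToHom (congrArg Proarrow.mk h)
  φ_eq : ∀ {A B B' : C.Obj} (m : C.Hor A B) (n : C.Hor B B'),
    ∃ h : D.tens (F.hor m) (F.hor n) = F.hor (C.tens m n),
      F.φ m n = eqToHom (congrArg Proarrow.mk h)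

lemma cell_eqToHom (F : LaxDoubleFunctor C D) {A B A' B' : C.Obj} {m : C.Hor A B}
    {m' : C.Hor A' B'} (h : Proarrow.mk m = Proarrow.mk m') :
    F.cell (eqToHom h) =
      eqToHom (show Proarrow.mk (F.hor m) = Proarrow.mk (F.hor m') from congrArg F.F₁.obj h) :=
  eqToHom_map F.F₁ h

lemma tensMap_congr {D : DoubleCat.{v, u}} {A B B' A' B₁ B₁' : D.Obj} {m : D.Hor A B}
    {n : D.Hor B B'} {m' : D.Hor A' B₁} {n' : D.Hor B₁ B₁'}
    {θ θ' : Proarrow.mk m ⟶ Proarrow.mk m'} {κ κ' : Proarrow.mk n ⟶ Proarrow.mk n'}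
    (hθ : θ = θ') (hκ : κ = κ') (h : D.tgtMap θ = D.srcMap κ) :
    D.tensMap θ κ h = D.tensMap θ' κ' (hθ ▸ hκ ▸ h) := by
  subst hθ hκ; rfl

/-- The identity double functor. -/
def id (C : DoubleCat.{v, u}) : LaxDoubleFunctor C C where
  F₀ := 𝟭 C.Obj
  hor m := m
  cell θ := θ
  cell_id _ := rfl
  cell_comp _ _ := rfl
  src_cell _ := rfl
  tgt_cell _ := rfl
  ι A := 𝟙 _
  src_ι A := C.srcMap_id _
  tgt_ι A := C.tgtMap_id _
  ι_naturality f := by simp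
  φ m n := 𝟙 _
  src_φ _ _ := C.srcMap_id _
  tgt_φ _ _ := C.tgtMap_id _
  φ_naturality _ _ _ := by simp
  associativity m n p := by simp [C.tensMap_id]
  left_unitality m := by
    simp only [C.tensMap_id, Category.comp_id]; rfl
  right_unitality m := by
    simp only [C.tensMap_id, Category.comp_id]; rfl

lemma tensMap_comp_cell (G : LaxDoubleFunctor D E) {A B B' : D.Obj} {A₁ B₁ B₁' : D.Obj}
    {m : D.Hor A B} {n : D.Hor B B'} {m' : D.Hor A₁ B₁} {n' : D.Hor B₁ B₁'}
    (θ : Proarrow.mk m ⟶ Proarrow.mk m') (κ : Proarrow.mk n ⟶ Proarrow.mk n')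
    (h : D.tgtMap θ = D.srcMap κ) {M : E.Pro} (k : Proarrow.mk (G.hor (D.tens m' n')) ⟶ M) :
    E.tensMap (G.cell θ) (G.cell κ) (by rw [G.tgt_cell, G.src_cell, h]) ≫ G.φ m' n' ≫ k =
      G.φ m n ≫ G.cell (D.tensMap θ κ h) ≫ k := by
  rw [← Category.assoc, G.φ_naturality θ κ h, Category.assoc]

lemma tensMap_comp_cell_id (G : LaxDoubleFunctor D E) {X Y : E.Obj} {A A' B B' : D.Obj}
    {l : E.Hor X Y} {m : D.Hor A B} {m' : D.Hor A' B} {n : D.Hor B B'} {l' : E.Hor Y (G.F₀.obj B')}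
    (a : Proarrow.mk l ⟶ Proarrow.mk (G.hor m)) (b : Proarrow.mk m ⟶ Proarrow.mk m')
    (c : Proarrow.mk l' ⟶ Proarrow.mk (G.hor n))
    (ha : E.tgtMap a = E.srcMap c) (hb : D.tgtMap b = D.srcMap (𝟙 (Proarrow.mk n)))
    (h : E.tgtMap (a ≫ G.cell b) = E.srcMap c) :
    E.tensMap (a ≫ G.cell b) c h = E.tensMap a c ha ≫
      E.tensMap (G.cell b) (G.cell (𝟙 (Proarrow.mk n))) (by rw [G.tgt_cell, G.src_cell, hb]) := by
  rw [← E.tensMap_comp]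
  exact tensMap_congr rfl (by rw [G.cell_id, Category.comp_id]) _

lemma tensMap_id_comp_cell (G : LaxDoubleFunctor D E) {X Y : E.Obj} {A B B' B'' : D.Obj}
    {l : E.Hor X Y} {m : D.Hor A B} {n : D.Hor B B'} {n' : D.Hor B B''}
    {l' : E.Hor (G.F₀.obj A) X}
    (c : Proarrow.mk l' ⟶ Proarrow.mk (G.hor m))
    (a : Proarrow.mk l ⟶ Proarrow.mk (G.hor n)) (b : Proarrow.mk n ⟶ Proarrow.mk n')
    (ha : E.tgtMap c = E.srcMap a) (hb : D.tgtMap (𝟙 (Proarrow.mk m)) = D.srcMap b)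
    (h : E.tgtMap c = E.srcMap (a ≫ G.cell b)) :
    E.tensMap c (a ≫ G.cell b) h = E.tensMap c a ha ≫
      E.tensMap (G.cell (𝟙 (Proarrow.mk m))) (G.cell b) (by rw [G.tgt_cell, G.src_cell, hb]) := by
  rw [← E.tensMap_comp]
  exact tensMap_congr (by rw [G.cell_id, Category.comp_id]) rfl _

/-- The composite of two lax double functors. -/
def comp (F : LaxDoubleFunctor C D) (G : LaxDoubleFunctor D E) : LaxDoubleFunctor C E where
  F₀ := F.F₀ ⋙ G.F₀
  hor m := G.hor (F.hor m)
  cell θ := G.cell (F.cell θ)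
  cell_id _ := by rw [F.cell_id, G.cell_id]
  cell_comp _ _ := by rw [F.cell_comp, G.cell_comp]
  src_cell _ := by rw [G.src_cell, F.src_cell]; rfl
  tgt_cell _ := by rw [G.tgt_cell, F.tgt_cell]; rfl
  ι A := G.ι (F.F₀.obj A) ≫ G.cell (F.ι A)
  src_ι A := by
    rw [E.srcMap_comp, G.src_ι, G.src_cell, F.src_ι, G.F₀.map_id]; exact Category.id_comp _
  tgt_ι A := by
    rw [E.tgtMap_comp, G.tgt_ι, G.tgt_cell, F.tgt_ι, G.F₀.map_id]; exact Category.id_comp _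
  ι_naturality f := by
    rw [← Category.assoc]
    erw [G.ι_naturality (F.F₀.map f)]
    rw [Category.assoc, Category.assoc, ← G.cell_comp, ← G.cell_comp, F.ι_naturality]
  φ m n := G.φ (F.hor m) (F.hor n) ≫ G.cell (F.φ m n)
  src_φ m n := by
    rw [E.srcMap_comp, G.src_φ, G.src_cell, F.src_φ, G.F₀.map_id]; exact Category.id_comp _
  tgt_φ m n := by
    rw [E.tgtMap_comp, G.tgt_φ, G.tgt_cell, F.tgt_φ, G.F₀.map_id]; exact Category.id_comp _
  φ_naturality θ κ h := by
    rw [← Category.assoc, G.φ_naturality (F.cell θ) (F.cell κ)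
      (by rw [F.tgt_cell, F.src_cell, h]), Category.assoc, Category.assoc, ← G.cell_comp,
      ← G.cell_comp, F.φ_naturality]
  associativity m n p := by
    have e₁ := G.tensMap_comp_cell_id (G.φ (F.hor m) (F.hor n)) (F.φ m n)
      (𝟙 (Proarrow.mk (G.hor (F.hor p)))) ((G.tgt_φ _ _).trans (E.srcMap_id _).symm)
      ((F.tgt_φ m n).trans (D.srcMap_id _).symm) (by
        rw [E.tgtMap_comp, G.tgt_φ, G.tgt_cell, F.tgt_φ, G.F₀.map_id, E.srcMap_id]
        exact Category.id_comp _)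
    have e₂ := G.tensMap_id_comp_cell (𝟙 (Proarrow.mk (G.hor (F.hor m))))
      (G.φ (F.hor n) (F.hor p)) (F.φ n p) ((E.tgtMap_id _).trans (G.src_φ _ _).symm)
      ((D.tgtMap_id _).trans (F.src_φ n p).symm) (by
        rw [E.srcMap_comp, G.src_φ, G.src_cell, F.src_φ, G.F₀.map_id, E.tgtMap_id]
        exact (Category.id_comp _).symm)
    have h₁ := F.associativity m n p
    have h₂ := G.associativity (F.hor m) (F.hor n) (F.hor p)
    refine (congrArg (· ≫ _) e₁).trans (Eq.trans ?_ (congrArg (fun t => _ ≫ t ≫ _) e₂).symm)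
    simp only [Category.assoc]
    rw [G.tensMap_comp_cell (F.φ m n) (𝟙 (Proarrow.mk (F.hor p)))
        ((F.tgt_φ m n).trans (D.srcMap_id _).symm),
      G.tensMap_comp_cell (𝟙 (Proarrow.mk (F.hor m))) (F.φ n p)
        ((D.tgtMap_id _).trans (F.src_φ n p).symm),
      ← G.cell_comp, ← G.cell_comp, h₁, G.cell_comp, ← G.cell_comp _ (F.φ m (C.tens n p)),
      reassoc_of% h₂]
  left_unitality m := by
    have e₁ := G.tensMap_comp_cell_id (G.ι (F.F₀.obj _)) (F.ι _)
      (𝟙 (Proarrow.mk (G.hor (F.hor m)))) ((G.tgt_ι _).trans (E.srcMap_id _).symm)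
      ((F.tgt_ι _).trans (D.srcMap_id _).symm) (by
        rw [E.tgtMap_comp, G.tgt_ι, G.tgt_cell, F.tgt_ι, G.F₀.map_id, E.srcMap_id]
        exact Category.id_comp _)
    have h₁ := F.left_unitality m
    have h₂ := G.left_unitality (F.hor m)
    refine (congrArg (· ≫ _) e₁).trans ?_
    rw [Category.assoc, G.tensMap_comp_cell _ _ ((F.tgt_ι _).trans (D.srcMap_id _).symm),
      ← G.cell_comp, h₁, cell_eqToHom]
    erw [reassoc_of% h₂]
    exact eqToHom_trans _ _
  right_unitality m := by
    have e₂ := G.tensMap_id_comp_cell (𝟙 (Proarrow.mk (G.hor (F.hor m))))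
      (G.ι (F.F₀.obj _)) (F.ι _) ((E.tgtMap_id _).trans (G.src_ι _).symm)
      ((D.tgtMap_id _).trans (F.src_ι _).symm) (by
        rw [E.srcMap_comp, G.src_ι, G.src_cell, F.src_ι, G.F₀.map_id, E.tgtMap_id]
        exact (Category.id_comp _).symm)
    have h₁ := F.right_unitality m
    have h₂ := G.right_unitality (F.hor m)
    refine (congrArg (· ≫ _) e₂).trans ?_
    rw [Category.assoc, G.tensMap_comp_cell _ _ ((D.tgtMap_id _).trans (F.src_ι _).symm),
      ← G.cell_comp, h₁, cell_eqToHom]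
    erw [reassoc_of% h₂]
    exact eqToHom_trans _ _

/-- Extensionality for lax double functors: they are equal when their data are. -/
theorem ext_of_comparison {F G : LaxDoubleFunctor C D} (h₀ : F.F₀ = G.F₀)
    (hhor : HEq (@hor _ _ F) (@hor _ _ G)) (hcell : HEq (@cell _ _ F) (@cell _ _ G))
    (hι : HEq F.ι G.ι) (hφ : HEq (@φ _ _ F) (@φ _ _ G)) : F = G := by
  cases F; cases G
  cases h₀; cases hhor; cases hcell; cases hι; cases hφ
  rfl

lemma id_comp (F : LaxDoubleFunctor C D) : (id C).comp F = F :=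
  ext_of_comparison rfl HEq.rfl HEq.rfl
    (heq_of_eq (by funext A; exact (congrArg (F.ι A ≫ ·) (F.cell_id _)).trans (Category.comp_id _)))
    (heq_of_eq (by
      funext A B B' m n
      exact (congrArg (F.φ m n ≫ ·) (F.cell_id _)).trans (Category.comp_id _)))

lemma comp_id (F : LaxDoubleFunctor C D) : F.comp (id D) = F :=
  ext_of_comparison rfl HEq.rfl HEq.rfl
    (heq_of_eq (by funext A; exact Category.id_comp _))
    (heq_of_eq (by funext A B B' m n; exact Category.id_comp _))

lemma comp_assoc {E' : DoubleCat.{v, u}} (F : LaxDoubleFunctor C D) (G : LaxDoubleFunctor D E)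
    (H : LaxDoubleFunctor E E') : (F.comp G).comp H = F.comp (G.comp H) :=
  ext_of_comparison rfl HEq.rfl HEq.rfl
    (heq_of_eq (by
      funext A
      exact (congrArg (H.ι _ ≫ ·) (H.cell_comp _ _)).trans (Category.assoc _ _ _).symm))
    (heq_of_eq (by
      funext A B B' m n
      exact (congrArg (H.φ _ _ ≫ ·) (H.cell_comp _ _)).trans (Category.assoc _ _ _).symm))

lemma IsPseudo.id (C : DoubleCat.{v, u}) : (LaxDoubleFunctor.id C).IsPseudo where
  isIso_ι _ := inferInstanceAs (IsIso (𝟙 _))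
  isIso_φ _ _ := inferInstanceAs (IsIso (𝟙 _))

lemma IsPseudo.comp {F : LaxDoubleFunctor C D} {G : LaxDoubleFunctor D E} (hF : F.IsPseudo)
    (hG : G.IsPseudo) : (F.comp G).IsPseudo where
  isIso_ι A := by
    have := hF.isIso_ι A
    have h₁ := hG.isIso_ι (F.F₀.obj A)
    have h₂ : IsIso (G.cell (F.ι A)) := inferInstanceAs (IsIso (G.F₁.map (F.ι A)))
    exact @IsIso.comp_isIso _ _ _ _ _ _ _ h₁ h₂
  isIso_φ m n := by
    have := hF.isIso_φ m n
    have h₁ := hG.isIso_φ (F.hor m) (F.hor n)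
    have h₂ : IsIso (G.cell (F.φ m n)) := inferInstanceAs (IsIso (G.F₁.map (F.φ m n)))
    exact @IsIso.comp_isIso _ _ _ _ _ _ _ h₁ h₂

lemma IsStrict.id (C : DoubleCat.{v, u}) : (LaxDoubleFunctor.id C).IsStrict where
  ι_eq _ := ⟨rfl, rfl⟩
  φ_eq _ _ := ⟨rfl, rfl⟩

lemma IsStrict.comp {F : LaxDoubleFunctor C D} {G : LaxDoubleFunctor D E} (hF : F.IsStrict)
    (hG : G.IsStrict) : (F.comp G).IsStrict where
  ι_eq A := by
    obtain ⟨h₁, e₁⟩ := hF.ι_eq A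
    obtain ⟨h₂, e₂⟩ := hG.ι_eq (F.F₀.obj A)
    refine ⟨h₂.trans (congrArg G.hor h₁), ?_⟩
    refine (congrArg₂ (fun s t => s ≫ G.cell t) e₂ e₁).trans ?_
    rw [cell_eqToHom]
    exact eqToHom_trans _ _
  φ_eq m n := by
    obtain ⟨h₁, e₁⟩ := hF.φ_eq m n
    obtain ⟨h₂, e₂⟩ := hG.φ_eq (F.hor m) (F.hor n)
    refine ⟨h₂.trans (congrArg G.hor h₁), ?_⟩
    refine (congrArg₂ (fun s t => s ≫ G.cell t) e₂ e₁).trans ?_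
    rw [cell_eqToHom]
    exact eqToHom_trans _ _

end LaxDoubleFunctor

/-! ### Vertical transformations -/

/-- A (vertical) transformation between lax double functors. -/
@[ext]
structure VertTrans {C D : DoubleCat.{v, u}} (F G : LaxDoubleFunctor C D) where
  app : ∀ A : C.Obj, F.F₀.obj A ⟶ G.F₀.obj A
  cellApp : ∀ {A B : C.Obj} (m : C.Hor A B), Proarrow.mk (F.hor m) ⟶ Proarrow.mk (G.hor m)
  src_cellApp : ∀ {A B : C.Obj} (m : C.Hor A B), D.srcMap (cellApp m) = app A
  tgt_cellApp : ∀ {A B : C.Obj} (m : C.Hor A B), D.tgtMap (cellApp m) = app B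
  naturality : ∀ {A A' : C.Obj} (f : A ⟶ A'), F.F₀.map f ≫ app A' = app A ≫ G.F₀.map f
  cell_naturality : ∀ {A B A' B' : C.Obj} {m : C.Hor A B} {m' : C.Hor A' B'}
    (θ : Proarrow.mk m ⟶ Proarrow.mk m'), F.cell θ ≫ cellApp m' = cellApp m ≫ G.cell θ
  unit : ∀ A : C.Obj, D.yMap (app A) ≫ G.ι A = F.ι A ≫ cellApp (C.y A)
  tensor : ∀ {A B B' : C.Obj} (m : C.Hor A B) (n : C.Hor B B'),
    D.tensMap (cellApp m) (cellApp n) ((tgt_cellApp m).trans (src_cellApp n).symm) ≫ G.φ m n =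
      F.φ m n ≫ cellApp (C.tens m n)

namespace VertTrans

variable {C D E : DoubleCat.{v, u}}

/-- The identity transformation. -/
@[simps]
def id (F : LaxDoubleFunctor C D) : VertTrans F F where
  app A := 𝟙 _
  cellApp m := 𝟙 _
  src_cellApp _ := D.srcMap_id _
  tgt_cellApp _ := D.tgtMap_id _
  naturality _ := by simp
  cell_naturality _ := by simp
  unit _ := by simp [D.yMap_id]
  tensor _ _ := by simp [D.tensMap_id]

/-- Vertical composition of transformations. -/
@[simps]
def comp {F G H : LaxDoubleFunctor C D} (σ : VertTrans F G) (τ : VertTrans G H) :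
    VertTrans F H where
  app A := σ.app A ≫ τ.app A
  cellApp m := σ.cellApp m ≫ τ.cellApp m
  src_cellApp m := by rw [D.srcMap_comp, σ.src_cellApp, τ.src_cellApp]
  tgt_cellApp m := by rw [D.tgtMap_comp, σ.tgt_cellApp, τ.tgt_cellApp]
  naturality f := by
    rw [← Category.assoc, σ.naturality, Category.assoc, τ.naturality, Category.assoc]
  cell_naturality θ := by
    rw [← Category.assoc, σ.cell_naturality, Category.assoc, τ.cell_naturality, Category.assoc]
  unit A := by
    rw [D.yMap_comp, Category.assoc, τ.unit, ← Category.assoc, σ.unit, Category.assoc]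
  tensor m n := by
    rw [D.tensMap_comp (σ.cellApp m) (σ.cellApp n)
      ((σ.tgt_cellApp m).trans (σ.src_cellApp n).symm) _ _
      ((τ.tgt_cellApp m).trans (τ.src_cellApp n).symm),
      Category.assoc, τ.tensor, ← Category.assoc, σ.tensor, Category.assoc]

/-- Precomposition of a transformation with a lax double functor. -/
@[simps]
def whiskerLeft (F : LaxDoubleFunctor C D) {G H : LaxDoubleFunctor D E} (τ : VertTrans G H) :
    VertTrans (F.comp G) (F.comp H) where
  app A := τ.app (F.F₀.obj A)
  cellApp m := τ.cellApp (F.hor m)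
  src_cellApp m := τ.src_cellApp _
  tgt_cellApp m := τ.tgt_cellApp _
  naturality f := τ.naturality _
  cell_naturality θ := τ.cell_naturality _
  unit A := by
    change E.yMap _ ≫ H.ι _ ≫ H.cell _ = (G.ι _ ≫ G.cell _) ≫ _
    rw [← Category.assoc, τ.unit, Category.assoc, Category.assoc, τ.cell_naturality]
  tensor m n := by
    change E.tensMap _ _ _ ≫ H.φ _ _ ≫ H.cell _ = (G.φ _ _ ≫ G.cell _) ≫ _
    rw [← Category.assoc, τ.tensor, Category.assoc, Category.assoc, τ.cell_naturality]

/-- Postcomposition of a transformation with a lax double functor. -/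
@[simps]
def whiskerRight {F G : LaxDoubleFunctor C D} (τ : VertTrans F G) (H : LaxDoubleFunctor D E) :
    VertTrans (F.comp H) (G.comp H) where
  app A := H.F₀.map (τ.app A)
  cellApp m := H.cell (τ.cellApp m)
  src_cellApp m := (H.src_cell _).trans (congrArg H.F₀.map (τ.src_cellApp m))
  tgt_cellApp m := (H.tgt_cell _).trans (congrArg H.F₀.map (τ.tgt_cellApp m))
  naturality f := by
    change H.F₀.map _ ≫ _ = _ ≫ H.F₀.map _
    rw [← H.F₀.map_comp, ← H.F₀.map_comp, τ.naturality]
  cell_naturality θ := by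
    change H.cell _ ≫ _ = _ ≫ H.cell _
    rw [← H.cell_comp, ← H.cell_comp, τ.cell_naturality]
  unit A := by
    change E.yMap _ ≫ H.ι _ ≫ H.cell _ = (H.ι _ ≫ H.cell _) ≫ _
    rw [← Category.assoc, H.ι_naturality, Category.assoc, Category.assoc, ← H.cell_comp,
      ← H.cell_comp, τ.unit]
  tensor m n := by
    change E.tensMap _ _ _ ≫ H.φ _ _ ≫ H.cell _ = (H.φ _ _ ≫ H.cell _) ≫ _
    rw [H.tensMap_comp_cell _ _ ((τ.tgt_cellApp m).trans (τ.src_cellApp n).symm),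
      Category.assoc, ← H.cell_comp, ← H.cell_comp, τ.tensor]

end VertTrans

/-! ### The 2-categories of double categories -/

/-- The three kinds of double functors. -/
inductive FunctorKind
  | lax
  | pseudo
  | strict

/-- Being a double functor of a given kind. -/
def LaxDoubleFunctor.IsOfKind {C D : DoubleCat.{v, u}} (F : LaxDoubleFunctor C D) :
    FunctorKind → Prop
  | .lax => True
  | .pseudo => F.IsPseudo
  | .strict => F.IsStrict

/-- The objects of the 2-category of double categories, double functors of kind `k` and
transformations. -/
structure DblOf (k : FunctorKind) : Type (max (u + 1) (v + 1)) where
  toDoubleCat : DoubleCat.{v, u}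

/-- The 2-category of double categories, lax double functors and transformations. -/
abbrev DblLax : Type (max (u + 1) (v + 1)) := DblOf.{v, u} .lax

/-- The 2-category of double categories, pseudo double functors and transformations. -/
abbrev Dbl : Type (max (u + 1) (v + 1)) := DblOf.{v, u} .pseudo

/-- The 2-category of double categories, strict double functors and transformations. -/
abbrev DblStrict : Type (max (u + 1) (v + 1)) := DblOf.{v, u} .strict

/-- Double functors of kind `k`. -/
@[ext]
structure DblHom (k : FunctorKind) (C D : DoubleCat.{v, u}) where
  functor : LaxDoubleFunctor C D
  isOfKind : functor.IsOfKind k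

instance DblHom.category (k : FunctorKind) (C D : DoubleCat.{v, u}) :
    Category.{max u v} (DblHom k C D) where
  Hom F G := VertTrans F.functor G.functor
  id F := VertTrans.id F.functor
  comp σ τ := VertTrans.comp σ τ
  id_comp σ := by ext <;> simp
  comp_id σ := by ext <;> simp
  assoc σ τ ρ := by ext <;> simp

/-- The identity double functor, as a double functor of kind `k`. -/
def DblHom.id (k : FunctorKind) (C : DoubleCat.{v, u}) : DblHom k C C where
  functor := LaxDoubleFunctor.id C
  isOfKind := match k with
    | .lax => True.intro
    | .pseudo => LaxDoubleFunctor.IsPseudo.id C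
    | .strict => LaxDoubleFunctor.IsStrict.id C

/-- Double functors of kind `k` compose. -/
def DblHom.comp {k : FunctorKind} {C D E : DoubleCat.{v, u}} (F : DblHom k C D)
    (G : DblHom k D E) : DblHom k C E where
  functor := F.functor.comp G.functor
  isOfKind := match k, F, G with
    | .lax, _, _ => True.intro
    | .pseudo, F, G => LaxDoubleFunctor.IsPseudo.comp F.isOfKind G.isOfKind
    | .strict, F, G => LaxDoubleFunctor.IsStrict.comp F.isOfKind G.isOfKind

lemma DblHom.id_comp {k : FunctorKind} {C D : DoubleCat.{v, u}} (F : DblHom k C D) :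
    (DblHom.id k C).comp F = F :=
  DblHom.ext (LaxDoubleFunctor.id_comp _)

lemma DblHom.comp_id {k : FunctorKind} {C D : DoubleCat.{v, u}} (F : DblHom k C D) :
    F.comp (DblHom.id k D) = F :=
  DblHom.ext (LaxDoubleFunctor.comp_id _)

lemma DblHom.comp_assoc {k : FunctorKind} {C D E E' : DoubleCat.{v, u}} (F : DblHom k C D)
    (G : DblHom k D E) (H : DblHom k E E') : (F.comp G).comp H = F.comp (G.comp H) :=
  DblHom.ext (LaxDoubleFunctor.comp_assoc _ _ _)

/-- The components of a transformation at objects. -/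
abbrev DblHom.app {k : FunctorKind} {C D : DoubleCat.{v, u}} {F G : DblHom k C D} (σ : F ⟶ G)
    (A : C.Obj) : F.functor.F₀.obj A ⟶ G.functor.F₀.obj A :=
  VertTrans.app σ A

/-- The components of a transformation at proarrows. -/
abbrev DblHom.cellApp {k : FunctorKind} {C D : DoubleCat.{v, u}} {F G : DblHom k C D} (σ : F ⟶ G)
    {A B : C.Obj} (m : C.Hor A B) :
    Proarrow.mk (F.functor.hor m) ⟶ Proarrow.mk (G.functor.hor m) :=
  VertTrans.cellApp σ m

lemma DblHom.eqToHom_app {k : FunctorKind} {C D : DoubleCat.{v, u}} {F G : DblHom k C D}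
    (h : F = G) (A : C.Obj) :
    DblHom.app (eqToHom h) A = eqToHom (congrArg (fun H => H.functor.F₀.obj A) h) := by
  subst h; rfl

lemma DblHom.eqToHom_cellApp {k : FunctorKind} {C D : DoubleCat.{v, u}} {F G : DblHom k C D}
    (h : F = G) {A B : C.Obj} (m : C.Hor A B) :
    DblHom.cellApp (eqToHom h) m =
      eqToHom (congrArg (fun H => Proarrow.mk (H.functor.hor m)) h) := by
  subst h; rfl

/-- Two transformations are equal when their components are. -/
lemma DblHom.hom_ext {k : FunctorKind} {C D : DoubleCat.{v, u}} {F G : DblHom k C D}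
    {σ τ : F ⟶ G} (h₀ : ∀ A : C.Obj, DblHom.app σ A = DblHom.app τ A)
    (h₁ : ∀ {A B : C.Obj} (m : C.Hor A B), DblHom.cellApp σ m = DblHom.cellApp τ m) :
    σ = τ :=
  VertTrans.ext (funext h₀) (by funext A B m; exact h₁ m)

/-- Composition of double functors is associative. -/
def DblHom.associator {k : FunctorKind} {C D E E' : DoubleCat.{v, u}} (F : DblHom k C D)
    (G : DblHom k D E) (H : DblHom k E E') : (F.comp G).comp H ≅ F.comp (G.comp H) :=
  eqToIso (DblHom.comp_assoc F G H)

/-- Identity double functors are left units for composition. -/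
def DblHom.leftUnitor {k : FunctorKind} {C D : DoubleCat.{v, u}} (F : DblHom k C D) :
    (DblHom.id k C).comp F ≅ F :=
  eqToIso (DblHom.id_comp F)

/-- Identity double functors are right units for composition. -/
def DblHom.rightUnitor {k : FunctorKind} {C D : DoubleCat.{v, u}} (F : DblHom k C D) :
    F.comp (DblHom.id k D) ≅ F :=
  eqToIso (DblHom.comp_id F)

section

variable {k : FunctorKind} {C D E E' : DoubleCat.{v, u}} (F : DblHom k C D) (G : DblHom k D E)
  (H : DblHom k E E') (A : C.Obj) {A' B : C.Obj} (m : C.Hor A' B)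

lemma DblHom.associator_hom_app : DblHom.app (DblHom.associator F G H).hom A = 𝟙 _ :=
  DblHom.eqToHom_app (DblHom.comp_assoc F G H) _

lemma DblHom.associator_inv_app : DblHom.app (DblHom.associator F G H).inv A = 𝟙 _ :=
  DblHom.eqToHom_app (DblHom.comp_assoc F G H).symm _

lemma DblHom.associator_hom_cellApp : DblHom.cellApp (DblHom.associator F G H).hom m = 𝟙 _ :=
  DblHom.eqToHom_cellApp (DblHom.comp_assoc F G H) _

lemma DblHom.associator_inv_cellApp : DblHom.cellApp (DblHom.associator F G H).inv m = 𝟙 _ :=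
  DblHom.eqToHom_cellApp (DblHom.comp_assoc F G H).symm _

lemma DblHom.leftUnitor_hom_app : DblHom.app (DblHom.leftUnitor F).hom A = 𝟙 _ :=
  DblHom.eqToHom_app (DblHom.id_comp F) _

lemma DblHom.leftUnitor_inv_app : DblHom.app (DblHom.leftUnitor F).inv A = 𝟙 _ :=
  DblHom.eqToHom_app (DblHom.id_comp F).symm _

lemma DblHom.leftUnitor_hom_cellApp : DblHom.cellApp (DblHom.leftUnitor F).hom m = 𝟙 _ :=
  DblHom.eqToHom_cellApp (DblHom.id_comp F) _

lemma DblHom.leftUnitor_inv_cellApp : DblHom.cellApp (DblHom.leftUnitor F).inv m = 𝟙 _ :=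
  DblHom.eqToHom_cellApp (DblHom.id_comp F).symm _

lemma DblHom.rightUnitor_hom_app : DblHom.app (DblHom.rightUnitor F).hom A = 𝟙 _ :=
  DblHom.eqToHom_app (DblHom.comp_id F) _

lemma DblHom.rightUnitor_inv_app : DblHom.app (DblHom.rightUnitor F).inv A = 𝟙 _ :=
  DblHom.eqToHom_app (DblHom.comp_id F).symm _

lemma DblHom.rightUnitor_hom_cellApp : DblHom.cellApp (DblHom.rightUnitor F).hom m = 𝟙 _ :=
  DblHom.eqToHom_cellApp (DblHom.comp_id F) _

lemma DblHom.rightUnitor_inv_cellApp : DblHom.cellApp (DblHom.rightUnitor F).inv m = 𝟙 _ :=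
  DblHom.eqToHom_cellApp (DblHom.comp_id F).symm _

end

/-- A sandwich of a morphism between two identities. -/
lemma eq_id_comp_comp_id {X : Type*} [Category X] {a b : X} {f g : a ⟶ b} {i : a ⟶ a} {j : b ⟶ b}
    (hi : i = 𝟙 a) (hj : j = 𝟙 b) (h : f = g) : f = i ≫ g ≫ j := by
  subst hi hj h; simp

/-- Left whiskering. -/
def DblHom.whiskerLeft {k : FunctorKind} {C D E : DoubleCat.{v, u}} (F : DblHom k C D)
    {G H : DblHom k D E} (τ : G ⟶ H) : F.comp G ⟶ F.comp H :=
  VertTrans.whiskerLeft F.functor τ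

/-- Right whiskering. -/
def DblHom.whiskerRight {k : FunctorKind} {C D E : DoubleCat.{v, u}} {F G : DblHom k C D}
    (τ : F ⟶ G) (H : DblHom k D E) : F.comp H ⟶ G.comp H :=
  VertTrans.whiskerRight τ H.functor

namespace DblHom

variable {k : FunctorKind} {C D E E₁ E₂ : DoubleCat.{v, u}}

lemma id_whiskerLeft {F G : DblHom k C D} (τ : F ⟶ G) :
    whiskerLeft (DblHom.id k C) τ = (leftUnitor F).hom ≫ τ ≫ (leftUnitor G).inv := by
  refine hom_ext (fun A => ?_) (fun m => ?_)
  · exact eq_id_comp_comp_id (leftUnitor_hom_app _ A) (leftUnitor_inv_app _ A) rfl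
  · exact eq_id_comp_comp_id (leftUnitor_hom_cellApp _ m) (leftUnitor_inv_cellApp _ m) rfl

lemma comp_whiskerLeft (F : DblHom k C D) (G : DblHom k D E) {H K : DblHom k E E₁} (τ : H ⟶ K) :
    whiskerLeft (F.comp G) τ =
      (associator F G H).hom ≫ whiskerLeft F (whiskerLeft G τ) ≫ (associator F G K).inv := by
  refine hom_ext (fun A => ?_) (fun m => ?_)
  · exact eq_id_comp_comp_id (associator_hom_app _ _ _ A) (associator_inv_app _ _ _ A) rfl
  · exact eq_id_comp_comp_id (associator_hom_cellApp _ _ _ m)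
      (associator_inv_cellApp _ _ _ m) rfl

lemma id_whiskerRight (F : DblHom k C D) (G : DblHom k D E) :
    whiskerRight (𝟙 F) G = 𝟙 (F.comp G) := by
  refine hom_ext (fun A => ?_) (fun m => ?_)
  · exact G.functor.F₀.map_id _
  · exact G.functor.cell_id _

lemma comp_whiskerRight {F G H : DblHom k C D} (σ : F ⟶ G) (τ : G ⟶ H) (K : DblHom k D E) :
    whiskerRight (σ ≫ τ) K = whiskerRight σ K ≫ whiskerRight τ K := by
  refine hom_ext (fun A => ?_) (fun m => ?_)
  · exact K.functor.F₀.map_comp _ _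
  · exact K.functor.cell_comp _ _

lemma whiskerRight_id {F G : DblHom k C D} (τ : F ⟶ G) :
    whiskerRight τ (DblHom.id k D) = (rightUnitor F).hom ≫ τ ≫ (rightUnitor G).inv := by
  refine hom_ext (fun A => ?_) (fun m => ?_)
  · exact eq_id_comp_comp_id (rightUnitor_hom_app _ A) (rightUnitor_inv_app _ A) rfl
  · exact eq_id_comp_comp_id (rightUnitor_hom_cellApp _ m) (rightUnitor_inv_cellApp _ m) rfl

lemma whiskerRight_comp {F F' : DblHom k C D} (τ : F ⟶ F') (G : DblHom k D E)
    (H : DblHom k E E₁) :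
    whiskerRight τ (G.comp H) =
      (associator F G H).inv ≫ whiskerRight (whiskerRight τ G) H ≫ (associator F' G H).hom := by
  refine hom_ext (fun A => ?_) (fun m => ?_)
  · exact eq_id_comp_comp_id (associator_inv_app _ _ _ A) (associator_hom_app _ _ _ A) rfl
  · exact eq_id_comp_comp_id (associator_inv_cellApp _ _ _ m)
      (associator_hom_cellApp _ _ _ m) rfl

lemma whisker_assoc (F : DblHom k C D) {G G' : DblHom k D E} (τ : G ⟶ G') (H : DblHom k E E₁) :
    whiskerRight (whiskerLeft F τ) H =
      (associator F G H).hom ≫ whiskerLeft F (whiskerRight τ H) ≫ (associator F G' H).inv := by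
  refine hom_ext (fun A => ?_) (fun m => ?_)
  · exact eq_id_comp_comp_id (associator_hom_app _ _ _ A) (associator_inv_app _ _ _ A) rfl
  · exact eq_id_comp_comp_id (associator_hom_cellApp _ _ _ m)
      (associator_inv_cellApp _ _ _ m) rfl

lemma whisker_exchange {F G : DblHom k C D} {H K : DblHom k D E} (σ : F ⟶ G) (τ : H ⟶ K) :
    whiskerLeft F τ ≫ whiskerRight σ K = whiskerRight σ H ≫ whiskerLeft G τ := by
  refine hom_ext (fun A => ?_) (fun m => ?_)
  · exact (VertTrans.naturality τ (VertTrans.app σ A)).symm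
  · exact (VertTrans.cell_naturality τ (VertTrans.cellApp σ m)).symm

lemma pentagon (F : DblHom k C D) (G : DblHom k D E) (H : DblHom k E E₁) (K : DblHom k E₁ E₂) :
    whiskerRight (associator F G H).hom K ≫ (associator F (G.comp H) K).hom ≫
        whiskerLeft F (associator G H K).hom =
      (associator (F.comp G) H K).hom ≫ (associator F G (H.comp K)).hom := by
  refine hom_ext (fun A => ?_) (fun m => ?_)
  · exact (congrArg₂ (· ≫ ·)
      ((congrArg K.functor.F₀.map (associator_hom_app F G H A)).trans (K.functor.F₀.map_id _))
      (congrArg₂ (· ≫ ·) (associator_hom_app F (G.comp H) K A)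
        (associator_hom_app G H K _))).trans
      ((Category.id_comp _).trans (congrArg₂ (· ≫ ·) (associator_hom_app (F.comp G) H K A)
        (associator_hom_app F G (H.comp K) A)).symm)
  · exact (congrArg₂ (· ≫ ·)
      ((congrArg K.functor.cell (associator_hom_cellApp F G H m)).trans (K.functor.cell_id _))
      (congrArg₂ (· ≫ ·) (associator_hom_cellApp F (G.comp H) K m)
        (associator_hom_cellApp G H K _))).trans
      ((Category.id_comp _).trans (congrArg₂ (· ≫ ·) (associator_hom_cellApp (F.comp G) H K m)
        (associator_hom_cellApp F G (H.comp K) m)).symm)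

lemma triangle (F : DblHom k C D) (G : DblHom k D E) :
    (associator F (DblHom.id k D) G).hom ≫ whiskerLeft F (leftUnitor G).hom =
      whiskerRight (rightUnitor F).hom G := by
  refine hom_ext (fun A => ?_) (fun m => ?_)
  · exact ((congrArg₂ (· ≫ ·) (associator_hom_app F (DblHom.id k D) G A)
      (leftUnitor_hom_app G _)).trans (Category.comp_id _)).trans
      ((congrArg G.functor.F₀.map (rightUnitor_hom_app F A)).trans (G.functor.F₀.map_id _)).symm
  · exact ((congrArg₂ (· ≫ ·) (associator_hom_cellApp F (DblHom.id k D) G m)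
      (leftUnitor_hom_cellApp G _)).trans (Category.comp_id _)).trans
      ((congrArg G.functor.cell (rightUnitor_hom_cellApp F m)).trans (G.functor.cell_id _)).symm

end DblHom

/-- The bicategory of double categories, double functors of kind `k` and transformations. -/
instance (k : FunctorKind) : Bicategory (DblOf.{v, u} k) where
  Hom C D := DblHom.{v, u} k C.toDoubleCat D.toDoubleCat
  id C := DblHom.id k C.toDoubleCat
  comp F G := DblHom.comp F G
  homCategory C D := DblHom.category k C.toDoubleCat D.toDoubleCat
  whiskerLeft F _ _ τ := DblHom.whiskerLeft F τ
  whiskerRight τ H := DblHom.whiskerRight τ H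
  associator F G H := DblHom.associator F G H
  leftUnitor F := DblHom.leftUnitor F
  rightUnitor F := DblHom.rightUnitor F
  whiskerLeft_id _ _ := rfl
  whiskerLeft_comp _ _ _ _ _ _ := rfl
  id_whiskerLeft τ := DblHom.id_whiskerLeft τ
  comp_whiskerLeft F G _ _ τ := DblHom.comp_whiskerLeft F G τ
  id_whiskerRight F G := DblHom.id_whiskerRight F G
  comp_whiskerRight σ τ K := DblHom.comp_whiskerRight σ τ K
  whiskerRight_id τ := DblHom.whiskerRight_id τ
  whiskerRight_comp τ G H := DblHom.whiskerRight_comp τ G H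
  whisker_assoc F _ _ τ H := DblHom.whisker_assoc F τ H
  whisker_exchange σ τ := DblHom.whisker_exchange σ τ
  pentagon F G H K := DblHom.pentagon F G H K
  triangle F G := DblHom.triangle F G

/-- The bicategory `DblOf k` is a 2-category. -/
instance (k : FunctorKind) : Bicategory.Strict (DblOf.{v, u} k) where
  id_comp F := DblHom.id_comp (k := k) F
  comp_id F := DblHom.comp_id (k := k) F
  assoc F G H := DblHom.comp_assoc (k := k) F G H
  leftUnitor_eqToIso _ := rfl
  rightUnitor_eqToIso _ := rfl
  associator_eqToIso _ _ _ := rfl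

/-! ### Internal fibrations in a 2-category -/

section

open Bicategory

variable {𝒦 : Type*} [Bicategory 𝒦] [Bicategory.Strict 𝒦]

/-- A 2-cell `α : e' ⟶ e` into the total object is `P`-Cartesian: for all `x : Y ⟶ X` and
`e'' : Y ⟶ E`, a 2-cell `ξ : e'' ⟶ x ≫ e` together with a factorization `γ` of `ξ ▷ P` through
`x ◁ α ▷ P` lifts uniquely to a factorization of `ξ` through `x ◁ α`. -/
def IsCartesianTwoCell {X E B : 𝒦} (P : E ⟶ B) {e' e : X ⟶ E} (α : e' ⟶ e) : Prop :=
  ∀ (Y : 𝒦) (x : Y ⟶ X) (e'' : Y ⟶ E) (ξ : e'' ⟶ x ≫ e) (γ : e'' ≫ P ⟶ (x ≫ e') ≫ P),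
    ξ ▷ P = γ ≫ (x ◁ α) ▷ P →
      ∃! ζ : e'' ⟶ x ≫ e', ξ = ζ ≫ x ◁ α ∧ ζ ▷ P = γ

/-- A 1-cell `P : E ⟶ B` of a 2-category is an internal (Street) fibration: every 2-cell
`β : b ⟶ e ≫ P` has a Cartesian lift, i.e. `b = e' ≫ P` and `β = α ▷ P` for a `P`-Cartesian
2-cell `α : e' ⟶ e`. -/
def IsInternalFibration {E B : 𝒦} (P : E ⟶ B) : Prop :=
  ∀ (X : 𝒦) (e : X ⟶ E) (b : X ⟶ B) (β : b ⟶ e ≫ P),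
    ∃ (e' : X ⟶ E) (α : e' ⟶ e) (h : e' ≫ P = b),
      α ▷ P = eqToHom h ≫ β ∧ IsCartesianTwoCell P α

end

/-! ### Fibrations of categories and cleavages -/

section

universe v₁ v₂ u₁ u₂

variable {𝒳 : Type u₁} {𝒮 : Type u₂} [Category.{v₁} 𝒳] [Category.{v₂} 𝒮]

/-- The Cartesian arrows of a functor. -/
def cartesianArrows (p : 𝒳 ⥤ 𝒮) : MorphismProperty 𝒳 :=
  fun _ _ φ => p.IsStronglyCartesian (p.map φ) φ

/-- A functor is a fibration when each arrow `b ⟶ p e` has a Cartesian lift with codomain `e`. -/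
def IsFibration (p : 𝒳 ⥤ 𝒮) : Prop :=
  ∀ ⦃b : 𝒮⦄ ⦃e : 𝒳⦄ (u : b ⟶ p.obj e), ∃ (e' : 𝒳) (φ : e' ⟶ e), p.IsStronglyCartesian u φ

/-- A cleavage: a choice of a Cartesian lift of each arrow `b ⟶ p e`. -/
structure Cleavage (p : 𝒳 ⥤ 𝒮) where
  dom : ∀ {b : 𝒮} {e : 𝒳}, (b ⟶ p.obj e) → 𝒳
  lift : ∀ {b : 𝒮} {e : 𝒳} (u : b ⟶ p.obj e), dom u ⟶ e
  isStronglyCartesian : ∀ {b : 𝒮} {e : 𝒳} (u : b ⟶ p.obj e), p.IsStronglyCartesian u (lift u)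

/-- The family of arrows chosen by a cleavage. -/
inductive Cleavage.arrows {p : 𝒳 ⥤ 𝒮} (c : Cleavage p) : MorphismProperty 𝒳
  | lift {b : 𝒮} {e : 𝒳} (u : b ⟶ p.obj e) : Cleavage.arrows c (c.lift u)

end

/-! ### The conditions on a double functor -/

namespace LaxDoubleFunctor

variable {E B : DoubleCat.{v, u}} (P : LaxDoubleFunctor E B)

/-- The arrows of the pointwise cleavage of `P₁ ×_{P₀} P₁` induced by a cleavage of `P₁`. -/
def pairArrows (c₁ : Cleavage P.F₁) : MorphismProperty E.Pair :=
  fun _ _ f => c₁.arrows f.fst ∧ c₁.arrows f.snd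

/-- `src` and `tgt` are cleavage-preserving. -/
structure SrcTgtPreserveCleavages (c₀ : Cleavage P.F₀) (c₁ : Cleavage P.F₁) : Prop where
  src : c₁.arrows ≤ c₀.arrows.inverseImage E.src
  tgt : c₁.arrows ≤ c₀.arrows.inverseImage E.tgt

/-- `y` and `⊗` are cleavage-preserving. -/
structure UnitTensorPreserveCleavages (c₀ : Cleavage P.F₀) (c₁ : Cleavage P.F₁) : Prop where
  unit : c₀.arrows ≤ c₁.arrows.inverseImage E.unit
  tensor : P.pairArrows c₁ ≤ c₁.arrows.inverseImage E.tensor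

/-- `y` and `⊗` preserve Cartesian arrows, with respect to `P₀`, `P₁` and `P₁ ×_{P₀} P₁`. -/
structure UnitTensorPreserveCartesian : Prop where
  unit : cartesianArrows P.F₀ ≤ (cartesianArrows P.F₁).inverseImage E.unit
  tensor : cartesianArrows P.F₂ ≤ (cartesianArrows P.F₁).inverseImage E.tensor

/-- A lax double functor, as a 1-cell of `DblLax`. -/
def toDblLax : (⟨E⟩ : DblLax.{v, u}) ⟶ ⟨B⟩ :=
  ⟨P, True.intro⟩

/-- A pseudo double functor, as a 1-cell of `Dbl`. -/
def toDbl (hP : P.IsPseudo) : (⟨E⟩ : Dbl.{v, u}) ⟶ ⟨B⟩ :=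
  ⟨P, hP⟩

/-- A strict double functor, as a 1-cell of `DblStrict`. -/
def toDblStrict (hP : P.IsStrict) : (⟨E⟩ : DblStrict.{v, u}) ⟶ ⟨B⟩ :=
  ⟨P, hP⟩

end LaxDoubleFunctor

/-!
A transformation of double functors is a family of arrows and cells, so the theorem reduces to a
comparison between internal and pointwise lifts.

*Cartesian transformations are pointwise.* A transformation into `E` is a `P`-Cartesian 2-cell
exactly when its components are Cartesian for `P₀` and `P₁`
(`VertTrans.IsPointwiseCartesian.isCartesianTwoCell`, `IsCartesianTwoCell.isPointwiseCartesian`).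
For the second direction, the universal property of a Cartesian 2-cell is tested on the walking
proarrow `walkingProarrow`: a strict double functor out of it picks a proarrow, and a transformation
out of such a functor is a single cell, since its components at the remaining proarrows, all of them
external units, are forced. Testing at external units gives the components at objects, because an
arrow into `e A` is the source of a cell into `e (y A)`.

*From cleavages to an internal fibration.* Given `β : b ⟶ e ≫ P`, the chosen lifts of the
components of `β` have matching sources and targets because `src` and `tgt` preserve the cleavages,
and the universal property of these lifts supplies the rest of a lax double functor `e'` over `b`,
comparison cells included (`VertTrans.exists_lift_of_cleavages`). The comparison cells of `e'`
compare the Cartesian cells `y α` and `α ⊗ α` with the components of `α`; so they are invertible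
when `y` and `⊗` preserve Cartesian arrows (`VertTrans.isPseudo_of_isPointwiseCartesian`), and
identities when `y` and `⊗` preserve the cleavages (`VertTrans.isStrict_of_arrows`).

*From an internal fibration to cleavages.* The comma double category `B ↓ P` exists because `P` is
lax, its projections `base` and `tot` are strict, and its objects and proarrows are exactly the
lifting problems for `P₀` and `P₁`. One Cartesian lift `α` of the universal transformation
`base ⟶ tot ≫ P` therefore yields both cleavages at once, compatible with `src` and `tgt`
(`commaDoubleCat.IsUniversalLift.srcTgtPreserveCleavages`). The unit and composition axioms of `α`
read `y α = ι ≫ α` and `α ⊗ α = φ ≫ α`; when `ι` and `φ` are invertible, respectively identities,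
this gives the condition on `y` and `⊗` for the components of `α`, and every Cartesian arrow,
respectively every chosen one, differs from such a component by an isomorphism, respectively an
identity.
-/

/-! ### Cartesian arrows and cleavages -/

section

universe v₁ v₂ u₁ u₂

variable {𝒳 : Type u₁} {𝒮 : Type u₂} [Category.{v₁} 𝒳] [Category.{v₂} 𝒮] {p : 𝒳 ⥤ 𝒮}

namespace cartesianArrows

lemma exists_lift {a b c : 𝒳} {φ : a ⟶ b} (h : cartesianArrows p φ) (g : c ⟶ b)
    (w : p.obj c ⟶ p.obj a) (hw : w ≫ p.map φ = p.map g) :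
    ∃ k : c ⟶ a, k ≫ φ = g ∧ p.map k = w := by
  have : p.IsStronglyCartesian (p.map φ) φ := h
  have : p.IsHomLift (w ≫ p.map φ) g := by rw [hw]; infer_instance
  obtain ⟨k, ⟨hk, hk'⟩, -⟩ :=
    Functor.IsStronglyCartesian.universal_property' (p := p) (f := p.map φ) (φ := φ) w g
  exact ⟨k, hk', (IsHomLift.eq_of_isHomLift p w k).symm⟩

lemma hom_ext {a b c : 𝒳} {φ : a ⟶ b} (h : cartesianArrows p φ) {k k' : c ⟶ a}
    (h₁ : k ≫ φ = k' ≫ φ) (h₂ : p.map k = p.map k') : k = k' := by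
  have : p.IsStronglyCartesian (p.map φ) φ := h
  have : p.IsHomLift (p.map k' ≫ p.map φ) (k' ≫ φ) := by rw [← p.map_comp]; infer_instance
  have hk : p.IsHomLift (p.map k') k := by rw [← h₂]; infer_instance
  exact (Functor.IsStronglyCartesian.universal_property' (p := p) (f := p.map φ) (φ := φ)
    (p.map k') (k' ≫ φ)).unique ⟨hk, h₁⟩ ⟨inferInstance, rfl⟩

lemma of_lift_of_ext {a b : 𝒳} {φ : a ⟶ b}
    (h : ∀ {c : 𝒳} (g : c ⟶ b) (w : p.obj c ⟶ p.obj a), w ≫ p.map φ = p.map g →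
      ∃ k : c ⟶ a, k ≫ φ = g ∧ p.map k = w)
    (h' : ∀ {c : 𝒳} (k k' : c ⟶ a), k ≫ φ = k' ≫ φ → p.map k = p.map k' → k = k') :
    cartesianArrows p φ where
  universal_property' {c} w g hg := by
    obtain ⟨k, hk, hk'⟩ := h g w (IsHomLift.eq_of_isHomLift p _ g)
    refine ⟨k, ⟨hk' ▸ inferInstance, hk⟩, fun k' ⟨_, h₂⟩ => h' _ _ (h₂.trans hk.symm) ?_⟩
    rw [hk', ← IsHomLift.eq_of_isHomLift p w k']

lemma iso_comp {a a' b : 𝒳} (k : a' ⟶ a) [IsIso k] {φ : a ⟶ b} (h : cartesianArrows p φ) :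
    cartesianArrows p (k ≫ φ) := by
  refine of_lift_of_ext (fun {c} g w hw => ?_) (fun l l' h₁ h₂ => ?_)
  · obtain ⟨l, hl, hl'⟩ := h.exists_lift g (w ≫ p.map k) (by simpa using hw)
    exact ⟨l ≫ inv k, by simpa using hl, by simp [hl']⟩
  · rw [← cancel_mono k]
    exact h.hom_ext (by simpa using h₁) (by simp [h₂])

lemma comp_iso {a b b' : 𝒳} {φ : a ⟶ b} (h : cartesianArrows p φ) (k : b ⟶ b') [IsIso k] :
    cartesianArrows p (φ ≫ k) := by
  refine of_lift_of_ext (fun {c} g w hw => ?_) (fun l l' h₁ h₂ => ?_)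
  · obtain ⟨l, hl, hl'⟩ := h.exists_lift (g ≫ inv k) w (by simp [← hw])
    exact ⟨l, by simp [reassoc_of% hl], hl'⟩
  · exact h.hom_ext (by simpa using congrArg (· ≫ inv k) h₁) h₂

/-- A comparison between Cartesian arrows is invertible as soon as its image is. -/
lemma isIso_of_comp {a a' b : 𝒳} {k : a' ⟶ a} {φ : a ⟶ b} (h : cartesianArrows p φ)
    (h' : cartesianArrows p (k ≫ φ)) (hk : IsIso (p.map k)) : IsIso k := by
  obtain ⟨l, hl, hl'⟩ := h'.exists_lift φ (inv (p.map k)) (by simp)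
  refine ⟨l, h'.hom_ext (by simp [hl]) (by simp [hl']), h.hom_ext (by simpa using hl)
    (by simp [hl'])⟩

lemma of_isStronglyCartesian {b : 𝒮} {a e : 𝒳} {u : b ⟶ p.obj e} {φ : a ⟶ e}
    (h : p.IsStronglyCartesian u φ) : cartesianArrows p φ := by
  obtain rfl := IsHomLift.domain_eq p u φ
  obtain rfl := IsHomLift.eq_of_isHomLift p u φ
  exact h

/-- The image of a Cartesian arrow over `u` is `u`, up to the equality of domains. -/
lemma map_eq {b : 𝒮} {a e : 𝒳} {u : b ⟶ p.obj e} {φ : a ⟶ e} (h : p.IsStronglyCartesian u φ) :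
    ∃ h : p.obj a = b, p.map φ = eqToHom h ≫ u := by
  obtain rfl := IsHomLift.domain_eq p u φ
  obtain rfl := IsHomLift.eq_of_isHomLift p u φ
  exact ⟨rfl, by simp⟩

lemma isStronglyCartesian {b : 𝒮} {a e : 𝒳} {u : b ⟶ p.obj e} {φ : a ⟶ e}
    (h : cartesianArrows p φ) (h' : p.obj a = b) (hu : p.map φ = eqToHom h' ≫ u) :
    p.IsStronglyCartesian u φ := by
  subst h'
  obtain rfl : p.map φ = u := by simpa using hu
  exact h

end cartesianArrows

lemma Cleavage.isFibration (c : Cleavage p) : IsFibration p :=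
  fun _ _ u => ⟨c.dom u, c.lift u, c.isStronglyCartesian u⟩

namespace Cleavage

variable {c : Cleavage p}

lemma arrows.cartesian {a e : 𝒳} {f : a ⟶ e} (h : c.arrows f) : cartesianArrows p f := by
  obtain ⟨u⟩ := h
  exact .of_isStronglyCartesian (c.isStronglyCartesian u)

lemma arrows.eq_lift {a e : 𝒳} {f : a ⟶ e} (h : c.arrows f) {b : 𝒮} {u : b ⟶ p.obj e}
    (hb : p.obj a = b) (hf : p.map f = eqToHom hb ≫ u) :
    ∃ h : a = c.dom u, f = eqToHom h ≫ c.lift u := by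
  obtain ⟨u'⟩ := h
  obtain ⟨h₁, h₂⟩ := cartesianArrows.map_eq (c.isStronglyCartesian u')
  obtain rfl := h₁.symm.trans hb
  obtain rfl : u' = u := (cancel_epi (eqToHom h₁)).1 (h₂.symm.trans hf)
  exact ⟨rfl, by simp⟩

lemma arrows.eqToHom_comp {a a' e : 𝒳} {f : a ⟶ e} (hf : c.arrows f) (h : a' = a) :
    c.arrows (eqToHom h ≫ f) := by
  subst h; simpa using hf

/-- Two chosen arrows with the same image are equal. -/
lemma arrows.unique {a a' e : 𝒳} {f : a ⟶ e} {g : a' ⟶ e} (hf : c.arrows f) (hg : c.arrows g)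
    (h : p.obj a = p.obj a') (hfg : p.map f = eqToHom h ≫ p.map g) :
    ∃ h : a = a', f = eqToHom h ≫ g := by
  obtain ⟨h₁, h₂⟩ := hf.eq_lift h hfg
  obtain ⟨h₃, h₄⟩ := hg.eq_lift rfl (Category.id_comp _).symm
  refine ⟨h₁.trans h₃.symm, ?_⟩
  have h₅ : c.lift (p.map g) = eqToHom h₃.symm ≫ g := by
    rw [← cancel_epi (eqToHom h₃)]
    simpa using h₄.symm
  exact h₂.trans (by rw [h₅]; simp)

end Cleavage

end

/-! ### Calculus in a double category -/

namespace DoubleCat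

variable {D : DoubleCat.{v, u}}

lemma srcMap_eqToHom {A B A' B' : D.Obj} {m : D.Hor A B} {m' : D.Hor A' B'}
    (h : Proarrow.mk m = Proarrow.mk m') :
    D.srcMap (eqToHom h) = eqToHom (congrArg Proarrow.src h) :=
  eqToHom_map D.src h

lemma tgtMap_eqToHom {A B A' B' : D.Obj} {m : D.Hor A B} {m' : D.Hor A' B'}
    (h : Proarrow.mk m = Proarrow.mk m') :
    D.tgtMap (eqToHom h) = eqToHom (congrArg Proarrow.tgt h) :=
  eqToHom_map D.tgt h

lemma tensMap_eqToHom {A B C : D.Obj} {m m' : D.Hor A B} {n n' : D.Hor B C} (hm : m = m')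
    (hn : n = n') (h) :
    D.tensMap (eqToHom (congrArg Proarrow.mk hm)) (eqToHom (congrArg Proarrow.mk hn)) h =
      eqToHom (by rw [hm, hn]) := by
  subst hm hn
  exact D.tensMap_id _ _

section

variable {A B C A' B' C' A'' C'' : D.Obj}

lemma tensMap_comp_left {B'' : D.Obj} {m : D.Hor A B} {n : D.Hor B C} {m' : D.Hor A' B}
    {m'' : D.Hor A'' B''} {n'' : D.Hor B'' C''} (f : Proarrow.mk m ⟶ Proarrow.mk m')
    (g : Proarrow.mk m' ⟶ Proarrow.mk m'') (κ : Proarrow.mk n ⟶ Proarrow.mk n'') (h₁ h₂) (h₃) :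
    D.tensMap f (𝟙 (Proarrow.mk n)) h₁ ≫ D.tensMap g κ h₂ = D.tensMap (f ≫ g) κ h₃ := by
  rw [← D.tensMap_comp]
  exact LaxDoubleFunctor.tensMap_congr rfl (Category.id_comp _) _

lemma tensMap_comp_right {B'' : D.Obj} {m : D.Hor A B} {n : D.Hor B C} {n' : D.Hor B C'}
    {m'' : D.Hor A'' B''} {n'' : D.Hor B'' C''} (κ : Proarrow.mk m ⟶ Proarrow.mk m'')
    (f : Proarrow.mk n ⟶ Proarrow.mk n') (g : Proarrow.mk n' ⟶ Proarrow.mk n'') (h₁ h₂) (h₃) :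
    D.tensMap (𝟙 (Proarrow.mk m)) f h₁ ≫ D.tensMap κ g h₂ = D.tensMap κ (f ≫ g) h₃ := by
  rw [← D.tensMap_comp]
  exact LaxDoubleFunctor.tensMap_congr (Category.id_comp _) rfl _

lemma tensMap_left_comp {m : D.Hor A B} {n : D.Hor B C} {m' : D.Hor A' B'}
    {m'' : D.Hor A'' B'} {n' : D.Hor B' C'} (f : Proarrow.mk m ⟶ Proarrow.mk m')
    (g : Proarrow.mk m' ⟶ Proarrow.mk m'') (κ : Proarrow.mk n ⟶ Proarrow.mk n') (h₁ h₂) (h₃) :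
    D.tensMap f κ h₁ ≫ D.tensMap g (𝟙 (Proarrow.mk n')) h₂ = D.tensMap (f ≫ g) κ h₃ := by
  rw [← D.tensMap_comp]
  exact LaxDoubleFunctor.tensMap_congr rfl (Category.comp_id _) _

lemma tensMap_right_comp {m : D.Hor A B} {n : D.Hor B C} {m' : D.Hor A' B'}
    {n' : D.Hor B' C'} {n'' : D.Hor B' C''} (κ : Proarrow.mk m ⟶ Proarrow.mk m')
    (f : Proarrow.mk n ⟶ Proarrow.mk n') (g : Proarrow.mk n' ⟶ Proarrow.mk n'') (h₁ h₂) (h₃) :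
    D.tensMap κ f h₁ ≫ D.tensMap (𝟙 (Proarrow.mk m')) g h₂ = D.tensMap κ (f ≫ g) h₃ := by
  rw [← D.tensMap_comp]
  exact LaxDoubleFunctor.tensMap_congr (Category.comp_id _) rfl _

end

lemma tens_congr {A B C A' B' C' : D.Obj} {m : D.Hor A B} {n : D.Hor B C}
    {m' : D.Hor A' B'} {n' : D.Hor B' C'} (hm : Proarrow.mk m = Proarrow.mk m')
    (hn : Proarrow.mk n = Proarrow.mk n') :
    Proarrow.mk (D.tens m n) = Proarrow.mk (D.tens m' n') := by
  cases hm; cases hn; rfl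

lemma tensMap_eqToHom_comp {A B C A' B' C' A'' B'' C'' : D.Obj} {m : D.Hor A B} {n : D.Hor B C}
    {m' : D.Hor A' B'} {n' : D.Hor B' C'} {m'' : D.Hor A'' B''} {n'' : D.Hor B'' C''}
    (hm : Proarrow.mk m = Proarrow.mk m') (hn : Proarrow.mk n = Proarrow.mk n')
    (θ : Proarrow.mk m' ⟶ Proarrow.mk m'') (κ : Proarrow.mk n' ⟶ Proarrow.mk n'')
    (h : D.tgtMap θ = D.srcMap κ) (h') :
    D.tensMap (eqToHom hm ≫ θ) (eqToHom hn ≫ κ) h' =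
      eqToHom (tens_congr hm hn) ≫ D.tensMap θ κ h := by
  cases hm; cases hn
  simp

lemma assoc_congr {A B C E : D.Obj} {m m' : D.Hor A B} {n n' : D.Hor B C} {p p' : D.Hor C E}
    (hm : m = m') (hn : n = n') (hp : p = p') :
    (D.assoc m n p).hom = eqToHom (by rw [hm, hn, hp]) ≫ (D.assoc m' n' p').hom ≫
      eqToHom (by rw [hm, hn, hp]) := by
  subst hm hn hp
  simp

lemma id_unit_tensMap {A B B' : D.Obj} {m : D.Hor A B} {m' : D.Hor A B'}
    (θ : Proarrow.mk m ⟶ Proarrow.mk m') (hθ : D.srcMap θ = 𝟙 A) (h) :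
    D.tensMap (𝟙 (Proarrow.mk (D.y A))) θ h =
      eqToHom (congrArg Proarrow.mk (D.unit_tens m)) ≫ θ ≫
        eqToHom (congrArg Proarrow.mk (D.unit_tens m').symm) := by
  rw [← D.unit_tensMap θ]
  exact LaxDoubleFunctor.tensMap_congr ((D.yMap_id A).symm.trans (congrArg _ hθ.symm)) rfl _

/-- An associator whose first entry is a unit is an identity: this is the pentagon axiom for two
units followed by `m` and `n`, in which all other occurrences of the associator are those of the
triangle axiom. -/
lemma assoc_unit_left {B C E : D.Obj} (m : D.Hor B C) (n : D.Hor C E) :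
    (D.assoc (D.y B) m n).hom = eqToHom (by rw [D.unit_tens, D.unit_tens]) := by
  have hp := D.pentagon (D.y B) (D.y B) m n
  have h₁ : D.tensMap (D.assoc (D.y B) (D.y B) m).hom (𝟙 (Proarrow.mk n))
      ((D.tgt_assoc _ _ m).trans (D.srcMap_id n).symm) =
      eqToHom (by simp only [D.unit_tens]) :=
    (LaxDoubleFunctor.tensMap_congr (D.triangle _ _) rfl _).trans
      (tensMap_eqToHom (by simp only [D.unit_tens]) rfl _)
  rw [h₁, assoc_congr rfl (D.unit_tens m) rfl, assoc_congr (D.unit_tens (D.y B)) rfl rfl,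
    D.triangle, id_unit_tensMap _ (D.src_assoc _ _ _)] at hp
  simp only [Category.assoc, eqToHom_trans_assoc, eqToHom_trans] at hp
  have h₂ := (cancel_epi (D.assoc (D.y B) m n).hom).1 ((cancel_epi _).1 hp)
  rw [eqToHom_comp_iff, comp_eqToHom_iff] at h₂
  simpa using h₂

/-- A pair of externally composable cells is invertible when its components are. -/
lemma isIso_pair {M N : D.Pair} (f : M ⟶ N) (h₁ : IsIso f.fst) (h₂ : IsIso f.snd) : IsIso f := by
  have hw : D.tgtMap (inv f.fst) = D.srcMap (inv f.snd) := by
    have e₁ : D.tgtMap f.fst ≫ D.tgtMap (inv f.fst) = 𝟙 _ := by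
      rw [← D.tgtMap_comp, IsIso.hom_inv_id, D.tgtMap_id]
    have e₂ : D.srcMap (inv f.snd) ≫ D.srcMap f.snd = 𝟙 _ := by
      rw [← D.srcMap_comp, IsIso.inv_hom_id, D.srcMap_id]
    rw [f.w] at e₁
    exact ((Category.id_comp _).symm.trans (e₂ ▸ Category.assoc _ _ _)).trans
      ((congrArg _ e₁).trans (Category.comp_id _))
  exact ⟨⟨inv f.fst, inv f.snd, hw⟩, PairHom.ext (IsIso.hom_inv_id _) (IsIso.hom_inv_id _),
    PairHom.ext (IsIso.inv_hom_id _) (IsIso.inv_hom_id _)⟩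

lemma isIso_tensMap {A B C A' B' C' : D.Obj} {m : D.Hor A B} {n : D.Hor B C}
    {m' : D.Hor A' B'} {n' : D.Hor B' C'}
    (θ : Proarrow.mk m ⟶ Proarrow.mk m') (κ : Proarrow.mk n ⟶ Proarrow.mk n')
    (h : D.tgtMap θ = D.srcMap κ) [h₁ : IsIso θ] [h₂ : IsIso κ] : IsIso (D.tensMap θ κ h) := by
  let f : (⟨m, n⟩ : D.Pair) ⟶ ⟨m', n'⟩ := ⟨θ, κ, h⟩
  have : IsIso f := isIso_pair f h₁ h₂
  exact inferInstanceAs (IsIso (D.tensor.map f))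

end DoubleCat

namespace LaxDoubleFunctor

variable {C D : DoubleCat.{v, u}} (F : LaxDoubleFunctor C D)

/-- The left unit axiom of `F`, with the cell `θ` into `F m` in place of its identity. -/
lemma unit_tensMap_φ {A B : D.Obj} {A' B' : C.Obj} {N : D.Hor A B} {m : C.Hor A' B'}
    (θ : Proarrow.mk N ⟶ Proarrow.mk (F.hor m)) (f : A ⟶ F.F₀.obj A') (hf : D.srcMap θ = f) (h) :
    D.tensMap (D.yMap f ≫ F.ι A') θ h ≫ F.φ (C.y A') m =
      eqToHom (congrArg Proarrow.mk (D.unit_tens N)) ≫ θ ≫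
        eqToHom (by rw [C.unit_tens]) := by
  subst hf
  rw [← D.tensMap_left_comp _ _ _ (D.tgt_yMap _) ((F.tgt_ι _).trans (D.srcMap_id _).symm),
    Category.assoc, F.left_unitality, D.unit_tensMap]
  simp

/-- The right unit axiom of `F`, with the cell `θ` into `F m` in place of its identity. -/
lemma tensMap_unit_φ {A B : D.Obj} {A' B' : C.Obj} {N : D.Hor A B} {m : C.Hor A' B'}
    (θ : Proarrow.mk N ⟶ Proarrow.mk (F.hor m)) (f : B ⟶ F.F₀.obj B') (hf : D.tgtMap θ = f) (h) :
    D.tensMap θ (D.yMap f ≫ F.ι B') h ≫ F.φ m (C.y B') =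
      eqToHom (congrArg Proarrow.mk (D.tens_unit N)) ≫ θ ≫
        eqToHom (by rw [C.tens_unit]) := by
  subst hf
  rw [← D.tensMap_right_comp _ _ _ (D.src_yMap _).symm ((D.tgtMap_id _).trans (F.src_ι _).symm),
    Category.assoc, F.right_unitality, D.tensMap_unit]
  simp

variable {F}

/-- The unit comparison of a pseudo double functor, as an isomorphism. -/
noncomputable def IsPseudo.ιIso (hF : F.IsPseudo) (A : C.Obj) :
    Proarrow.mk (D.y (F.F₀.obj A)) ≅ Proarrow.mk (F.hor (C.y A)) :=
  @asIso _ _ _ _ (F.ι A) (hF.isIso_ι A)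

lemma IsPseudo.ι_comp_ιIso_inv (hF : F.IsPseudo) (A : C.Obj) : F.ι A ≫ (hF.ιIso A).inv = 𝟙 _ :=
  (hF.ιIso A).hom_inv_id

lemma IsPseudo.srcMap_ιIso_inv (hF : F.IsPseudo) (A : C.Obj) :
    D.srcMap (hF.ιIso A).inv = 𝟙 (F.F₀.obj A) := by
  have := congrArg (fun θ => D.srcMap θ) (hF.ι_comp_ιIso_inv A)
  simpa only [D.srcMap_comp, F.src_ι, D.srcMap_id, Category.id_comp] using this

lemma IsPseudo.tgtMap_ιIso_inv (hF : F.IsPseudo) (A : C.Obj) :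
    D.tgtMap (hF.ιIso A).inv = 𝟙 (F.F₀.obj A) := by
  have := congrArg (fun θ => D.tgtMap θ) (hF.ι_comp_ιIso_inv A)
  simpa only [D.tgtMap_comp, F.tgt_ι, D.tgtMap_id, Category.id_comp] using this

/-- The composition comparison of a pseudo double functor, as an isomorphism. -/
noncomputable def IsPseudo.φIso (hF : F.IsPseudo) {A A' A'' : C.Obj} (m : C.Hor A A')
    (n : C.Hor A' A'') :
    Proarrow.mk (D.tens (F.hor m) (F.hor n)) ≅ Proarrow.mk (F.hor (C.tens m n)) :=
  @asIso _ _ _ _ (F.φ m n) (hF.isIso_φ m n)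

lemma IsPseudo.φ_comp_φIso_inv (hF : F.IsPseudo) {A A' A'' : C.Obj} (m : C.Hor A A')
    (n : C.Hor A' A'') : F.φ m n ≫ (hF.φIso m n).inv = 𝟙 _ :=
  (hF.φIso m n).hom_inv_id

section unitCell

variable {G F : LaxDoubleFunctor C D} {A B : C.Obj}

/-- The cell at the unit of `A` that a transformation with component `f` at `A` must have. -/
noncomputable def IsPseudo.unitCell (hG : G.IsPseudo) (f : G.F₀.obj A ⟶ F.F₀.obj A) :
    Proarrow.mk (G.hor (C.y A)) ⟶ Proarrow.mk (F.hor (C.y A)) :=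
  (hG.ιIso A).inv ≫ D.yMap f ≫ F.ι A

variable (hG : G.IsPseudo)

lemma IsPseudo.ι_comp_unitCell (f : G.F₀.obj A ⟶ F.F₀.obj A) :
    G.ι A ≫ hG.unitCell f = D.yMap f ≫ F.ι A := by
  rw [unitCell, ← Category.assoc, hG.ι_comp_ιIso_inv, Category.id_comp]

lemma IsPseudo.srcMap_unitCell (f : G.F₀.obj A ⟶ F.F₀.obj A) :
    D.srcMap (hG.unitCell f) = f := by
  rw [unitCell, D.srcMap_comp, D.srcMap_comp, D.src_yMap, F.src_ι, hG.srcMap_ιIso_inv,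
    Category.comp_id, Category.id_comp]

lemma IsPseudo.tgtMap_unitCell (f : G.F₀.obj A ⟶ F.F₀.obj A) :
    D.tgtMap (hG.unitCell f) = f := by
  rw [unitCell, D.tgtMap_comp, D.tgtMap_comp, D.tgt_yMap, F.tgt_ι, hG.tgtMap_ιIso_inv,
    Category.comp_id, Category.id_comp]

/-- At a unit followed by `m`, the compatibility of a transformation with the composition
comparisons is automatic. -/
lemma IsPseudo.unitCell_tens {m : C.Hor A B}
    (θ : Proarrow.mk (G.hor m) ⟶ Proarrow.mk (F.hor m)) (f : G.F₀.obj A ⟶ F.F₀.obj A)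
    (hf : D.srcMap θ = f) (h) :
    D.tensMap (hG.unitCell f) θ h ≫ F.φ (C.y A) m =
      G.φ (C.y A) m ≫ eqToHom (by rw [C.unit_tens]) ≫ θ ≫ eqToHom (by rw [C.unit_tens]) := by
  have hw := (G.tgt_ι A).trans (D.srcMap_id (G.hor m)).symm
  have := hG.isIso_ι A
  have := D.isIso_tensMap (G.ι A) (𝟙 (Proarrow.mk (G.hor m))) hw
  rw [← cancel_epi (D.tensMap (G.ι A) (𝟙 (Proarrow.mk (G.hor m))) hw), ← Category.assoc,
    ← D.tensMap_comp, ← Category.assoc (D.tensMap _ _ _), G.left_unitality]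
  simp only [hG.ι_comp_unitCell, Category.id_comp]
  rw [F.unit_tensMap_φ θ f hf]
  simp

/-- At `m` followed by a unit, the compatibility of a transformation with the composition
comparisons is automatic. -/
lemma IsPseudo.tens_unitCell {m : C.Hor A B}
    (θ : Proarrow.mk (G.hor m) ⟶ Proarrow.mk (F.hor m)) (f : G.F₀.obj B ⟶ F.F₀.obj B)
    (hf : D.tgtMap θ = f) (h) :
    D.tensMap θ (hG.unitCell f) h ≫ F.φ m (C.y B) =
      G.φ m (C.y B) ≫ eqToHom (by rw [C.tens_unit]) ≫ θ ≫ eqToHom (by rw [C.tens_unit]) := by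
  have hw := (D.tgtMap_id (G.hor m)).trans (G.src_ι B).symm
  have := hG.isIso_ι B
  have := D.isIso_tensMap (𝟙 (Proarrow.mk (G.hor m))) (G.ι B) hw
  rw [← cancel_epi (D.tensMap (𝟙 (Proarrow.mk (G.hor m))) (G.ι B) hw), ← Category.assoc,
    ← D.tensMap_comp, ← Category.assoc (D.tensMap _ _ _), G.right_unitality]
  simp only [hG.ι_comp_unitCell, Category.id_comp]
  rw [F.tensMap_unit_φ θ f hf]
  simp

end unitCell

end LaxDoubleFunctor

/-! ### The walking proarrow -/

/-- The discrete category on a type, with morphisms in an arbitrary universe. -/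
abbrev discreteCategoryOf (α : Type u) : Category.{v} α where
  Hom a b := ULift (PLift (a = b))
  id _ := ⟨⟨rfl⟩⟩
  comp f g := ⟨⟨f.down.down.trans g.down.down⟩⟩

/-- The objects of the walking proarrow. -/
inductive Walking : Type u
  | s
  | t

/-- The proarrows of the walking proarrow: two units and the generic proarrow. -/
inductive WalkingHor : Walking.{u} → Walking.{u} → Type u
  | unitS : WalkingHor .s .s
  | gen : WalkingHor .s .t
  | unitT : WalkingHor .t .t

namespace WalkingHor

instance (a b : Walking.{u}) : Subsingleton (WalkingHor a b) :=
  ⟨fun m n => by cases m <;> cases n <;> rfl⟩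

/-- The external units of the walking proarrow. -/
def unit : ∀ a : Walking.{u}, WalkingHor a a
  | .s => unitS
  | .t => unitT

/-- External composition in the walking proarrow. -/
def tens : ∀ {a b c : Walking.{u}}, WalkingHor a b → WalkingHor b c → WalkingHor a c
  | _, _, _, unitS, n => n
  | _, _, _, gen, unitT => gen
  | _, _, _, unitT, n => n

end WalkingHor

/-- The walking proarrow: the double category freely generated by a single proarrow. Its arrows and
cells are identities. -/
def walkingProarrow : DoubleCat.{v, u} where
  Obj := Walking
  cat₀ := discreteCategoryOf _
  Hor := WalkingHor
  cat₁ := discreteCategoryOf _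
  srcMap θ := ⟨⟨congrArg Proarrow.src θ.down.down⟩⟩
  tgtMap θ := ⟨⟨congrArg Proarrow.tgt θ.down.down⟩⟩
  srcMap_id _ := rfl
  tgtMap_id _ := rfl
  srcMap_comp _ _ := rfl
  tgtMap_comp _ _ := rfl
  y := WalkingHor.unit
  yMap f := ⟨⟨by rw [f.down.down]⟩⟩
  src_yMap _ := rfl
  tgt_yMap _ := rfl
  yMap_id _ := rfl
  yMap_comp _ _ := rfl
  tens := WalkingHor.tens
  tensMap {A B C A' B' C' m n m' n'} θ κ _ := ⟨⟨by cases θ.down.down; cases κ.down.down; rfl⟩⟩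
  src_tensMap _ _ _ := rfl
  tgt_tensMap _ _ _ := rfl
  tensMap_id _ _ := rfl
  tensMap_comp _ _ _ _ _ _ := rfl
  unit_tens _ := Subsingleton.elim _ _
  tens_unit _ := Subsingleton.elim _ _
  unit_tensMap _ := ULift.ext _ _ (Subsingleton.elim _ _)
  tensMap_unit _ := ULift.ext _ _ (Subsingleton.elim _ _)
  assoc m n p := @Iso.mk _ (discreteCategoryOf _) _ _
    ⟨⟨congrArg Proarrow.mk (Subsingleton.elim _ _)⟩⟩
    ⟨⟨congrArg Proarrow.mk (Subsingleton.elim _ _)⟩⟩ rfl rfl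
  src_assoc _ _ _ := rfl
  tgt_assoc _ _ _ := rfl
  assoc_naturality _ _ _ _ _ := rfl
  pentagon _ _ _ _ := rfl
  triangle _ _ := ULift.ext _ _ (Subsingleton.elim _ _)

namespace walkingProarrow

lemma eq_of_hom {M N : (walkingProarrow.{v, u}).Pro} (θ : M ⟶ N) : M = N :=
  θ.down.down

lemma obj_eq_of_hom {a b : (walkingProarrow.{v, u}).Obj} (f : a ⟶ b) : a = b :=
  f.down.down

instance {M N : (walkingProarrow.{v, u}).Pro} : Subsingleton (M ⟶ N) :=
  ⟨fun _ _ => ULift.ext _ _ (Subsingleton.elim _ _)⟩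

instance {a b : (walkingProarrow.{v, u}).Obj} : Subsingleton (a ⟶ b) :=
  ⟨fun _ _ => ULift.ext _ _ (Subsingleton.elim _ _)⟩

variable {D : DoubleCat.{v, u}}

section

variable {A B : D.Obj} (N : D.Hor A B)

/-- The objects in the image of `pick N`. -/
def pickObj (_ : D.Hor A B) : Walking.{u} → D.Obj
  | .s => A
  | .t => B

/-- The proarrows in the image of `pick N`. -/
def pickHor : ∀ {a b : Walking.{u}}, WalkingHor a b → D.Hor (pickObj N a) (pickObj N b)
  | _, _, .unitS => D.y A
  | _, _, .gen => N
  | _, _, .unitT => D.y B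

lemma pickHor_unit (a : Walking.{u}) : D.y (pickObj N a) = pickHor N (WalkingHor.unit a) := by
  cases a <;> rfl

lemma pickHor_tens {a b c : Walking.{u}} (m : WalkingHor a b) (n : WalkingHor b c) :
    D.tens (pickHor N m) (pickHor N n) = pickHor N (WalkingHor.tens m n) := by
  cases m <;> cases n
  · exact D.unit_tens _
  · exact D.unit_tens _
  · exact D.tens_unit _
  · exact D.unit_tens _

/-- Three composable proarrows of the walking proarrow include at least two units, so that the
associator of their images is an identity. -/
lemma assoc_pickHor {a b c d : Walking.{u}} (m : WalkingHor a b) (n : WalkingHor b c)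
    (p : WalkingHor c d) :
    ∃ h, (D.assoc (pickHor N m) (pickHor N n) (pickHor N p)).hom = eqToHom h := by
  cases n
  · exact ⟨_, D.triangle _ _⟩
  · cases m
    exact ⟨_, D.assoc_unit_left _ _⟩
  · exact ⟨_, D.triangle _ _⟩

/-- The strict double functor that sends the generic proarrow to `N`. -/
def pick : LaxDoubleFunctor walkingProarrow.{v, u} D where
  F₀ :=
    { obj := pickObj N
      map := fun f => eqToHom (by rw [obj_eq_of_hom f])
      map_comp := fun _ _ => (eqToHom_trans _ _).symm }
  hor m := pickHor N m
  cell θ := eqToHom (congrArg (fun M => Proarrow.mk (pickHor N M.hor)) (eq_of_hom θ))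
  cell_id _ := rfl
  cell_comp _ _ := (eqToHom_trans _ _).symm
  src_cell _ := D.srcMap_eqToHom _
  tgt_cell _ := D.tgtMap_eqToHom _
  ι a := eqToHom (congrArg Proarrow.mk (pickHor_unit N a))
  src_ι _ := D.srcMap_eqToHom _
  tgt_ι _ := D.tgtMap_eqToHom _
  ι_naturality f := by
    obtain rfl := obj_eq_of_hom f
    obtain rfl : f = 𝟙 _ := Subsingleton.elim _ _
    simp [D.yMap_id]
  φ m n := eqToHom (congrArg Proarrow.mk (pickHor_tens N m n))
  src_φ _ _ := D.srcMap_eqToHom _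
  tgt_φ _ _ := D.tgtMap_eqToHom _
  φ_naturality θ κ h := by
    cases eq_of_hom θ
    cases eq_of_hom κ
    simp only [eqToHom_refl, D.tensMap_id, Category.id_comp, Category.comp_id]
  associativity m n p := by
    obtain ⟨h, h'⟩ := assoc_pickHor N m n p
    rw [h']
    have h₁ := D.tensMap_eqToHom (pickHor_tens N m n) (Eq.refl (pickHor N p))
      ((D.tgtMap_eqToHom _).trans (D.srcMap_eqToHom _).symm)
    have h₂ := D.tensMap_eqToHom (Eq.refl (pickHor N m)) (pickHor_tens N n p)
      ((D.tgtMap_eqToHom _).trans (D.srcMap_eqToHom _).symm)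
    exact (congrArg (· ≫ _) h₁).trans (((congrArg (_ ≫ ·) (eqToHom_trans _ _)).trans
      (eqToHom_trans _ _)).trans ((congrArg (_ ≫ ·) ((congrArg (· ≫ _) h₂).trans
        (eqToHom_trans _ _))).trans (eqToHom_trans _ _)).symm)
  left_unitality {a b} m := by
    have h₁ := D.tensMap_eqToHom (pickHor_unit N a) (Eq.refl (pickHor N m))
      ((D.tgtMap_eqToHom _).trans (D.srcMap_eqToHom _).symm)
    erw [h₁]
    exact eqToHom_trans _ _
  right_unitality {a b} m := by
    have h₁ := D.tensMap_eqToHom (Eq.refl (pickHor N m)) (pickHor_unit N b)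
      ((D.tgtMap_eqToHom _).trans (D.srcMap_eqToHom _).symm)
    erw [h₁]
    exact eqToHom_trans _ _

lemma pick_isStrict : (pick N).IsStrict where
  ι_eq a := ⟨pickHor_unit N a, rfl⟩
  φ_eq m n := ⟨pickHor_tens N m n, rfl⟩

end

/-- The generic proarrow. -/
abbrev gen : (walkingProarrow.{v, u}).Hor Walking.s Walking.t := WalkingHor.gen

variable {G F : LaxDoubleFunctor walkingProarrow.{v, u} D}

/-- The transformation out of a pseudo double functor on the walking proarrow determined by its
component at the generic proarrow. -/
noncomputable def ofCell (hG : G.IsPseudo)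
    (θ : Proarrow.mk (G.hor gen) ⟶ Proarrow.mk (F.hor gen)) : VertTrans G F where
  app a := match a with
    | .s => D.srcMap θ
    | .t => D.tgtMap θ
  cellApp m := match m with
    | .unitS => hG.unitCell (F := F) (A := Walking.s) (D.srcMap θ)
    | .gen => θ
    | .unitT => hG.unitCell (F := F) (A := Walking.t) (D.tgtMap θ)
  src_cellApp m := by
    cases m
    · exact hG.srcMap_unitCell _
    · rfl
    · exact hG.srcMap_unitCell _
  tgt_cellApp m := by
    cases m
    · exact hG.tgtMap_unitCell _
    · rfl
    · exact hG.tgtMap_unitCell _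
  naturality f := by
    obtain rfl := obj_eq_of_hom f
    obtain rfl : f = 𝟙 _ := Subsingleton.elim _ _
    simp
  cell_naturality θ := by
    cases eq_of_hom θ
    obtain rfl : θ = 𝟙 _ := Subsingleton.elim _ _
    simp [LaxDoubleFunctor.cell_id]
  unit a := by
    cases a <;> exact (hG.ι_comp_unitCell _).symm
  tensor m n := by
    have id_sandwich {M N : D.Pro} (f : M ⟶ N) : 𝟙 M ≫ f ≫ 𝟙 N = f := by simp
    cases m <;> cases n
    · exact (hG.unitCell_tens _ _ (hG.srcMap_unitCell _) _).trans (congrArg _ (id_sandwich _))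
    · exact (hG.unitCell_tens θ _ rfl _).trans (congrArg _ (id_sandwich _))
    · exact (hG.tens_unitCell θ _ rfl _).trans (congrArg _ (id_sandwich _))
    · exact (hG.unitCell_tens _ _ (hG.srcMap_unitCell _) _).trans (congrArg _ (id_sandwich _))

/-- The components of a transformation at external units are forced by its components at objects,
which are the source and the target of its component at the generic proarrow. -/
lemma ext_of_cell (hG : G.IsPseudo) {σ τ : VertTrans G F} (h : σ.cellApp gen = τ.cellApp gen) :
    σ = τ := by
  have h₀ : ∀ a, σ.app a = τ.app a
    | .s => by rw [← σ.src_cellApp gen, ← τ.src_cellApp gen, h]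
    | .t => by rw [← σ.tgt_cellApp gen, ← τ.tgt_cellApp gen, h]
  have h₁ : ∀ a, σ.cellApp (walkingProarrow.y a) = τ.cellApp (walkingProarrow.y a) := by
    intro a
    have := hG.isIso_ι a
    rw [← cancel_epi (G.ι a), ← σ.unit, ← τ.unit, h₀]
  refine VertTrans.ext (funext h₀) ?_
  funext a b m
  cases m
  · exact h₁ .s
  · exact h
  · exact h₁ .t

end walkingProarrow

/-! ### Cartesian transformations are the pointwise Cartesian ones -/

namespace LaxDoubleFunctor

variable {C D E : DoubleCat.{v, u}}

lemma IsStrict.isPseudo {F : LaxDoubleFunctor C D} (hF : F.IsStrict) : F.IsPseudo where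
  isIso_ι A := by
    obtain ⟨h, h'⟩ := hF.ι_eq A
    rw [h']; infer_instance
  isIso_φ m n := by
    obtain ⟨h, h'⟩ := hF.φ_eq m n
    rw [h']; infer_instance

lemma IsStrict.isOfKind {F : LaxDoubleFunctor C D} (hF : F.IsStrict) : ∀ k, F.IsOfKind k
  | .lax => True.intro
  | .pseudo => hF.isPseudo
  | .strict => hF

end LaxDoubleFunctor

namespace VertTrans

variable {X E B : DoubleCat.{v, u}} {P : LaxDoubleFunctor E B}

/-- A transformation into the total double category of `P` is pointwise Cartesian when its
components are Cartesian arrows of `P₀` and `P₁`. -/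
structure IsPointwiseCartesian (P : LaxDoubleFunctor E B) {e' e : LaxDoubleFunctor X E}
    (α : VertTrans e' e) : Prop where
  app : ∀ A : X.Obj, cartesianArrows P.F₀ (α.app A)
  cellApp : ∀ {A A' : X.Obj} (m : X.Hor A A'), cartesianArrows P.F₁ (α.cellApp m)

/-- Being Cartesian at the external unit of `A` implies being Cartesian at `A`: an arrow `g` into
`e A` corresponds to the cell `y g ≫ ι` into `e (y A)`, whose source recovers `g`. -/
lemma app_of_cellApp_unit (hP : P.IsPseudo) {e' e : LaxDoubleFunctor X E} (α : VertTrans e' e)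
    (A : X.Obj) (h : cartesianArrows P.F₁ (α.cellApp (X.y A))) :
    cartesianArrows P.F₀ (α.app A) := by
  have key {C : E.Obj} (l : C ⟶ e'.F₀.obj A) :
      (E.yMap l ≫ e'.ι A) ≫ α.cellApp (X.y A) = E.yMap (l ≫ α.app A) ≫ e.ι A := by
    rw [Category.assoc, ← α.unit, E.yMap_comp, Category.assoc]
  have cell_y {F : LaxDoubleFunctor X E} {C : E.Obj} (l : C ⟶ F.F₀.obj A) :
      P.ι C ≫ P.cell (E.yMap l ≫ F.ι A) = B.yMap (P.F₀.map l) ≫ P.ι _ ≫ P.cell (F.ι A) := by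
    rw [P.cell_comp, ← Category.assoc, ← P.ι_naturality, Category.assoc]
  have src_y {F : LaxDoubleFunctor X E} {C : E.Obj} (l : C ⟶ F.F₀.obj A) :
      E.srcMap (E.yMap l ≫ F.ι A) = l := by
    rw [E.srcMap_comp, E.src_yMap, F.src_ι, Category.comp_id]
  refine .of_lift_of_ext (fun {C} g w hw => ?_) (fun {C} l l' h₁ h₂ => ?_)
  · have hw' : ((hP.ιIso C).inv ≫ B.yMap w ≫ P.ι _ ≫ P.cell (e'.ι A)) ≫
        P.cell (α.cellApp (X.y A)) = P.cell (E.yMap g ≫ e.ι A) := by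
      have := hP.isIso_ι C
      rw [← cancel_epi (P.ι C), cell_y, ← hw, B.yMap_comp]
      simp only [Category.assoc]
      rw [reassoc_of% hP.ι_comp_ιIso_inv, ← P.cell_comp, ← α.unit, P.cell_comp,
        reassoc_of% P.ι_naturality]
    obtain ⟨k, hk, hk'⟩ := h.exists_lift (E.yMap g ≫ e.ι A)
      ((hP.ιIso C).inv ≫ B.yMap w ≫ P.ι _ ≫ P.cell (e'.ι A)) hw'
    have hsrc : B.srcMap ((hP.ιIso C).inv ≫ B.yMap w ≫ P.ι _ ≫ P.cell (e'.ι A)) = w := by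
      rw [B.srcMap_comp, B.srcMap_comp, B.srcMap_comp, hP.srcMap_ιIso_inv, B.src_yMap, P.src_ι,
        P.src_cell, e'.src_ι, P.F₀.map_id, Category.id_comp, Category.id_comp]
      exact Category.comp_id _
    refine ⟨E.srcMap k, ?_, ?_⟩
    · rw [← src_y g, ← hk]
      exact ((E.srcMap_comp _ _).trans (congrArg _ (α.src_cellApp _))).symm
    · exact (P.src_cell k).symm.trans ((congrArg (fun θ => B.srcMap θ) hk').trans hsrc)
  · have := h.hom_ext (k := E.yMap l ≫ e'.ι A) (k' := E.yMap l' ≫ e'.ι A)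
      ((key l).trans ((by rw [h₁]) : _ = _) |>.trans (key l').symm) (by
        have := hP.isIso_ι C
        refine (cancel_epi (P.ι C)).1 ?_
        exact (cell_y l).trans ((by rw [h₂]) : _ = _) |>.trans (cell_y l').symm)
    rw [← src_y l, this, src_y]

namespace IsPointwiseCartesian

variable {e'' e' e : LaxDoubleFunctor X E} {α : VertTrans e' e}

lemma app_hom_ext (h : IsPointwiseCartesian P α) {A : X.Obj} {C : E.Obj} {f f' : C ⟶ e'.F₀.obj A}
    (h₁ : f ≫ α.app A = f' ≫ α.app A) (h₂ : P.F₀.map f = P.F₀.map f') : f = f' :=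
  (h.app A).hom_ext h₁ h₂

lemma cell_hom_ext (h : IsPointwiseCartesian P α) {A A' : X.Obj} {m : X.Hor A A'} {C C' : E.Obj}
    {n : E.Hor C C'} {θ θ' : Proarrow.mk n ⟶ Proarrow.mk (e'.hor m)}
    (h₁ : θ ≫ α.cellApp m = θ' ≫ α.cellApp m) (h₂ : P.cell θ = P.cell θ') : θ = θ' :=
  (h.cellApp m).hom_ext h₁ h₂

/-- Factorizations through a pointwise Cartesian transformation can be found pointwise. That the
resulting family is compatible with the comparison cells uses that those of `P` are
epimorphisms. -/
lemma exists_factor (hP : P.IsPseudo) (h : IsPointwiseCartesian P α) (ξ : VertTrans e'' e)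
    (γ : VertTrans (e''.comp P) (e'.comp P))
    (w : whiskerRight ξ P = comp γ (whiskerRight α P)) :
    ∃ ζ : VertTrans e'' e', ξ = comp ζ α ∧ whiskerRight ζ P = γ := by
  have w₀ (A) : P.F₀.map (ξ.app A) = γ.app A ≫ P.F₀.map (α.app A) :=
    congrArg (fun σ => VertTrans.app σ A) w
  have w₁ {A A' : X.Obj} (m : X.Hor A A') :
      P.cell (ξ.cellApp m) = γ.cellApp m ≫ P.cell (α.cellApp m) :=
    congrArg (fun σ => VertTrans.cellApp σ m) w
  have w₀' (A) : ∃ k : e''.F₀.obj A ⟶ e'.F₀.obj A, k ≫ α.app A = ξ.app A ∧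
      P.F₀.map k = γ.app A :=
    (h.app A).exists_lift (ξ.app A) (γ.app A) (w₀ A).symm
  have w₁' {A A' : X.Obj} (m : X.Hor A A') :
      ∃ k : Proarrow.mk (e''.hor m) ⟶ Proarrow.mk (e'.hor m), k ≫ α.cellApp m = ξ.cellApp m ∧
        P.cell k = γ.cellApp m :=
    (h.cellApp m).exists_lift (ξ.cellApp m) (γ.cellApp m) (w₁ m).symm
  choose ζ₀ hζ₀ hPζ₀ using w₀'
  choose ζ₁ hζ₁ hPζ₁ using @w₁'
  have src_ζ {A A' : X.Obj} (m : X.Hor A A') : E.srcMap (ζ₁ m) = ζ₀ A := by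
    refine h.app_hom_ext ?_ ?_
    · rw [hζ₀, ← ξ.src_cellApp m, ← hζ₁, E.srcMap_comp, α.src_cellApp]
    · exact (P.src_cell _).symm.trans ((congrArg B.srcMap (hPζ₁ m)).trans
        ((γ.src_cellApp m).trans (hPζ₀ A).symm))
  have tgt_ζ {A A' : X.Obj} (m : X.Hor A A') : E.tgtMap (ζ₁ m) = ζ₀ A' := by
    refine h.app_hom_ext ?_ ?_
    · rw [hζ₀, ← ξ.tgt_cellApp m, ← hζ₁, E.tgtMap_comp, α.tgt_cellApp]
    · exact (P.tgt_cell _).symm.trans ((congrArg B.tgtMap (hPζ₁ m)).trans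
        ((γ.tgt_cellApp m).trans (hPζ₀ A').symm))
  refine ⟨⟨ζ₀, ζ₁, src_ζ, tgt_ζ, ?_, ?_, ?_, ?_⟩, ?_, ?_⟩
  · intro A A' f
    refine h.app_hom_ext ?_ ?_
    · rw [Category.assoc, hζ₀, ξ.naturality, Category.assoc, α.naturality, ← Category.assoc, hζ₀]
    · rw [P.F₀.map_comp, P.F₀.map_comp, hPζ₀, hPζ₀]
      exact γ.naturality f
  · intro A A' A₁ A₁' m m' θ
    refine h.cell_hom_ext ?_ ?_
    · rw [Category.assoc, hζ₁, ξ.cell_naturality, Category.assoc, α.cell_naturality,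
        ← Category.assoc, hζ₁]
    · rw [P.cell_comp, P.cell_comp, hPζ₁, hPζ₁]
      exact γ.cell_naturality θ
  · intro A
    refine h.cell_hom_ext ?_ ?_
    · rw [Category.assoc, ← α.unit, Category.assoc, hζ₁, ← ξ.unit, ← hζ₀, E.yMap_comp,
        Category.assoc]
    · have := hP.isIso_ι (e''.F₀.obj A)
      rw [← cancel_epi (P.ι (e''.F₀.obj A)), P.cell_comp, P.cell_comp, hPζ₁, ← Category.assoc,
        ← P.ι_naturality, hPζ₀, Category.assoc]
      exact (γ.unit A).trans (Category.assoc _ _ _)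
  · intro A A' A'' m n
    refine h.cell_hom_ext ?_ ?_
    · rw [Category.assoc, ← α.tensor, Category.assoc, hζ₁, ← ξ.tensor]
      have := E.tensMap_comp (ζ₁ m) (ζ₁ n) ((tgt_ζ m).trans (src_ζ n).symm) (α.cellApp m)
        (α.cellApp n) ((α.tgt_cellApp m).trans (α.src_cellApp n).symm)
      simp only [← Category.assoc, ← this, hζ₁]
    · have := hP.isIso_φ (e''.hor m) (e''.hor n)
      rw [← cancel_epi (P.φ (e''.hor m) (e''.hor n)), P.cell_comp, P.cell_comp, hPζ₁,
        ← P.tensMap_comp_cell _ _ ((tgt_ζ m).trans (src_ζ n).symm)]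
      have := γ.tensor m n
      simp only [hPζ₁]
      exact this.trans (Category.assoc _ _ _)
  · exact VertTrans.ext (funext fun A => (hζ₀ A).symm) (by funext A B m; exact (hζ₁ m).symm)
  · exact VertTrans.ext (funext hPζ₀) (by funext A B m; exact hPζ₁ m)

lemma factor_unique (h : IsPointwiseCartesian P α) {ζ ζ' : VertTrans e'' e'}
    (h₁ : comp ζ α = comp ζ' α) (h₂ : whiskerRight ζ P = whiskerRight ζ' P) : ζ = ζ' :=
  VertTrans.ext
    (funext fun A => h.app_hom_ext (congrArg (fun σ => VertTrans.app σ A) h₁)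
      (congrArg (fun σ => VertTrans.app σ A) h₂))
    (by
      funext A A' m
      exact h.cell_hom_ext (congrArg (fun σ => VertTrans.cellApp σ m) h₁)
        (congrArg (fun σ => VertTrans.cellApp σ m) h₂))

lemma whiskerLeft {Y : DoubleCat.{v, u}} (h : IsPointwiseCartesian P α)
    (x : LaxDoubleFunctor Y X) : IsPointwiseCartesian P (VertTrans.whiskerLeft x α) :=
  ⟨fun _ => h.app _, fun _ => h.cellApp _⟩

end IsPointwiseCartesian

end VertTrans

section

open Bicategory VertTrans

variable {k : FunctorKind} {E B : DoubleCat.{v, u}} {P : LaxDoubleFunctor E B}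

/-- A double functor, as a 1-cell of the 2-category of double functors of kind `k`. -/
def LaxDoubleFunctor.toDblOf {X Y : DoubleCat.{v, u}} (F : LaxDoubleFunctor X Y)
    (hF : F.IsOfKind k) : (⟨X⟩ : DblOf.{v, u} k) ⟶ ⟨Y⟩ :=
  ⟨F, hF⟩

lemma VertTrans.IsPointwiseCartesian.isCartesianTwoCell (hP : P.IsPseudo) (hk : P.IsOfKind k)
    {X : DblOf.{v, u} k} {e' e : X ⟶ ⟨E⟩} (α : e' ⟶ e)
    (h : IsPointwiseCartesian P (e' := DblHom.functor e') (e := DblHom.functor e) α) :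
    IsCartesianTwoCell (P.toDblOf hk) α := by
  intro Y x e'' ξ γ w
  have h' := h.whiskerLeft (DblHom.functor x)
  obtain ⟨ζ, hζ, hζ'⟩ := h'.exists_factor hP ξ γ w
  exact ⟨ζ, ⟨hζ, hζ'⟩, fun ζ' h'' => h'.factor_unique (h''.1.symm.trans hζ) (h''.2.trans hζ'.symm)⟩

/-- The components at proarrows of a Cartesian transformation inherit its universal property. It is
tested against the strict double functors on the walking proarrow that pick `m` and `n`; the
transformations involved are single cells. -/
lemma IsCartesianTwoCell.cellApp (hP : P.IsPseudo) (hk : P.IsOfKind k)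
    {X : DblOf.{v, u} k} {e' e : X ⟶ ⟨E⟩} {α : e' ⟶ e} (h : IsCartesianTwoCell (P.toDblOf hk) α)
    {A A' : X.toDoubleCat.Obj} (m : X.toDoubleCat.Hor A A') {C C' : E.Obj} {n : E.Hor C C'}
    (g : Proarrow.mk n ⟶ Proarrow.mk ((DblHom.functor e).hor m))
    (w : Proarrow.mk (P.hor n) ⟶ Proarrow.mk (P.hor ((DblHom.functor e').hor m)))
    (hw : w ≫ P.cell (DblHom.cellApp α m) = P.cell g) :
    ∃! l : Proarrow.mk n ⟶ Proarrow.mk ((DblHom.functor e').hor m),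
      l ≫ DblHom.cellApp α m = g ∧ P.cell l = w := by
  let x : (⟨walkingProarrow⟩ : DblOf k) ⟶ X :=
    LaxDoubleFunctor.toDblOf _ ((walkingProarrow.pick_isStrict m).isOfKind k)
  let e'' : (⟨walkingProarrow⟩ : DblOf k) ⟶ ⟨E⟩ :=
    LaxDoubleFunctor.toDblOf _ ((walkingProarrow.pick_isStrict n).isOfKind k)
  have he'' : (walkingProarrow.pick n).IsPseudo := (walkingProarrow.pick_isStrict n).isPseudo
  let ξ : e'' ⟶ x ≫ e :=
    walkingProarrow.ofCell (G := walkingProarrow.pick n)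
      (F := (walkingProarrow.pick m).comp (DblHom.functor e)) he'' g
  let γ : e'' ≫ P.toDblOf hk ⟶ (x ≫ e') ≫ P.toDblOf hk :=
    walkingProarrow.ofCell (G := (walkingProarrow.pick n).comp P)
      (F := ((walkingProarrow.pick m).comp (DblHom.functor e')).comp P) (he''.comp hP) w
  obtain ⟨ζ, ⟨hζ, hζ'⟩, huniq⟩ := h _ x e'' ξ γ
    (walkingProarrow.ext_of_cell (he''.comp hP) hw.symm)
  refine ⟨VertTrans.cellApp ζ walkingProarrow.gen,
    ⟨(congrArg (fun σ => VertTrans.cellApp σ walkingProarrow.gen) hζ).symm,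
      congrArg (fun σ => VertTrans.cellApp σ walkingProarrow.gen) hζ'⟩, fun l ⟨hl, hl'⟩ => ?_⟩
  have := huniq (walkingProarrow.ofCell (G := walkingProarrow.pick n)
      (F := (walkingProarrow.pick m).comp (DblHom.functor e')) he'' l)
    ⟨walkingProarrow.ext_of_cell he'' hl.symm, walkingProarrow.ext_of_cell (he''.comp hP) hl'⟩
  exact congrArg (fun σ => VertTrans.cellApp σ walkingProarrow.gen) this

lemma IsCartesianTwoCell.isPointwiseCartesian (hP : P.IsPseudo) (hk : P.IsOfKind k)
    {X : DblOf.{v, u} k} {e' e : X ⟶ ⟨E⟩} {α : e' ⟶ e}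
    (h : IsCartesianTwoCell (P.toDblOf hk) α) :
    IsPointwiseCartesian P (e' := DblHom.functor e') (e := DblHom.functor e) α := by
  have h₁ {A A' : X.toDoubleCat.Obj} (m : X.toDoubleCat.Hor A A') :
      cartesianArrows P.F₁ (DblHom.cellApp α m) := by
    refine .of_lift_of_ext (fun g w hw => ?_) (fun l l' h₁ h₂ => ?_)
    · exact (h.cellApp hP hk m g w hw).exists
    · exact (h.cellApp hP hk m (l' ≫ DblHom.cellApp α m) (P.cell l')
        (P.cell_comp _ _).symm).unique ⟨h₁, h₂⟩ ⟨rfl, rfl⟩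
  exact ⟨fun A => VertTrans.app_of_cellApp_unit hP α A (h₁ _), h₁⟩

end

/-! ### Lifting a transformation along pointwise lifts -/

namespace VertTrans

variable {X E B : DoubleCat.{v, u}} {P : LaxDoubleFunctor E B}

/-- Chosen Cartesian lifts of the components of `β : b ⟶ e ≫ P`, with strictly compatible sources
and targets, assemble into a lax double functor `e'` and a transformation `e' ⟶ e`. All data of
`e'` are induced by universal properties, and so are its axioms: an equation between cells into
`e' m` can be checked after composition with `α` and after application of `P`, where it becomes an
axiom of `e` and one of `b`. The comparison cells of `P` have to be invertible in order to define
those of `e'`. The objects and proarrows of `b` are equal to the images of the lifts, and are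
replaced by them at the beginning, after which no transport along equalities is left. -/
theorem exists_lift_of_pointwise (hP : P.IsPseudo) (W₀ : MorphismProperty E.Obj)
    (W₁ : MorphismProperty E.Pro) (hW₀ : W₀ ≤ cartesianArrows P.F₀)
    (hW₁ : W₁ ≤ cartesianArrows P.F₁) {e : LaxDoubleFunctor X E} {b : LaxDoubleFunctor X B}
    (β : VertTrans b (e.comp P)) (obj : X.Obj → E.Obj)
    (hor : ∀ {A A' : X.Obj}, X.Hor A A' → E.Hor (obj A) (obj A'))
    (a : ∀ A, obj A ⟶ e.F₀.obj A)
    (θ : ∀ {A A' : X.Obj} (m : X.Hor A A'), Proarrow.mk (hor m) ⟶ Proarrow.mk (e.hor m))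
    (ha : ∀ A, W₀ (a A)) (hθ : ∀ {A A' : X.Obj} (m : X.Hor A A'), W₁ (θ m))
    (src_θ : ∀ {A A' : X.Obj} (m : X.Hor A A'), E.srcMap (θ m) = a A)
    (tgt_θ : ∀ {A A' : X.Obj} (m : X.Hor A A'), E.tgtMap (θ m) = a A')
    (hobj : ∀ A, ∃ h : P.F₀.obj (obj A) = b.F₀.obj A, P.F₀.map (a A) = eqToHom h ≫ β.app A)
    (hhor : ∀ {A A' : X.Obj} (m : X.Hor A A'), ∃ h : Proarrow.mk (P.hor (hor m)) =
      Proarrow.mk (b.hor m), P.cell (θ m) = eqToHom h ≫ β.cellApp m) :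
    ∃ (e' : LaxDoubleFunctor X E) (α : VertTrans e' e) (_ : e'.comp P = b),
      HEq (whiskerRight α P) β ∧ (∀ A, W₀ (α.app A)) ∧
        ∀ {A A' : X.Obj} (m : X.Hor A A'), W₁ (α.cellApp m) := by
  -- The objects and proarrows of `b` become the images under `P` of the domains of the lifts.
  obtain ⟨⟨bobj, bmap, map_id, map_comp⟩, bhor, bcell, cell_id, cell_comp, src_cell, tgt_cell,
    bι, src_ι, tgt_ι, ι_nat, bφ, src_φ, tgt_φ, φ_nat, assoc', left', right'⟩ := b
  obtain rfl : bobj = fun A => P.F₀.obj (obj A) := funext fun A => (hobj A).1.symm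
  obtain rfl : @bhor = fun _ _ m => P.hor (hor m) := by
    funext A A' m
    have := (hhor m).1
    simpa using this.symm
  have hβ₀ (A) : P.F₀.map (a A) = β.app A := (hobj A).2.trans (Category.id_comp _)
  have hβ₁ {A A' : X.Obj} (m : X.Hor A A') : P.cell (θ m) = β.cellApp m :=
    (hhor m).2.trans (Category.id_comp _)
  clear hobj hhor
  have ext₀ {A : X.Obj} {C : E.Obj} {f f' : C ⟶ obj A} (h₁ : f ≫ a A = f' ≫ a A)
      (h₂ : P.F₀.map f = P.F₀.map f') : f = f' := (hW₀ _ (ha A)).hom_ext h₁ h₂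
  have ext₁ {A A' : X.Obj} {m : X.Hor A A'} {C C' : E.Obj} {n : E.Hor C C'}
      {f f' : Proarrow.mk n ⟶ Proarrow.mk (hor m)} (h₁ : f ≫ θ m = f' ≫ θ m)
      (h₂ : P.cell f = P.cell f') : f = f' := (hW₁ _ (hθ m)).hom_ext h₁ h₂
  have exists_map {A A' : X.Obj} (f : A ⟶ A') :
      ∃ k : obj A ⟶ obj A', k ≫ a A' = a A ≫ e.F₀.map f ∧ P.F₀.map k = bmap f :=
    (hW₀ _ (ha A')).exists_lift _ _ (by
      rw [P.F₀.map_comp, hβ₀, hβ₀]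
      exact β.naturality f)
  choose map hmap hPmap using @exists_map
  have exists_cell {A A' A₁ A₁' : X.Obj} {m : X.Hor A A'} {m' : X.Hor A₁ A₁'}
      (f : Proarrow.mk m ⟶ Proarrow.mk m') : ∃ k : Proarrow.mk (hor m) ⟶ Proarrow.mk (hor m'),
        k ≫ θ m' = θ m ≫ e.cell f ∧ P.cell k = bcell f :=
    (hW₁ _ (hθ m')).exists_lift _ _ ((β.cell_naturality f).trans (by
      rw [← hβ₁]
      exact (P.cell_comp _ _).symm) |> fun h => (congrArg (bcell f ≫ ·) (hβ₁ m')).trans h)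
  choose cell hcell hPcell using @exists_cell
  have exists_ι (A : X.Obj) : ∃ k : Proarrow.mk (E.y (obj A)) ⟶ Proarrow.mk (hor (X.y A)),
      k ≫ θ (X.y A) = E.yMap (a A) ≫ e.ι A ∧ P.cell k = (hP.ιIso _).inv ≫ bι A := by
    have : P.ι (obj A) ≫ P.cell (E.yMap (a A) ≫ e.ι A) = bι A ≫ P.cell (θ (X.y A)) := by
      rw [P.cell_comp, ← Category.assoc, ← P.ι_naturality, Category.assoc, hβ₀, hβ₁]
      exact β.unit A
    exact (hW₁ _ (hθ (X.y A))).exists_lift _ _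
      ((Category.assoc _ _ _).trans ((Iso.inv_comp_eq (hP.ιIso _)).2 this.symm))
  choose ι hι hPι using exists_ι
  have exists_φ {A A' A'' : X.Obj} (m : X.Hor A A') (n : X.Hor A' A'') :
      ∃ k : Proarrow.mk (E.tens (hor m) (hor n)) ⟶ Proarrow.mk (hor (X.tens m n)),
        k ≫ θ (X.tens m n) = E.tensMap (θ m) (θ n) ((tgt_θ m).trans (src_θ n).symm) ≫ e.φ m n ∧
          P.cell k = (hP.φIso _ _).inv ≫ bφ m n := by
    have hw := (tgt_θ m).trans (src_θ n).symm
    have : P.φ (hor m) (hor n) ≫ P.cell (E.tensMap (θ m) (θ n) hw ≫ e.φ m n) =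
        bφ m n ≫ P.cell (θ (X.tens m n)) := by
      rw [P.cell_comp, ← P.tensMap_comp_cell _ _ hw]
      simp only [hβ₁]
      exact β.tensor m n
    exact (hW₁ _ (hθ (X.tens m n))).exists_lift _ _
      ((Category.assoc _ _ _).trans ((Iso.inv_comp_eq (hP.φIso _ _)).2 this.symm))
  choose φ hφ hPφ using @exists_φ
  replace hPι (A) : P.ι (obj A) ≫ P.cell (ι A) = bι A := by
    rw [hPι]
    exact (Category.assoc _ _ _).symm.trans ((congrArg (· ≫ bι A) (hP.ι_comp_ιIso_inv _)).trans
      (Category.id_comp _))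
  replace hPφ {A A' A'' : X.Obj} (m : X.Hor A A') (n : X.Hor A' A'') :
      P.φ (hor m) (hor n) ≫ P.cell (φ m n) = bφ m n := by
    rw [hPφ]
    exact (Category.assoc _ _ _).symm.trans ((congrArg (· ≫ bφ m n)
      (hP.φ_comp_φIso_inv _ _)).trans (Category.id_comp _))
  -- The remaining data of `b` become the images under `P` of the induced data.
  obtain rfl : @bmap = fun _ _ f => P.F₀.map (map f) := by
    funext A A' f; exact (hPmap f).symm
  obtain rfl : @bcell = fun _ _ _ _ _ _ f => P.cell (cell f) := by
    funext _ _ _ _ _ _ f; exact (hPcell f).symm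
  obtain rfl : bι = fun A => P.ι (obj A) ≫ P.cell (ι A) := by
    funext A; exact (hPι A).symm
  obtain rfl : @bφ = fun _ _ _ m n => P.φ (hor m) (hor n) ≫ P.cell (φ m n) := by
    funext _ _ _ m n; exact (hPφ m n).symm
  clear hPmap hPcell hPι hPφ
  have hPι (A : X.Obj) : IsIso (P.ι (obj A)) := hP.isIso_ι _
  have hPφ {A A' A'' : E.Obj} (m : E.Hor A A') (n : E.Hor A' A'') : IsIso (P.φ m n) :=
    hP.isIso_φ _ _
  have src_cell' {A A' A₁ A₁' : X.Obj} {m : X.Hor A A'} {m' : X.Hor A₁ A₁'}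
      (f : Proarrow.mk m ⟶ Proarrow.mk m') : E.srcMap (cell f) = map (X.srcMap f) := by
    refine ext₀ ?_ ((P.src_cell _).symm.trans (src_cell f))
    rw [← src_θ m', ← E.srcMap_comp, hcell, E.srcMap_comp, src_θ, e.src_cell, src_θ, hmap]
  have tgt_cell' {A A' A₁ A₁' : X.Obj} {m : X.Hor A A'} {m' : X.Hor A₁ A₁'}
      (f : Proarrow.mk m ⟶ Proarrow.mk m') : E.tgtMap (cell f) = map (X.tgtMap f) := by
    refine ext₀ ?_ ((P.tgt_cell _).symm.trans (tgt_cell f))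
    rw [← tgt_θ m', ← E.tgtMap_comp, hcell, E.tgtMap_comp, tgt_θ, e.tgt_cell, tgt_θ, hmap]
  have src_ι' (A) : E.srcMap (ι A) = 𝟙 (obj A) := by
    refine ext₀ ?_ ?_
    · rw [← src_θ (X.y A), ← E.srcMap_comp, hι, E.srcMap_comp, E.src_yMap, e.src_ι, src_θ,
        Category.comp_id, Category.id_comp]
    · rw [← P.src_cell, P.F₀.map_id, ← Category.id_comp (B.srcMap _), ← P.src_ι, ← B.srcMap_comp]
      exact (src_ι A).trans (P.src_ι _).symm
  have tgt_ι' (A) : E.tgtMap (ι A) = 𝟙 (obj A) := by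
    refine ext₀ ?_ ?_
    · rw [← tgt_θ (X.y A), ← E.tgtMap_comp, hι, E.tgtMap_comp, E.tgt_yMap, e.tgt_ι, tgt_θ,
        Category.comp_id, Category.id_comp]
    · rw [← P.tgt_cell, P.F₀.map_id, ← Category.id_comp (B.tgtMap _), ← P.tgt_ι, ← B.tgtMap_comp]
      exact (tgt_ι A).trans (P.tgt_ι _).symm
  have hw {A A' A'' : X.Obj} (m : X.Hor A A') (n : X.Hor A' A'') :
      E.tgtMap (θ m) = E.srcMap (θ n) := (tgt_θ m).trans (src_θ n).symm
  have src_φ' {A A' A'' : X.Obj} (m : X.Hor A A') (n : X.Hor A' A'') :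
      E.srcMap (φ m n) = 𝟙 (obj A) := by
    refine ext₀ ?_ ?_
    · rw [← src_θ (X.tens m n), ← E.srcMap_comp, hφ, E.srcMap_comp, E.src_tensMap, e.src_φ, src_θ,
        src_θ, Category.comp_id, Category.id_comp]
    · rw [← P.src_cell, P.F₀.map_id, ← Category.id_comp (B.srcMap _), ← P.src_φ (hor m) (hor n),
        ← B.srcMap_comp]
      exact (src_φ m n).trans (P.src_φ _ _).symm
  have tgt_φ' {A A' A'' : X.Obj} (m : X.Hor A A') (n : X.Hor A' A'') :
      E.tgtMap (φ m n) = 𝟙 (obj A'') := by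
    refine ext₀ ?_ ?_
    · rw [← tgt_θ (X.tens m n), ← E.tgtMap_comp, hφ, E.tgtMap_comp, E.tgt_tensMap, e.tgt_φ, tgt_θ,
        tgt_θ, Category.comp_id, Category.id_comp]
    · rw [← P.tgt_cell, P.F₀.map_id, ← Category.id_comp (B.tgtMap _), ← P.tgt_φ (hor m) (hor n),
        ← B.tgtMap_comp]
      exact (tgt_φ m n).trans (P.tgt_φ _ _).symm
  have ι_nat' {A A' : X.Obj} (f : A ⟶ A') :
      E.yMap (map f) ≫ ι A' = ι A ≫ cell (X.yMap f) := by
    refine ext₁ ?_ ?_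
    · rw [Category.assoc, hι, Category.assoc, hcell, ← Category.assoc, ← Category.assoc, hι,
        ← E.yMap_comp, hmap, E.yMap_comp, Category.assoc, e.ι_naturality, Category.assoc]
    · rw [← cancel_epi (P.ι (obj A)), P.cell_comp, P.cell_comp, ← Category.assoc,
        ← P.ι_naturality, Category.assoc]
      exact (ι_nat f).trans (Category.assoc _ _ _)
  have φ_nat' {A A' A'' A₁ A₁' A₁'' : X.Obj} {m : X.Hor A A'} {n : X.Hor A' A''}
      {m₁ : X.Hor A₁ A₁'} {n₁ : X.Hor A₁' A₁''} (f : Proarrow.mk m ⟶ Proarrow.mk m₁)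
      (g : Proarrow.mk n ⟶ Proarrow.mk n₁) (h : X.tgtMap f = X.srcMap g) :
      E.tensMap (cell f) (cell g) (by rw [tgt_cell', src_cell', h]) ≫ φ m₁ n₁ =
        φ m n ≫ cell (X.tensMap f g h) := by
    have h' : E.tgtMap (cell f) = E.srcMap (cell g) := by rw [tgt_cell', src_cell', h]
    refine ext₁ ?_ ?_
    · rw [Category.assoc, hφ, Category.assoc, hcell, ← Category.assoc, ← Category.assoc, hφ,
        ← E.tensMap_comp _ _ h' _ _ (hw _ _)]
      simp only [hcell]
      rw [E.tensMap_comp _ _ (hw _ _) _ _ (by rw [e.tgt_cell, e.src_cell, h]), Category.assoc,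
        e.φ_naturality _ _ h, Category.assoc]
    · rw [← cancel_epi (P.φ (hor m) (hor n)), P.cell_comp, P.cell_comp,
        ← P.tensMap_comp_cell _ _ h']
      exact (φ_nat f g h).trans (Category.assoc _ _ _)
  have assoc'' {A A' A'' A₃ : X.Obj} (m : X.Hor A A') (n : X.Hor A' A'') (p : X.Hor A'' A₃) :
      E.tensMap (φ m n) (𝟙 (Proarrow.mk (hor p))) ((tgt_φ' m n).trans (E.srcMap_id _).symm) ≫
          φ (X.tens m n) p ≫ cell (X.assoc m n p).hom =
        (E.assoc (hor m) (hor n) (hor p)).hom ≫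
          E.tensMap (𝟙 (Proarrow.mk (hor m))) (φ n p)
            ((E.tgtMap_id _).trans (src_φ' n p).symm) ≫ φ m (X.tens n p) := by
    have h₁ := (tgt_φ' m n).trans (E.srcMap_id (hor p)).symm
    have h₂ := (E.tgtMap_id (hor m)).trans (src_φ' n p).symm
    have h₃ := (E.tgt_tensMap _ _ (hw m n)).trans (hw n p)
    have h₄ := (hw m n).trans (E.src_tensMap _ _ (hw n p)).symm
    refine ext₁ ?_ ?_
    · have l := (E.tensMap_comp_left _ _ _ h₁ (hw (X.tens m n) p)
          (by rw [E.tgtMap_comp, tgt_φ', Category.id_comp, hw])).trans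
        ((LaxDoubleFunctor.tensMap_congr (hφ m n) rfl _).trans (E.tensMap_left_comp _ _ _ h₃
          ((e.tgt_φ m n).trans (E.srcMap_id _).symm) _).symm)
      have r := (E.tensMap_comp_right _ _ _ h₂ (hw m (X.tens n p))
          (by rw [E.srcMap_comp, src_φ', Category.id_comp, hw])).trans
        ((LaxDoubleFunctor.tensMap_congr rfl (hφ n p) _).trans (E.tensMap_right_comp _ _ _ h₄
          ((E.tgtMap_id _).trans (e.src_φ n p).symm) _).symm)
      simp only [Category.assoc]
      rw [hcell, reassoc_of% hφ (X.tens m n) p, reassoc_of% l, e.associativity,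
        hφ m (X.tens n p), reassoc_of% r,
        ← reassoc_of% E.assoc_naturality (θ m) (θ n) (θ p) (hw m n) (hw n p)]
    · have l := B.tensMap_comp_left (P.φ (hor m) (hor n)) (P.cell (φ m n))
        (𝟙 (Proarrow.mk (P.hor (hor p)))) ((P.tgt_φ _ _).trans (B.srcMap_id _).symm)
        (by rw [P.tgt_cell, tgt_φ', P.F₀.map_id, B.srcMap_id])
        ((tgt_φ m n).trans (B.srcMap_id _).symm)
      have r := B.tensMap_comp_right (𝟙 (Proarrow.mk (P.hor (hor m)))) (P.φ (hor n) (hor p))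
        (P.cell (φ n p)) ((B.tgtMap_id _).trans (P.src_φ _ _).symm)
        (by rw [P.src_cell, src_φ', P.F₀.map_id, B.tgtMap_id])
        ((B.tgtMap_id _).trans (src_φ n p).symm)
      have := B.isIso_tensMap (P.φ (hor m) (hor n)) (𝟙 (Proarrow.mk (P.hor (hor p))))
        ((P.tgt_φ _ _).trans (B.srcMap_id _).symm)
      refine (cancel_epi (P.φ (E.tens (hor m) (hor n)) (hor p))).1 ((cancel_epi (B.tensMap
        (P.φ (hor m) (hor n)) (𝟙 (Proarrow.mk (P.hor (hor p))))
        ((P.tgt_φ _ _).trans (B.srcMap_id _).symm))).1 ?_)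
      simp only [P.cell_comp]
      rw [← P.tensMap_comp_cell _ _ h₁, reassoc_of% P.associativity (hor m) (hor n) (hor p)]
      simp only [← P.tensMap_comp_cell _ _ h₂, P.cell_id]
      rw [reassoc_of% l, reassoc_of% r]
      have := assoc' m n p
      simp only [Category.assoc] at this
      exact this
  have θ_congr {A A' : X.Obj} {m m' : X.Hor A A'} (h : m' = m) :
      θ m = eqToHom (by rw [h]) ≫ θ m' ≫ eqToHom (by rw [h]) := by
    subst h
    simp
  have left'' {A A' : X.Obj} (m : X.Hor A A') :
      E.tensMap (ι A) (𝟙 (Proarrow.mk (hor m))) ((tgt_ι' A).trans (E.srcMap_id _).symm) ≫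
        φ (X.y A) m = eqToHom (by rw [E.unit_tens, X.unit_tens]) := by
    have h₁ := (tgt_ι' A).trans (E.srcMap_id (hor m)).symm
    have h₂ := (P.tgt_ι (obj A)).trans (B.srcMap_id (P.hor (hor m))).symm
    refine ext₁ ?_ ?_
    · have l := (E.tensMap_comp_left _ _ _ h₁ (hw (X.y A) m)
          (by rw [E.tgtMap_comp, tgt_ι', Category.id_comp, hw])).trans
        (LaxDoubleFunctor.tensMap_congr (hι A) rfl _)
      rw [Category.assoc, hφ, reassoc_of% l, e.unit_tensMap_φ (θ m) _ (src_θ m),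
        θ_congr (X.unit_tens m).symm]
      simp
    · have l := B.tensMap_comp_left (P.ι (obj A)) (P.cell (ι A)) (𝟙 (Proarrow.mk (P.hor (hor m))))
        h₂ (by rw [P.tgt_cell, tgt_ι', P.F₀.map_id, B.srcMap_id])
        ((tgt_ι A).trans (B.srcMap_id _).symm)
      have := B.isIso_tensMap _ _ h₂
      refine (cancel_epi (P.φ (E.y (obj A)) (hor m))).1 ((cancel_epi (B.tensMap _ _ h₂)).1 ?_)
      rw [P.cell_comp, ← P.tensMap_comp_cell _ _ h₁, P.cell_eqToHom,
        reassoc_of% P.left_unitality (hor m)]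
      simp only [P.cell_id]
      rw [reassoc_of% l]
      exact (left' m).trans (eqToHom_trans _ _).symm
  have right'' {A A' : X.Obj} (m : X.Hor A A') :
      E.tensMap (𝟙 (Proarrow.mk (hor m))) (ι A') ((E.tgtMap_id _).trans (src_ι' A').symm) ≫
        φ m (X.y A') = eqToHom (by rw [E.tens_unit, X.tens_unit]) := by
    have h₁ := (E.tgtMap_id (hor m)).trans (src_ι' A').symm
    have h₂ := (B.tgtMap_id (P.hor (hor m))).trans (P.src_ι (obj A')).symm
    refine ext₁ ?_ ?_
    · have l := (E.tensMap_comp_right _ _ _ h₁ (hw m (X.y A'))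
          (by rw [E.srcMap_comp, src_ι', Category.id_comp, hw])).trans
        (LaxDoubleFunctor.tensMap_congr rfl (hι A') _)
      rw [Category.assoc, hφ, reassoc_of% l, e.tensMap_unit_φ (θ m) _ (tgt_θ m),
        θ_congr (X.tens_unit m).symm]
      simp
    · have l := B.tensMap_comp_right (𝟙 (Proarrow.mk (P.hor (hor m)))) (P.ι (obj A'))
        (P.cell (ι A')) h₂ (by rw [P.src_cell, src_ι', P.F₀.map_id, B.tgtMap_id])
        ((B.tgtMap_id _).trans (src_ι A').symm)
      have := B.isIso_tensMap _ _ h₂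
      refine (cancel_epi (P.φ (hor m) (E.y (obj A')))).1 ((cancel_epi (B.tensMap _ _ h₂)).1 ?_)
      rw [P.cell_comp, ← P.tensMap_comp_cell _ _ h₁, P.cell_eqToHom,
        reassoc_of% P.right_unitality (hor m)]
      simp only [P.cell_id]
      rw [reassoc_of% l]
      exact (right' m).trans (eqToHom_trans _ _).symm
  let e' : LaxDoubleFunctor X E :=
    { F₀ :=
        { obj := obj
          map := map
          map_id := fun A => ext₀ (by simp [hmap]) ((map_id A).trans (P.F₀.map_id _).symm)
          map_comp := fun f g => ext₀ (by simp [hmap, reassoc_of% hmap])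
            ((map_comp f g).trans (P.F₀.map_comp _ _).symm) }
      hor := hor
      cell := cell
      cell_id := fun m => ext₁ (by simp [hcell, e.cell_id]) ((cell_id m).trans (P.cell_id _).symm)
      cell_comp := fun f g => ext₁
        (by rw [hcell, e.cell_comp, Category.assoc, hcell, ← Category.assoc, ← Category.assoc,
          hcell]) ((cell_comp f g).trans (P.cell_comp _ _).symm)
      src_cell := src_cell'
      tgt_cell := tgt_cell'
      ι := ι
      src_ι := src_ι'
      tgt_ι := tgt_ι'
      ι_naturality := ι_nat'
      φ := φ
      src_φ := src_φ'
      tgt_φ := tgt_φ'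
      φ_naturality := φ_nat'
      associativity := assoc''
      left_unitality := left''
      right_unitality := right'' }
  let α : VertTrans e' e :=
    { app := a
      cellApp := θ
      src_cellApp := src_θ
      tgt_cellApp := tgt_θ
      naturality := hmap
      cell_naturality := hcell
      unit := fun A => (hι A).symm
      tensor := fun m n => (hφ m n).symm }
  exact ⟨e', α, rfl, heq_of_eq (VertTrans.ext (funext hβ₀) (by funext A A' m; exact hβ₁ m)), ha, hθ⟩

end VertTrans

/-! ### From cleavages to internal fibrations -/

section

universe v₁ v₂ u₁ u₂

variable {𝒳 : Type u₁} {𝒮 : Type u₂} [Category.{v₁} 𝒳] [Category.{v₂} 𝒮] {p : 𝒳 ⥤ 𝒮}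

lemma eq_eqToHom_of_comp {a b c : 𝒳} {f : a ⟶ b} {g : b ⟶ c} {h : a = b} {h' : a = c}
    (hf : f = eqToHom h) (hfg : f ≫ g = eqToHom h') : g = eqToHom (h.symm.trans h') := by
  subst h hf
  simpa using hfg

lemma Cleavage.arrows.comp_eqToHom {c : Cleavage p} {a e e' : 𝒳} {f : a ⟶ e} (hf : c.arrows f)
    (h : e = e') : c.arrows (f ≫ eqToHom h) := by
  subst h; simpa using hf

/-- A comparison between chosen arrows is an identity as soon as its image is. -/
lemma Cleavage.arrows.eq_eqToHom {c : Cleavage p} {a a' e : 𝒳} {k : a ⟶ a'} {f : a' ⟶ e}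
    (hf : c.arrows f) (hkf : c.arrows (k ≫ f)) {h : p.obj a = p.obj a'}
    (hk : p.map k = eqToHom h) : ∃ h : a = a', k = eqToHom h := by
  obtain ⟨h₁, h₂⟩ := hkf.unique hf h (by rw [p.map_comp, hk])
  exact ⟨h₁, hf.cartesian.hom_ext h₂ (by rw [hk, eqToHom_map])⟩

end

namespace DoubleCat

variable {D : DoubleCat.{v, u}}

/-- A cell whose source and target are known up to equalities of their domains can be retyped. -/
lemma exists_cell_of_src_tgt {A A' C C' : D.Obj} {n : D.Hor C C'} {Q : D.Pro}
    (f : Q ⟶ Proarrow.mk n) {s : A ⟶ C} {t : A' ⟶ C'} (hs : D.src.obj Q = A)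
    (ht : D.tgt.obj Q = A') (hs' : D.src.map f = eqToHom hs ≫ s)
    (ht' : D.tgt.map f = eqToHom ht ≫ t) :
    ∃ (m : D.Hor A A') (θ : Proarrow.mk m ⟶ Proarrow.mk n) (h : Proarrow.mk m = Q),
      θ = eqToHom h ≫ f ∧ D.srcMap θ = s ∧ D.tgtMap θ = t := by
  obtain ⟨m⟩ := Q
  subst hs ht
  exact ⟨m, f, rfl, (Category.id_comp f).symm, hs'.trans (Category.id_comp _),
    ht'.trans (Category.id_comp _)⟩

end DoubleCat

namespace LaxDoubleFunctor

variable {E B : DoubleCat.{v, u}} {P : LaxDoubleFunctor E B}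

/-- A composable pair of Cartesian cells is Cartesian if its common arrow is. -/
lemma cartesianArrows_pair {M N : E.Pair} (f : M ⟶ N) (h₁ : cartesianArrows P.F₁ f.fst)
    (h₂ : cartesianArrows P.F₁ f.snd) (h₀ : cartesianArrows P.F₀ (E.tgtMap f.fst)) :
    cartesianArrows P.F₂ f := by
  refine .of_lift_of_ext (fun {L} g w hw => ?_) (fun {L} k k' hk hk' => ?_)
  · obtain ⟨k₁, hk₁, hk₁'⟩ := h₁.exists_lift g.fst w.fst
      (congrArg (fun x => DoubleCat.PairHom.fst x) hw)
    obtain ⟨k₂, hk₂, hk₂'⟩ := h₂.exists_lift g.snd w.snd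
      (congrArg (fun x => DoubleCat.PairHom.snd x) hw)
    have hw' : E.tgtMap k₁ = E.srcMap k₂ := by
      refine h₀.hom_ext ?_ ?_
      · rw [← E.tgtMap_comp, hk₁, g.w, ← hk₂, E.srcMap_comp, f.w]
      · exact (P.tgt_cell _).symm.trans ((congrArg B.tgtMap hk₁').trans (w.w.trans
          ((congrArg B.srcMap hk₂').symm.trans (P.src_cell _))))
    exact ⟨⟨k₁, k₂, hw'⟩, DoubleCat.PairHom.ext hk₁ hk₂, DoubleCat.PairHom.ext hk₁' hk₂'⟩
  · exact DoubleCat.PairHom.ext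
      (h₁.hom_ext (congrArg (fun x => DoubleCat.PairHom.fst x) hk)
        (congrArg (fun x => DoubleCat.PairHom.fst x) hk'))
      (h₂.hom_ext (congrArg (fun x => DoubleCat.PairHom.snd x) hk)
        (congrArg (fun x => DoubleCat.PairHom.snd x) hk'))

end LaxDoubleFunctor

namespace VertTrans

variable {X E B : DoubleCat.{v, u}} {P : LaxDoubleFunctor E B}

/-- The chosen lifts of the components of `β` have matching sources and targets, because `src` and
`tgt` preserve the cleavages; they assemble into a lift of `β`. -/
lemma exists_lift_of_cleavages (hP : P.IsPseudo) {c₀ : Cleavage P.F₀} {c₁ : Cleavage P.F₁}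
    (hc : P.SrcTgtPreserveCleavages c₀ c₁) {e : LaxDoubleFunctor X E} {b : LaxDoubleFunctor X B}
    (β : VertTrans b (e.comp P)) :
    ∃ (e' : LaxDoubleFunctor X E) (α : VertTrans e' e) (_ : e'.comp P = b),
      HEq (whiskerRight α P) β ∧ (∀ A, c₀.arrows (α.app A)) ∧
        ∀ {A A' : X.Obj} (m : X.Hor A A'), c₁.arrows (α.cellApp m) := by
  have key {A A' : X.Obj} (m : X.Hor A A') :
      ∃ (n : E.Hor (c₀.dom (β.app A)) (c₀.dom (β.app A')))
        (θ : Proarrow.mk n ⟶ Proarrow.mk (e.hor m)), c₁.arrows θ ∧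
        E.srcMap θ = c₀.lift (β.app A) ∧ E.tgtMap θ = c₀.lift (β.app A') ∧
        ∃ h : Proarrow.mk (P.hor n) = Proarrow.mk (b.hor m),
          P.cell θ = eqToHom h ≫ β.cellApp m := by
    let β₁ : (Proarrow.mk (b.hor m) : B.Pro) ⟶ P.F₁.obj (Proarrow.mk (e.hor m)) := β.cellApp m
    have hl : c₁.arrows (c₁.lift β₁) := .lift _
    obtain ⟨h, hPl⟩ := cartesianArrows.map_eq (c₁.isStronglyCartesian β₁)
    obtain ⟨hs, hs'⟩ := (hc.src _ hl).eq_lift (u := β.app A) (congrArg B.src.obj h) (by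
      refine (P.src_cell _).symm.trans ((congrArg B.src.map hPl).trans ?_)
      rw [B.src.map_comp, eqToHom_map]
      exact congrArg _ (β.src_cellApp m))
    obtain ⟨ht, ht'⟩ := (hc.tgt _ hl).eq_lift (u := β.app A') (congrArg B.tgt.obj h) (by
      refine (P.tgt_cell _).symm.trans ((congrArg B.tgt.map hPl).trans ?_)
      rw [B.tgt.map_comp, eqToHom_map]
      exact congrArg _ (β.tgt_cellApp m))
    obtain ⟨n, θ, hn, hθ, hsrc, htgt⟩ := E.exists_cell_of_src_tgt (c₁.lift β₁) hs ht hs' ht'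
    refine ⟨n, θ, hθ ▸ hl.eqToHom_comp hn, hsrc, htgt, (congrArg P.F₁.obj hn).trans h, ?_⟩
    have : P.F₁.map θ = P.F₁.map (eqToHom hn) ≫ P.F₁.map (c₁.lift β₁) := by rw [hθ, P.F₁.map_comp]
    rw [hPl, eqToHom_map, eqToHom_trans_assoc] at this
    exact this
  choose hor θ hθ hsrc htgt hhor using @key
  exact exists_lift_of_pointwise hP c₀.arrows c₁.arrows (fun _ _ _ h => h.cartesian)
    (fun _ _ _ h => h.cartesian) β _ hor (fun A => c₀.lift (β.app A)) θ (fun A => .lift _) hθ hsrc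
    htgt (fun A => cartesianArrows.map_eq (c₀.isStronglyCartesian _)) hhor

variable {e' e : LaxDoubleFunctor X E} {α : VertTrans e' e}

/-- The comparison cells of `e'` are comparisons between Cartesian cells whose images are
invertible. -/
lemma isPseudo_of_isPointwiseCartesian (hP : P.IsPseudo) (hU : P.UnitTensorPreserveCartesian)
    (he : e.IsPseudo) (he' : (e'.comp P).IsPseudo) (h : IsPointwiseCartesian P α) :
    e'.IsPseudo where
  isIso_ι A := by
    have h₁ : cartesianArrows P.F₁ (E.yMap (α.app A)) := hU.unit _ (h.app A)
    have := he.isIso_ι A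
    have h₂ := h₁.comp_iso (e.ι A)
    rw [α.unit] at h₂
    have h₃ : IsIso (P.cell (e'.ι A)) :=
      @IsIso.of_isIso_comp_left _ _ _ _ _ _ _ (hP.isIso_ι _) (he'.isIso_ι A)
    exact (h.cellApp _).isIso_of_comp h₂ h₃
  isIso_φ {A A' A''} m n := by
    have hw := (α.tgt_cellApp m).trans (α.src_cellApp n).symm
    let f : (⟨e'.hor m, e'.hor n⟩ : E.Pair) ⟶ ⟨e.hor m, e.hor n⟩ := ⟨_, _, hw⟩
    have h₁ : cartesianArrows P.F₁ (E.tensMap (α.cellApp m) (α.cellApp n) hw) :=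
      hU.tensor f (P.cartesianArrows_pair f (h.cellApp m) (h.cellApp n) (by
        change cartesianArrows P.F₀ (E.tgtMap (α.cellApp m))
        rw [α.tgt_cellApp]
        exact h.app A'))
    have := he.isIso_φ m n
    have h₂ := h₁.comp_iso (e.φ m n)
    rw [α.tensor] at h₂
    have h₃ : IsIso (P.cell (e'.φ m n)) :=
      @IsIso.of_isIso_comp_left _ _ _ _ _ _ _ (hP.isIso_φ _ _) (he'.isIso_φ m n)
    exact (h.cellApp _).isIso_of_comp h₂ h₃

/-- The comparison cells of `e'` are comparisons between chosen cells whose images are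
identities. -/
lemma isStrict_of_arrows (hP : P.IsStrict) {c₀ : Cleavage P.F₀} {c₁ : Cleavage P.F₁}
    (hU : P.UnitTensorPreserveCleavages c₀ c₁)
    (he : e.IsStrict) (he' : (e'.comp P).IsStrict) (h₀ : ∀ A, c₀.arrows (α.app A))
    (h₁ : ∀ {A A' : X.Obj} (m : X.Hor A A'), c₁.arrows (α.cellApp m)) :
    e'.IsStrict where
  ι_eq A := by
    obtain ⟨h, hh⟩ := he.ι_eq A
    have h₂ := (hU.unit _ (h₀ A)).comp_eqToHom (congrArg Proarrow.mk h)
    have h₃ : c₁.arrows (e'.ι A ≫ α.cellApp (X.y A)) := by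
      rw [← α.unit, hh]
      exact h₂
    obtain ⟨hb, hb'⟩ := he'.ι_eq A
    obtain ⟨hp, hp'⟩ := hP.ι_eq (e'.F₀.obj A)
    have h₄ : P.cell (e'.ι A) = eqToHom (congrArg Proarrow.mk (hp.symm.trans hb)) :=
      eq_eqToHom_of_comp hp' hb'
    obtain ⟨h₅, h₆⟩ := (h₁ _).eq_eqToHom h₃ h₄
    exact ⟨by simpa using h₅, h₆⟩
  φ_eq m n := by
    obtain ⟨h, hh⟩ := he.φ_eq m n
    have hw := (α.tgt_cellApp m).trans (α.src_cellApp n).symm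
    let f : (⟨e'.hor m, e'.hor n⟩ : E.Pair) ⟶ ⟨e.hor m, e.hor n⟩ := ⟨_, _, hw⟩
    have h₂ := (hU.tensor f ⟨h₁ m, h₁ n⟩).comp_eqToHom (congrArg Proarrow.mk h)
    have h₃ : c₁.arrows (e'.φ m n ≫ α.cellApp (X.tens m n)) := by
      rw [← α.tensor, hh]
      exact h₂
    obtain ⟨hb, hb'⟩ := he'.φ_eq m n
    obtain ⟨hp, hp'⟩ := hP.φ_eq (e'.hor m) (e'.hor n)
    have h₄ : P.cell (e'.φ m n) = eqToHom (congrArg Proarrow.mk (hp.symm.trans hb)) :=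
      eq_eqToHom_of_comp hp' hb'
    obtain ⟨h₅, h₆⟩ := (h₁ _).eq_eqToHom h₃ h₄
    exact ⟨by simpa using h₅, h₆⟩

end VertTrans

section

open Bicategory VertTrans

variable {k : FunctorKind} {E B : DoubleCat.{v, u}} {P : LaxDoubleFunctor E B}

/-- A double functor of kind `k` is an internal fibration as soon as each transformation between
double functors of kind `k` has a pointwise Cartesian lift of kind `k`. -/
lemma isInternalFibration_of_exists_lift (hP : P.IsPseudo) (hk : P.IsOfKind k)
    (H : ∀ (X : DoubleCat.{v, u}) (e : LaxDoubleFunctor X E) (b : LaxDoubleFunctor X B)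
      (β : VertTrans b (e.comp P)), e.IsOfKind k → b.IsOfKind k →
      ∃ (e' : LaxDoubleFunctor X E) (α : VertTrans e' e) (_ : e'.comp P = b),
        HEq (VertTrans.whiskerRight α P) β ∧ IsPointwiseCartesian P α ∧ e'.IsOfKind k) :
    IsInternalFibration (P.toDblOf hk) := by
  intro X e ⟨b, hb⟩ β
  obtain ⟨e', α, rfl, hα, hα', he'⟩ := H X.toDoubleCat (DblHom.functor e) b β
    (DblHom.isOfKind e) hb
  refine ⟨e'.toDblOf he', α, rfl, ?_,
    IsPointwiseCartesian.isCartesianTwoCell hP hk (e' := e'.toDblOf he') (e := e) α hα'⟩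
  exact (eq_of_heq hα).trans (Category.id_comp β).symm

end

/-! ### The comma double category -/

section

variable {E B : DoubleCat.{v, max u v}}

namespace LaxDoubleFunctor

variable {P : LaxDoubleFunctor E B}

lemma yMap_comp_ι_of_comm {b b' : B.Obj} {e e' : E.Obj} (f : b ⟶ b') (g : e ⟶ e')
    (u : b ⟶ P.F₀.obj e) (u' : b' ⟶ P.F₀.obj e') (w : f ≫ u' = u ≫ P.F₀.map g) :
    B.yMap f ≫ B.yMap u' ≫ P.ι e' = (B.yMap u ≫ P.ι e) ≫ P.cell (E.yMap g) := by
  rw [Category.assoc, ← P.ι_naturality, ← Category.assoc, ← Category.assoc, ← B.yMap_comp,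
    ← B.yMap_comp, w]

lemma tensMap_comp_φ_of_comm {b₁ b₂ b₃ b₁' b₂' b₃' : B.Obj} {e₁ e₂ e₃ e₁' e₂' e₃' : E.Obj}
    {l : B.Hor b₁ b₂} {r : B.Hor b₂ b₃} {l' : B.Hor b₁' b₂'} {r' : B.Hor b₂' b₃'}
    {m : E.Hor e₁ e₂} {n : E.Hor e₂ e₃} {m' : E.Hor e₁' e₂'} {n' : E.Hor e₂' e₃'}
    {μ : Proarrow.mk l ⟶ Proarrow.mk (P.hor m)} {ν : Proarrow.mk r ⟶ Proarrow.mk (P.hor n)}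
    {μ' : Proarrow.mk l' ⟶ Proarrow.mk (P.hor m')} {ν' : Proarrow.mk r' ⟶ Proarrow.mk (P.hor n')}
    {f : Proarrow.mk l ⟶ Proarrow.mk l'} {g : Proarrow.mk r ⟶ Proarrow.mk r'}
    {f' : Proarrow.mk m ⟶ Proarrow.mk m'} {g' : Proarrow.mk n ⟶ Proarrow.mk n'}
    (w : f ≫ μ' = μ ≫ P.cell f') (w' : g ≫ ν' = ν ≫ P.cell g') (h : B.tgtMap f = B.srcMap g)
    (h' : E.tgtMap f' = E.srcMap g') (h₁ : B.tgtMap μ = B.srcMap ν)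
    (h₂ : B.tgtMap μ' = B.srcMap ν') :
    B.tensMap f g h ≫ B.tensMap μ' ν' h₂ ≫ P.φ m' n' =
      (B.tensMap μ ν h₁ ≫ P.φ m n) ≫ P.cell (E.tensMap f' g' h') := by
  rw [Category.assoc, ← P.φ_naturality _ _ h', ← Category.assoc, ← Category.assoc,
    ← B.tensMap_comp _ _ _ _ _ h₂, ← B.tensMap_comp _ _ h₁]
  exact congrArg (· ≫ _) (tensMap_congr w w' _)

lemma assoc_comp_φ {b₁ b₂ b₃ b₄ : B.Obj} {e₁ e₂ e₃ e₄ : E.Obj}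
    {l : B.Hor b₁ b₂} {r : B.Hor b₂ b₃} {s : B.Hor b₃ b₄}
    {m : E.Hor e₁ e₂} {n : E.Hor e₂ e₃} {p : E.Hor e₃ e₄}
    (μ : Proarrow.mk l ⟶ Proarrow.mk (P.hor m)) (ν : Proarrow.mk r ⟶ Proarrow.mk (P.hor n))
    (κ : Proarrow.mk s ⟶ Proarrow.mk (P.hor p)) (h₁ : B.tgtMap μ = B.srcMap ν)
    (h₂ : B.tgtMap ν = B.srcMap κ) (h₃ h₄) :
    (B.assoc l r s).hom ≫ B.tensMap μ (B.tensMap ν κ h₂ ≫ P.φ n p) h₃ ≫ P.φ m (E.tens n p) =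
      (B.tensMap (B.tensMap μ ν h₁ ≫ P.φ m n) κ h₄ ≫ P.φ (E.tens m n) p) ≫
        P.cell (E.assoc m n p).hom := by
  rw [← B.tensMap_left_comp _ (P.φ m n) _ ((B.tgt_tensMap _ _ h₁).trans h₂)
      ((P.tgt_φ _ _).trans (B.srcMap_id _).symm),
    ← B.tensMap_right_comp _ _ (P.φ n p) (h₁.trans (B.src_tensMap _ _ h₂).symm)
      ((B.tgtMap_id _).trans (P.src_φ _ _).symm)]
  simp only [Category.assoc]
  rw [P.associativity, ← reassoc_of% B.assoc_naturality μ ν κ h₁ h₂]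

end LaxDoubleFunctor

/-- Objects of the comma double category `B ↓ P`: arrows `b ⟶ P e`. -/
structure CommaObj (P : LaxDoubleFunctor E B) where
  base : B.Obj
  tot : E.Obj
  hom : base ⟶ P.F₀.obj tot

variable {P : LaxDoubleFunctor E B}

/-- Arrows of the comma double category: commutative squares. -/
@[ext]
structure CommaArrow (X Y : CommaObj P) where
  base : X.base ⟶ Y.base
  tot : X.tot ⟶ Y.tot
  w : base ≫ Y.hom = X.hom ≫ P.F₀.map tot

/-- Proarrows of the comma double category: cells `n ⟶ P m` with prescribed source and target. -/
structure CommaHor (X Y : CommaObj P) where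
  base : B.Hor X.base Y.base
  tot : E.Hor X.tot Y.tot
  cell : Proarrow.mk base ⟶ Proarrow.mk (P.hor tot)
  src_cell : B.srcMap cell = X.hom
  tgt_cell : B.tgtMap cell = Y.hom

/-- Cells of the comma double category: commutative squares of cells. -/
@[ext]
structure CommaCell (M N : Proarrow (CommaHor (P := P))) where
  base : Proarrow.mk M.hor.base ⟶ Proarrow.mk N.hor.base
  tot : Proarrow.mk M.hor.tot ⟶ Proarrow.mk N.hor.tot
  w : base ≫ N.hor.cell = M.hor.cell ≫ P.cell tot

lemma CommaHor.ext_of_eqToHom {X Y : CommaObj P} {M N : CommaHor X Y} (h : M.base = N.base)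
    (h' : M.tot = N.tot) (hc : M.cell = eqToHom (by rw [h]) ≫ N.cell ≫ eqToHom (by rw [h'])) :
    M = N := by
  obtain ⟨b, t, c, _, _⟩ := M
  obtain ⟨b', t', c', _, _⟩ := N
  obtain rfl : b = b' := h
  obtain rfl : t = t' := h'
  obtain rfl : c = c' := by simpa using hc
  rfl

instance : Category.{v} (CommaObj P) where
  Hom := CommaArrow
  id X := ⟨𝟙 _, 𝟙 _, by simp⟩
  comp f g := ⟨f.base ≫ g.base, f.tot ≫ g.tot, by
    rw [Category.assoc, g.w, P.F₀.map_comp, ← Category.assoc, f.w, Category.assoc]⟩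
  id_comp f := CommaArrow.ext (Category.id_comp _) (Category.id_comp _)
  comp_id f := CommaArrow.ext (Category.comp_id _) (Category.comp_id _)
  assoc f g h := CommaArrow.ext (Category.assoc _ _ _) (Category.assoc _ _ _)

instance : Category.{v} (Proarrow (CommaHor (P := P))) where
  Hom := CommaCell
  id M := ⟨𝟙 _, 𝟙 _, by rw [P.cell_id]; simp⟩
  comp f g := ⟨f.base ≫ g.base, f.tot ≫ g.tot, by
    rw [Category.assoc, g.w, P.cell_comp, ← Category.assoc, f.w, Category.assoc]⟩
  id_comp f := CommaCell.ext (Category.id_comp _) (Category.id_comp _)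
  comp_id f := CommaCell.ext (Category.comp_id _) (Category.comp_id _)
  assoc f g h := CommaCell.ext (Category.assoc _ _ _) (Category.assoc _ _ _)

namespace CommaCell

lemma eqToHom_base {M N : Proarrow (CommaHor (P := P))} (h : M = N) :
    CommaCell.base (eqToHom h) = eqToHom (by rw [h]) := by
  subst h; rfl

lemma eqToHom_tot {M N : Proarrow (CommaHor (P := P))} (h : M = N) :
    CommaCell.tot (eqToHom h) = eqToHom (by rw [h]) := by
  subst h; rfl

variable {M N : Proarrow (CommaHor (P := P))} (θ : CommaCell M N)

/-- The external source of a cell of the comma double category. -/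
def src : CommaArrow M.src N.src :=
  ⟨B.srcMap θ.base, E.srcMap θ.tot, by
    rw [← M.hor.src_cell, ← N.hor.src_cell, ← B.srcMap_comp, θ.w, B.srcMap_comp, P.src_cell]⟩

/-- The external target of a cell of the comma double category. -/
def tgt : CommaArrow M.tgt N.tgt :=
  ⟨B.tgtMap θ.base, E.tgtMap θ.tot, by
    rw [← M.hor.tgt_cell, ← N.hor.tgt_cell, ← B.tgtMap_comp, θ.w, B.tgtMap_comp, P.tgt_cell]⟩

end CommaCell

namespace CommaHor

/-- The external units of the comma double category. -/
def unit (X : CommaObj P) : CommaHor X X where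
  base := B.y X.base
  tot := E.y X.tot
  cell := B.yMap X.hom ≫ P.ι X.tot
  src_cell := by rw [B.srcMap_comp, B.src_yMap, P.src_ι, Category.comp_id]
  tgt_cell := by rw [B.tgtMap_comp, B.tgt_yMap, P.tgt_ι, Category.comp_id]

variable {X Y Z W : CommaObj P}

lemma tgt_eq_src (M : CommaHor X Y) (N : CommaHor Y Z) : B.tgtMap M.cell = B.srcMap N.cell :=
  M.tgt_cell.trans N.src_cell.symm

/-- External composition of proarrows in the comma double category. -/
def tens (M : CommaHor X Y) (N : CommaHor Y Z) : CommaHor X Z where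
  base := B.tens M.base N.base
  tot := E.tens M.tot N.tot
  cell := B.tensMap M.cell N.cell (M.tgt_eq_src N) ≫ P.φ M.tot N.tot
  src_cell := by rw [B.srcMap_comp, B.src_tensMap, P.src_φ, Category.comp_id, M.src_cell]
  tgt_cell := by rw [B.tgtMap_comp, B.tgt_tensMap, P.tgt_φ, Category.comp_id, N.tgt_cell]

lemma unit_tens (M : CommaHor X Y) : tens (unit X) M = M :=
  ext_of_eqToHom (B.unit_tens _) (E.unit_tens _) (P.unit_tensMap_φ _ _ M.src_cell _)

lemma tens_unit (M : CommaHor X Y) : tens M (unit Y) = M :=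
  ext_of_eqToHom (B.tens_unit _) (E.tens_unit _) (P.tensMap_unit_φ _ _ M.tgt_cell _)

lemma assoc_comp_cell (M : CommaHor X Y) (N : CommaHor Y Z) (L : CommaHor Z W) :
    (B.assoc M.base N.base L.base).hom ≫ (tens M (tens N L)).cell =
      (tens (tens M N) L).cell ≫ P.cell (E.assoc M.tot N.tot L.tot).hom :=
  P.assoc_comp_φ _ _ _ (M.tgt_eq_src N) (N.tgt_eq_src L) _ _

lemma assoc_inv_comp_cell (M : CommaHor X Y) (N : CommaHor Y Z) (L : CommaHor Z W) :
    (B.assoc M.base N.base L.base).inv ≫ (tens (tens M N) L).cell =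
      (tens M (tens N L)).cell ≫ P.cell (E.assoc M.tot N.tot L.tot).inv := by
  have h : P.cell (E.assoc M.tot N.tot L.tot).hom ≫ P.cell (E.assoc M.tot N.tot L.tot).inv =
      𝟙 _ := by rw [← P.cell_comp, Iso.hom_inv_id, P.cell_id]
  refine (Iso.inv_comp_eq _).2 (Eq.symm ?_)
  refine (Category.assoc _ _ _).symm.trans ?_
  rw [assoc_comp_cell]
  exact (Category.assoc _ _ _).trans ((congrArg (_ ≫ ·) h).trans (Category.comp_id _))

end CommaHor

/-- The comma double category `B ↓ P`. Its objects and proarrows include arrows and cells of `B`;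
for it to have the size of `E` and `B`, their universe of objects has to be `max u v`. -/
def commaDoubleCat (P : LaxDoubleFunctor E B) : DoubleCat.{v, max u v} where
  Obj := CommaObj P
  Hor := CommaHor
  srcMap θ := CommaCell.src θ
  tgtMap θ := CommaCell.tgt θ
  srcMap_id _ := CommaArrow.ext (B.srcMap_id _) (E.srcMap_id _)
  tgtMap_id _ := CommaArrow.ext (B.tgtMap_id _) (E.tgtMap_id _)
  srcMap_comp _ _ := CommaArrow.ext (B.srcMap_comp _ _) (E.srcMap_comp _ _)
  tgtMap_comp _ _ := CommaArrow.ext (B.tgtMap_comp _ _) (E.tgtMap_comp _ _)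
  y X := CommaHor.unit X
  yMap f := CommaCell.mk (B.yMap f.base) (E.yMap f.tot) (P.yMap_comp_ι_of_comm _ _ _ _ f.w)
  src_yMap _ := CommaArrow.ext (B.src_yMap _) (E.src_yMap _)
  tgt_yMap _ := CommaArrow.ext (B.tgt_yMap _) (E.tgt_yMap _)
  yMap_id _ := CommaCell.ext (B.yMap_id _) (E.yMap_id _)
  yMap_comp _ _ := CommaCell.ext (B.yMap_comp _ _) (E.yMap_comp _ _)
  tens M N := CommaHor.tens M N
  tensMap θ κ h := CommaCell.mk
    (B.tensMap θ.base κ.base (congrArg CommaArrow.base h))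
    (E.tensMap θ.tot κ.tot (congrArg CommaArrow.tot h))
    (P.tensMap_comp_φ_of_comm θ.w κ.w _ (congrArg CommaArrow.tot h) (CommaHor.tgt_eq_src _ _) _)
  src_tensMap _ _ _ := CommaArrow.ext (B.src_tensMap _ _ _) (E.src_tensMap _ _ _)
  tgt_tensMap _ _ _ := CommaArrow.ext (B.tgt_tensMap _ _ _) (E.tgt_tensMap _ _ _)
  tensMap_id _ _ := CommaCell.ext (B.tensMap_id _ _) (E.tensMap_id _ _)
  tensMap_comp _ _ h _ _ h' := CommaCell.ext
    (B.tensMap_comp _ _ (congrArg CommaArrow.base h) _ _ (congrArg CommaArrow.base h'))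
    (E.tensMap_comp _ _ (congrArg CommaArrow.tot h) _ _ (congrArg CommaArrow.tot h'))
  unit_tens M := M.unit_tens
  tens_unit M := M.tens_unit
  unit_tensMap {_ _ _ _ M N} θ :=
    have h := congrArg Proarrow.mk (CommaHor.unit_tens M)
    have h' := congrArg Proarrow.mk (CommaHor.unit_tens N).symm
    CommaCell.ext
      ((B.unit_tensMap θ.base).trans (congrArg₂ (· ≫ θ.base ≫ ·)
        (CommaCell.eqToHom_base h).symm (CommaCell.eqToHom_base h').symm))
      ((E.unit_tensMap θ.tot).trans (congrArg₂ (· ≫ θ.tot ≫ ·)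
        (CommaCell.eqToHom_tot h).symm (CommaCell.eqToHom_tot h').symm))
  tensMap_unit {_ _ _ _ M N} θ :=
    have h := congrArg Proarrow.mk (CommaHor.tens_unit M)
    have h' := congrArg Proarrow.mk (CommaHor.tens_unit N).symm
    CommaCell.ext
      ((B.tensMap_unit θ.base).trans (congrArg₂ (· ≫ θ.base ≫ ·)
        (CommaCell.eqToHom_base h).symm (CommaCell.eqToHom_base h').symm))
      ((E.tensMap_unit θ.tot).trans (congrArg₂ (· ≫ θ.tot ≫ ·)
        (CommaCell.eqToHom_tot h).symm (CommaCell.eqToHom_tot h').symm))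
  assoc M N L :=
    { hom := CommaCell.mk (B.assoc M.base N.base L.base).hom (E.assoc M.tot N.tot L.tot).hom
        (CommaHor.assoc_comp_cell M N L)
      inv := CommaCell.mk (B.assoc M.base N.base L.base).inv (E.assoc M.tot N.tot L.tot).inv
        (CommaHor.assoc_inv_comp_cell M N L)
      hom_inv_id := CommaCell.ext (Iso.hom_inv_id _) (Iso.hom_inv_id _)
      inv_hom_id := CommaCell.ext (Iso.inv_hom_id _) (Iso.inv_hom_id _) }
  src_assoc _ _ _ := CommaArrow.ext (B.src_assoc _ _ _) (E.src_assoc _ _ _)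
  tgt_assoc _ _ _ := CommaArrow.ext (B.tgt_assoc _ _ _) (E.tgt_assoc _ _ _)
  assoc_naturality _ _ _ h h' := CommaCell.ext
    (B.assoc_naturality _ _ _ (congrArg CommaArrow.base h) (congrArg CommaArrow.base h'))
    (E.assoc_naturality _ _ _ (congrArg CommaArrow.tot h) (congrArg CommaArrow.tot h'))
  pentagon _ _ _ _ := CommaCell.ext (B.pentagon _ _ _ _) (E.pentagon _ _ _ _)
  triangle M N :=
    have h : Proarrow.mk (CommaHor.tens (CommaHor.tens M (CommaHor.unit _)) N) =
        Proarrow.mk (CommaHor.tens M (CommaHor.tens (CommaHor.unit _) N)) := by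
      rw [CommaHor.tens_unit, CommaHor.unit_tens]
    CommaCell.ext ((B.triangle _ _).trans (CommaCell.eqToHom_base h).symm)
      ((E.triangle _ _).trans (CommaCell.eqToHom_tot h).symm)

namespace commaDoubleCat

lemma id_comp_id_comp_eq {𝒳 : Type*} [Category 𝒳] {a b : 𝒳} {i : a ⟶ a} {j : b ⟶ b}
    {f : a ⟶ b} (hi : i = 𝟙 a) (hj : j = 𝟙 b) : i ≫ 𝟙 a ≫ f = f ≫ j ≫ 𝟙 b := by
  subst hi hj; simp

variable (P)

/-- The projection of the comma double category to the base, a strict double functor. -/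
def base : LaxDoubleFunctor (commaDoubleCat P) B where
  F₀ :=
    { obj := fun X => CommaObj.base X
      map := fun f => CommaArrow.base f }
  hor M := CommaHor.base M
  cell θ := CommaCell.base θ
  cell_id _ := rfl
  cell_comp _ _ := rfl
  src_cell _ := rfl
  tgt_cell _ := rfl
  ι _ := 𝟙 _
  src_ι _ := B.srcMap_id _
  tgt_ι _ := B.tgtMap_id _
  ι_naturality _ := (Category.comp_id _).trans (Category.id_comp _).symm
  φ _ _ := 𝟙 _
  src_φ _ _ := B.srcMap_id _
  tgt_φ _ _ := B.tgtMap_id _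
  φ_naturality _ _ _ := (Category.comp_id _).trans (Category.id_comp _).symm
  associativity m n p :=
    id_comp_id_comp_eq (B.tensMap_id (B.tens (CommaHor.base m) (CommaHor.base n)) (CommaHor.base p))
      (B.tensMap_id (CommaHor.base m) (B.tens (CommaHor.base n) (CommaHor.base p)))
  left_unitality {X _} m :=
    (congrArg (· ≫ _) (B.tensMap_id (B.y (CommaObj.base X)) (CommaHor.base m))).trans
      (Category.id_comp _)
  right_unitality {_ Y} m :=
    (congrArg (· ≫ _) (B.tensMap_id (CommaHor.base m) (B.y (CommaObj.base Y)))).trans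
      (Category.id_comp _)

/-- The projection of the comma double category to the total double category, a strict double
functor. -/
def tot : LaxDoubleFunctor (commaDoubleCat P) E where
  F₀ :=
    { obj := fun X => CommaObj.tot X
      map := fun f => CommaArrow.tot f }
  hor M := CommaHor.tot M
  cell θ := CommaCell.tot θ
  cell_id _ := rfl
  cell_comp _ _ := rfl
  src_cell _ := rfl
  tgt_cell _ := rfl
  ι _ := 𝟙 _
  src_ι _ := E.srcMap_id _
  tgt_ι _ := E.tgtMap_id _
  ι_naturality _ := (Category.comp_id _).trans (Category.id_comp _).symm
  φ _ _ := 𝟙 _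
  src_φ _ _ := E.srcMap_id _
  tgt_φ _ _ := E.tgtMap_id _
  φ_naturality _ _ _ := (Category.comp_id _).trans (Category.id_comp _).symm
  associativity m n p :=
    id_comp_id_comp_eq (E.tensMap_id (E.tens (CommaHor.tot m) (CommaHor.tot n)) (CommaHor.tot p))
      (E.tensMap_id (CommaHor.tot m) (E.tens (CommaHor.tot n) (CommaHor.tot p)))
  left_unitality {X _} m :=
    (congrArg (· ≫ _) (E.tensMap_id (E.y (CommaObj.tot X)) (CommaHor.tot m))).trans
      (Category.id_comp _)
  right_unitality {_ Y} m :=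
    (congrArg (· ≫ _) (E.tensMap_id (CommaHor.tot m) (E.y (CommaObj.tot Y)))).trans
      (Category.id_comp _)

lemma base_isStrict : (base P).IsStrict := ⟨fun _ => ⟨rfl, rfl⟩, fun _ _ => ⟨rfl, rfl⟩⟩

lemma tot_isStrict : (tot P).IsStrict := ⟨fun _ => ⟨rfl, rfl⟩, fun _ _ => ⟨rfl, rfl⟩⟩

/-- The universal transformation from a double functor into the base to one that factors through
`P`. -/
def trans : VertTrans (base P) ((tot P).comp P) where
  app X := CommaObj.hom X
  cellApp M := CommaHor.cell M
  src_cellApp M := CommaHor.src_cell M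
  tgt_cellApp M := CommaHor.tgt_cell M
  naturality f := CommaArrow.w f
  cell_naturality θ := CommaCell.w θ
  unit X := by
    refine (congrArg (_ ≫ ·) ((congrArg (_ ≫ ·) (P.cell_id _)).trans (Category.comp_id _))).trans
      (Category.id_comp _).symm
  tensor M N := by
    refine (congrArg (_ ≫ ·) ((congrArg (_ ≫ ·) (P.cell_id _)).trans (Category.comp_id _))).trans
      (Category.id_comp _).symm

end commaDoubleCat

end

/-! ### From internal fibrations to cleavages -/

section

variable {E B : DoubleCat.{v, max u v}} {P : LaxDoubleFunctor E B}

namespace commaDoubleCat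

/-- An arrow `b ⟶ P e`, as an object of the comma double category. -/
def ofArrow {b : B.Obj} {e : E.Obj} (u : b ⟶ P.F₀.obj e) : (commaDoubleCat P).Obj :=
  CommaObj.mk b e u

/-- A cell `n ⟶ P m`, as a proarrow of the comma double category. -/
def ofCell {N : B.Pro} {M : E.Pro} (u : N ⟶ P.F₁.obj M) :
    (commaDoubleCat P).Hor (ofArrow (B.src.map u : N.src ⟶ P.F₀.obj M.src))
      (ofArrow (B.tgt.map u : N.tgt ⟶ P.F₀.obj M.tgt)) :=
  CommaHor.mk N.hor M.hor u rfl rfl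

/-- A cell `θ` of the total double category, as the proarrow `P θ` of the comma double category. -/
def ofTotCell {A A' C C' : E.Obj} {m : E.Hor A A'} {n : E.Hor C C'}
    (θ : Proarrow.mk m ⟶ Proarrow.mk n) {s : A ⟶ C} (hs : E.srcMap θ = s) {t : A' ⟶ C'}
    (ht : E.tgtMap θ = t) :
    (commaDoubleCat P).Hor (ofArrow (P.F₀.map s)) (ofArrow (P.F₀.map t)) :=
  CommaHor.mk (P.hor m) n (P.cell θ) ((P.src_cell θ).trans (congrArg P.F₀.map hs))
    ((P.tgt_cell θ).trans (congrArg P.F₀.map ht))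

lemma eqToHom_trans_assoc_refl {𝒳 : Type*} [Category 𝒳] {a b c : 𝒳} (h : a = b) (f : b ⟶ c) :
    eqToHom h.symm ≫ eqToHom h ≫ f = f := by
  subst h; simp

/-- Replacing an arrow by an equal one, where the types of the two agree only after the comma double
category is unfolded, so that rewriting is not available. -/
lemma property_of_eq {𝒳 : Type*} [Category 𝒳] {W : MorphismProperty 𝒳} {a b : 𝒳} {f g : a ⟶ b}
    (h : f = g) (hg : W g) : W f := by
  subst h; exact hg

/-- A Cartesian lift of the universal transformation `trans P`, described by its components. -/
structure IsUniversalLift {e' : LaxDoubleFunctor (commaDoubleCat P) E}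
    (α : VertTrans e' (tot P)) : Prop where
  isPointwiseCartesian : VertTrans.IsPointwiseCartesian P α
  map_app : ∀ X : CommaObj P, ∃ h : P.F₀.obj (e'.F₀.obj X) = X.base,
    P.F₀.map (α.app X) = eqToHom h ≫ X.hom
  cell_cellApp : ∀ {X Y : CommaObj P} (m : CommaHor X Y),
    ∃ h : Proarrow.mk (P.hor (e'.hor m)) = Proarrow.mk m.base,
      P.cell (α.cellApp m) = eqToHom h ≫ m.cell

/-- An internal fibration of any kind has a universal lift, because the projections of the comma
double category are strict. -/
lemma exists_isUniversalLift {k : FunctorKind} (hP : P.IsPseudo) (hk : P.IsOfKind k)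
    (h : IsInternalFibration (P.toDblOf hk)) :
    ∃ (e' : LaxDoubleFunctor (commaDoubleCat P) E) (α : VertTrans e' (tot P)),
      e'.IsOfKind k ∧ IsUniversalLift α := by
  let e : (⟨commaDoubleCat P⟩ : DblOf k) ⟶ ⟨E⟩ := (tot P).toDblOf ((tot_isStrict P).isOfKind k)
  let b : (⟨commaDoubleCat P⟩ : DblOf k) ⟶ ⟨B⟩ := (base P).toDblOf ((base_isStrict P).isOfKind k)
  obtain ⟨e', α, he', hα, hα'⟩ := h ⟨commaDoubleCat P⟩ e b (trans P)
  refine ⟨DblHom.functor e', α, DblHom.isOfKind e',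
    hα'.isPointwiseCartesian hP hk, fun X => ?_, fun {X Y} m => ?_⟩
  · exact ⟨_, (congrArg (fun σ => VertTrans.app σ X) hα).trans
      (congrArg (· ≫ CommaObj.hom X) (DblHom.eqToHom_app he' X))⟩
  · exact ⟨_, (congrArg (fun σ => VertTrans.cellApp σ m) hα).trans
      (congrArg (· ≫ CommaHor.cell m) (DblHom.eqToHom_cellApp he' m))⟩

namespace IsUniversalLift

variable {e' : LaxDoubleFunctor (commaDoubleCat P) E} {α : VertTrans e' (tot P)}

/-- The cleavage of `P₀` given by the components at objects of a universal lift. -/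
def cleavage₀ (h : IsUniversalLift α) : Cleavage P.F₀ where
  dom u := e'.F₀.obj (ofArrow u)
  lift u := α.app (ofArrow u)
  isStronglyCartesian u :=
    (h.isPointwiseCartesian.app (ofArrow u)).isStronglyCartesian (h.map_app (ofArrow u)).1
      (h.map_app (ofArrow u)).2

/-- The cleavage of `P₁` given by the components at proarrows of a universal lift. -/
def cleavage₁ (h : IsUniversalLift α) : Cleavage P.F₁ where
  dom u := ⟨e'.hor (ofCell u)⟩
  lift u := α.cellApp (ofCell u)
  isStronglyCartesian u :=
    (h.isPointwiseCartesian.cellApp (ofCell u)).isStronglyCartesian (h.cell_cellApp (ofCell u)).1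
      (h.cell_cellApp (ofCell u)).2

lemma arrows_app (h : IsUniversalLift α) (X : CommaObj P) : h.cleavage₀.arrows (α.app X) :=
  .lift (c := h.cleavage₀) X.hom

/-- A proarrow of the comma double category is a cell `ofCell u`, up to the equalities of its source
and target with those of `u`. -/
lemma arrows_cellApp (h : IsUniversalLift α) {X Y : CommaObj P} (m : CommaHor X Y) :
    h.cleavage₁.arrows (α.cellApp m) := by
  have key {x x' : B.Obj} {a a' : E.Obj} {n : B.Hor x x'} {m : E.Hor a a'}
      (c : Proarrow.mk n ⟶ Proarrow.mk (P.hor m)) {s : x ⟶ P.F₀.obj a} (hs : B.srcMap c = s)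
      {t : x' ⟶ P.F₀.obj a'} (ht : B.tgtMap c = t) :
      h.cleavage₁.arrows (α.cellApp
        (CommaHor.mk n m c hs ht : CommaHor (CommaObj.mk x a s) (CommaObj.mk x' a' t))) := by
    cases hs
    cases ht
    exact .lift (c := h.cleavage₁) (b := Proarrow.mk n) (e := Proarrow.mk m) c
  exact key m.cell m.src_cell m.tgt_cell

lemma srcTgtPreserveCleavages (h : IsUniversalLift α) :
    P.SrcTgtPreserveCleavages h.cleavage₀ h.cleavage₁ where
  src := by
    rintro _ _ _ ⟨u⟩
    change h.cleavage₀.arrows (E.srcMap (α.cellApp (ofCell u)))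
    rw [α.src_cellApp]
    exact h.arrows_app _
  tgt := by
    rintro _ _ _ ⟨u⟩
    change h.cleavage₀.arrows (E.tgtMap (α.cellApp (ofCell u)))
    rw [α.tgt_cellApp]
    exact h.arrows_app _

lemma yMap_app (α : VertTrans e' (tot P)) (X : CommaObj P) :
    E.yMap (α.app X) = e'.ι X ≫ α.cellApp (CommaHor.unit X) :=
  (Category.comp_id _).symm.trans (α.unit X)

lemma tensMap_cellApp (α : VertTrans e' (tot P)) {X Y Z : CommaObj P} (m : CommaHor X Y)
    (n : CommaHor Y Z) (hw) :
    E.tensMap (α.cellApp m) (α.cellApp n) hw = e'.φ m n ≫ α.cellApp (CommaHor.tens m n) :=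
  (Category.comp_id _).symm.trans (α.tensor m n)

/-- A chosen cell is a component of the universal lift, up to an equality of domains. -/
lemma eq_cellApp_ofTotCell (h : IsUniversalLift α) {A A' C C' : E.Obj} {m : E.Hor A A'}
    {n : E.Hor C C'} {θ : Proarrow.mk m ⟶ Proarrow.mk n} (hθ : h.cleavage₁.arrows θ)
    {s : A ⟶ C} (hs : E.srcMap θ = s) {t : A' ⟶ C'} (ht : E.tgtMap θ = t) :
    ∃ hm : Proarrow.mk m = Proarrow.mk (e'.hor (ofTotCell (P := P) θ hs ht)),
      θ = eqToHom hm ≫ α.cellApp (ofTotCell (P := P) θ hs ht) := by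
  obtain ⟨h₁, h₂⟩ := h.cell_cellApp (ofTotCell (P := P) θ hs ht)
  refine hθ.unique (h.arrows_cellApp _) h₁.symm ?_
  refine Eq.trans ?_ (congrArg (eqToHom h₁.symm ≫ ·) h₂).symm
  exact (eqToHom_trans_assoc_refl h₁ _).symm

/-- Chosen arrows and cells are components of the universal lift, whose composites with `y` and `⊗`
are again components, as `ι` and `φ` are identities. -/
lemma unitTensorPreserveCleavages (h : IsUniversalLift α) (he' : e'.IsStrict) :
    P.UnitTensorPreserveCleavages h.cleavage₀ h.cleavage₁ where
  unit := by
    rintro _ _ _ ⟨u⟩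
    obtain ⟨hι, hι'⟩ := he'.ι_eq (ofArrow u)
    exact property_of_eq (W := h.cleavage₁.arrows)
      ((yMap_app α (ofArrow u)).trans (congrArg (· ≫ _) hι'))
      ((h.arrows_cellApp _).eqToHom_comp _)
  tensor := by
    rintro M N f ⟨h₁, h₂⟩
    obtain ⟨hm, hm'⟩ := h.eq_cellApp_ofTotCell h₁ rfl rfl
    obtain ⟨hn, hn'⟩ := h.eq_cellApp_ofTotCell h₂ f.w.symm rfl
    obtain ⟨hφ, hφ'⟩ := he'.φ_eq (ofTotCell (P := P) f.fst rfl rfl)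
      (ofTotCell (P := P) f.snd f.w.symm rfl)
    have hw := (α.tgt_cellApp (ofTotCell (P := P) f.fst rfl rfl)).trans
      (α.src_cellApp (ofTotCell (P := P) f.snd f.w.symm rfl)).symm
    exact property_of_eq (W := h.cleavage₁.arrows)
      ((LaxDoubleFunctor.tensMap_congr hm' hn' f.w).trans
      ((DoubleCat.tensMap_eqToHom_comp hm hn _ _ hw _).trans (congrArg (_ ≫ ·)
        ((tensMap_cellApp α _ _ hw).trans (congrArg (· ≫ _) hφ')))))
      (((h.arrows_cellApp _).eqToHom_comp _).eqToHom_comp _)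

/-- Every arrow factors through the component of the universal lift over the same arrow. -/
lemma exists_comp_app (h : IsUniversalLift α) {A C : E.Obj} (f : A ⟶ C) :
    ∃ k : A ⟶ e'.F₀.obj (ofArrow (P.F₀.map f)), k ≫ α.app (ofArrow (P.F₀.map f)) = f ∧
      ∃ h, P.F₀.map k = eqToHom h := by
  obtain ⟨h₁, h₂⟩ := h.map_app (ofArrow (P.F₀.map f))
  obtain ⟨k, hk, hk'⟩ := (h.isPointwiseCartesian.app (ofArrow (P.F₀.map f))).exists_lift f
    (eqToHom h₁.symm) ((congrArg (eqToHom h₁.symm ≫ ·) h₂).trans (eqToHom_trans_assoc_refl h₁ _))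
  exact ⟨k, hk, _, hk'⟩

/-- Every cell factors through the component of the universal lift over the same cell. -/
lemma exists_comp_cellApp (h : IsUniversalLift α) {A A' C C' : E.Obj} {m : E.Hor A A'}
    {n : E.Hor C C'} (θ : Proarrow.mk m ⟶ Proarrow.mk n)
    {s : A ⟶ C} (hs : E.srcMap θ = s) {t : A' ⟶ C'} (ht : E.tgtMap θ = t) :
    ∃ k : Proarrow.mk m ⟶ Proarrow.mk (e'.hor (ofTotCell (P := P) θ hs ht)),
      k ≫ α.cellApp (ofTotCell (P := P) θ hs ht) = θ ∧
        ∃ h, P.cell k = eqToHom h := by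
  obtain ⟨h₁, h₂⟩ := h.cell_cellApp (ofTotCell (P := P) θ hs ht)
  obtain ⟨k, hk, hk'⟩ :=
    (h.isPointwiseCartesian.cellApp (ofTotCell (P := P) θ hs ht)).exists_lift θ
    (eqToHom h₁.symm) ((congrArg (eqToHom h₁.symm ≫ ·) h₂).trans (eqToHom_trans_assoc_refl h₁ _))
  exact ⟨k, hk, _, hk'⟩

/-- A Cartesian arrow, or pair of cells, differs from the components of the universal lift by an
isomorphism; for these components, `y` and `⊗` yield Cartesian cells up to the invertible `ι` and
`φ`. -/
lemma unitTensorPreserveCartesian (h : IsUniversalLift α) (he' : e'.IsPseudo) :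
    P.UnitTensorPreserveCartesian where
  unit {A C} f hf := by
    obtain ⟨k, hk, hk₁, hk₂⟩ := h.exists_comp_app f
    have hk' : IsIso k := by
      refine (h.isPointwiseCartesian.app _).isIso_of_comp ?_ ?_
      · rwa [hk]
      · rw [hk₂]; infer_instance
    have := he'.isIso_ι (ofArrow (P.F₀.map f))
    have h₁ : IsIso (E.yMap k) := inferInstanceAs (IsIso (E.unit.map k))
    have h₂ : E.yMap f = E.yMap k ≫ e'.ι (ofArrow (P.F₀.map f)) ≫ α.cellApp (CommaHor.unit _) :=
      (congrArg E.yMap hk).symm.trans ((E.yMap_comp _ _).trans (congrArg (E.yMap k ≫ ·)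
        (yMap_app α _)))
    have h₃ := (h.isPointwiseCartesian.cellApp _).iso_comp (e'.ι (ofArrow (P.F₀.map f)))
    exact property_of_eq (W := cartesianArrows P.F₁) h₂
      (@cartesianArrows.iso_comp _ _ _ _ _ _ _ _ (E.yMap k) h₁ _ h₃)
  tensor {M N} f hf := by
    let m := ofTotCell (P := P) f.fst rfl rfl
    let n := ofTotCell (P := P) f.snd f.w.symm rfl
    obtain ⟨k, hk, hk₁, hk₂⟩ := h.exists_comp_cellApp f.fst rfl rfl
    obtain ⟨l, hl, hl₁, hl₂⟩ := h.exists_comp_cellApp f.snd f.w.symm rfl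
    have hw : E.tgtMap (α.cellApp m) = E.srcMap (α.cellApp n) :=
      (α.tgt_cellApp m).trans (α.src_cellApp n).symm
    -- The two factors agree in the middle, because their common arrow is Cartesian.
    have hkl : E.tgtMap k = E.srcMap l := by
      refine (h.isPointwiseCartesian.app (ofArrow (P.F₀.map (E.tgtMap f.fst)))).hom_ext ?_ ?_
      · have hk' := (E.tgtMap_comp k (α.cellApp m)).symm.trans (congrArg E.tgtMap hk)
        have hl' := (E.srcMap_comp l (α.cellApp n)).symm.trans (congrArg E.srcMap hl)
        exact (congrArg (_ ≫ ·) (α.tgt_cellApp m).symm).trans (hk'.trans (f.w.trans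
          (hl'.symm.trans (congrArg (_ ≫ ·) (α.src_cellApp n)))))
      · exact (P.tgt_cell k).symm.trans ((congrArg B.tgtMap hk₂).trans ((B.tgtMap_eqToHom _).trans
          ((B.srcMap_eqToHom _).symm.trans ((congrArg B.srcMap hl₂).symm.trans (P.src_cell l)))))
    let a : (⟨e'.hor m, e'.hor n⟩ : E.Pair) ⟶ N := ⟨α.cellApp m, α.cellApp n, hw⟩
    let g : M ⟶ ⟨e'.hor m, e'.hor n⟩ := ⟨k, l, hkl⟩
    have hga : g ≫ a = f := DoubleCat.PairHom.ext hk hl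
    have ha : cartesianArrows P.F₂ a := P.cartesianArrows_pair a
      (h.isPointwiseCartesian.cellApp m) (h.isPointwiseCartesian.cellApp n) (by
        change cartesianArrows P.F₀ (E.tgtMap (α.cellApp m))
        rw [α.tgt_cellApp]
        exact h.isPointwiseCartesian.app _)
    have hg : IsIso g := by
      refine ha.isIso_of_comp (by rwa [hga]) (DoubleCat.isIso_pair _ ?_ ?_)
      · change IsIso (P.cell k)
        rw [hk₂]; infer_instance
      · change IsIso (P.cell l)
        rw [hl₂]; infer_instance
    have := he'.isIso_φ m n
    have h₁ : IsIso (E.tensMap k l hkl) := inferInstanceAs (IsIso (E.tensor.map g))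
    have h₂ : E.tensMap f.fst f.snd f.w = E.tensMap k l hkl ≫ e'.φ m n ≫
        α.cellApp (CommaHor.tens m n) := by
      exact (congrArg E.tensor.map hga).symm.trans ((E.tensor.map_comp g a).trans
        (congrArg (_ ≫ ·) (tensMap_cellApp α m n hw)))
    have h₃ := (h.isPointwiseCartesian.cellApp _).iso_comp (e'.φ m n)
    exact property_of_eq (W := cartesianArrows P.F₁) h₂
      (@cartesianArrows.iso_comp _ _ _ _ _ _ _ _ (E.tensMap k l hkl) h₁ _ h₃)

end IsUniversalLift

end commaDoubleCat

open VertTrans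

theorem mainTheorem2 {E B : DoubleCat.{v, max u v}} (P : LaxDoubleFunctor E B) (hP : P.IsPseudo) :
    (IsInternalFibration P.toDblLax ↔
      (IsFibration P.F₀ ∧ IsFibration P.F₁) ∧
        ∃ (c₀ : Cleavage P.F₀) (c₁ : Cleavage P.F₁), P.SrcTgtPreserveCleavages c₀ c₁) ∧
    (IsInternalFibration (P.toDbl hP) ↔
      (IsFibration P.F₀ ∧ IsFibration P.F₁) ∧
        (∃ (c₀ : Cleavage P.F₀) (c₁ : Cleavage P.F₁), P.SrcTgtPreserveCleavages c₀ c₁) ∧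
          P.UnitTensorPreserveCartesian) ∧
    (∀ hS : P.IsStrict, IsInternalFibration (P.toDblStrict hS) ↔
      (IsFibration P.F₀ ∧ IsFibration P.F₁) ∧
        ∃ (c₀ : Cleavage P.F₀) (c₁ : Cleavage P.F₁),
          P.SrcTgtPreserveCleavages c₀ c₁ ∧ P.UnitTensorPreserveCleavages c₀ c₁) := by
  refine ⟨⟨fun H => ?_, fun H => ?_⟩, ⟨fun H => ?_, fun H => ?_⟩,
    fun hS => ⟨fun H => ?_, fun H => ?_⟩⟩
  · obtain ⟨e', α, -, h⟩ := commaDoubleCat.exists_isUniversalLift (k := .lax) hP True.intro H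
    exact ⟨⟨h.cleavage₀.isFibration, h.cleavage₁.isFibration⟩, _, _, h.srcTgtPreserveCleavages⟩
  · obtain ⟨-, c₀, c₁, hc⟩ := H
    refine isInternalFibration_of_exists_lift (k := .lax) hP True.intro
      fun X e b β he hb => ?_
    obtain ⟨e', α, hb', hβ, h₀, h₁⟩ := exists_lift_of_cleavages hP hc β
    exact ⟨e', α, hb', hβ, ⟨fun A => (h₀ A).cartesian, fun m => (h₁ m).cartesian⟩, True.intro⟩
  · obtain ⟨e', α, he', h⟩ := commaDoubleCat.exists_isUniversalLift (k := .pseudo) hP hP H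
    exact ⟨⟨h.cleavage₀.isFibration, h.cleavage₁.isFibration⟩, ⟨_, _, h.srcTgtPreserveCleavages⟩,
      h.unitTensorPreserveCartesian he'⟩
  · obtain ⟨-, ⟨c₀, c₁, hc⟩, hU⟩ := H
    refine isInternalFibration_of_exists_lift (k := .pseudo) hP hP fun X e b β he hb => ?_
    obtain ⟨e', α, rfl, hβ, h₀, h₁⟩ := exists_lift_of_cleavages hP hc β
    have hα : IsPointwiseCartesian P α := ⟨fun A => (h₀ A).cartesian, fun m => (h₁ m).cartesian⟩
    exact ⟨e', α, rfl, hβ, hα, isPseudo_of_isPointwiseCartesian hP hU he hb hα⟩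
  · obtain ⟨e', α, he', h⟩ := commaDoubleCat.exists_isUniversalLift (k := .strict) hP hS H
    exact ⟨⟨h.cleavage₀.isFibration, h.cleavage₁.isFibration⟩, _, _, h.srcTgtPreserveCleavages,
      h.unitTensorPreserveCleavages he'⟩
  · obtain ⟨-, c₀, c₁, hc, hU⟩ := H
    refine isInternalFibration_of_exists_lift (k := .strict) hP hS fun X e b β he hb => ?_
    obtain ⟨e', α, rfl, hβ, h₀, h₁⟩ := exists_lift_of_cleavages hP hc β
    exact ⟨e', α, rfl, hβ, ⟨fun A => (h₀ A).cartesian, fun m => (h₁ m).cartesian⟩,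
      isStrict_of_arrows hS hU he hb h₀ h₁⟩

end
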